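/- Let $V$ be a finite or countably infinite set and let $P$ be a stochastic matrix on $V$. Put independent Poisson clocks of rate $1$ on the vertices of $V$, and let $X(t)$ be the continuous time walk started at a vertex $o\in V$ that moves exactly when the clock of its current vertex rings and then moves from $v$ to $u$ with probability $P_{vu}$, independently of the clocks. Let $\mathcal F_t$ be the $\sigma$-algebra generated by the clock rings up to time $t$, and let $$m_t(v)=\mathbb P\big(X(t)=v\mid \mathcal F_t,\ X(0)=o\big)$$ be the fragmentation process originating at $o$. Suppose that there is a constant $C_0>0$ such that $\sup_{u,v}P^k_{uv}\le C_0k^{-1/2}$ for every integer $1\le k\le |V|^2$ (for every integer $k\ge 1$ if $V$ is infinite). Suppose also that $P$ is reversible with respect to a positive measure $\pi$ on $V$, that is, $\pi_v>0$ and $\pi_vP_{vw}=\pi_wP_{wv}$ for all $v,w\in V$, and that $\Delta=\sup_{v,u\in V}\pi_v/\pi_u<\infty$. Then there is a constant $C$, depending only on $C_0$ and $\Delta$, such that for every $o\in V$ and all $0<t\le |V|^2/3$ (all $t>0$ if $V$ is infinite) $$\mathbb E\Big[\sum_{v\in V}m_t(v)^2\Big]\le C\,t^{-1/2}.$$ The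 rate $t^{-1/2}$ is optimal: the simple random walk on $\mathbb Z$ satisfies all these hypotheses (with $\pi\equiv1$, $\Delta=1$ and some $C_0$), and for it there is a constant $c>0$ such that $\mathbb E\big[\sum_{v}m_t(v)^2\big]\ge c\,t^{-1/2}$ for every starting vertex and all $t\ge 1$. -/

import Mathlib

open MeasureTheory ProbabilityTheory
open scoped ENNReal

noncomputable section

/-! ### Networks -/

/-- `P` is a stochastic matrix on the (finite or countably infinite) set `V`. -/
structure IsStochasticMatrix {V : Type*} (P : V → V → ℝ) : Prop where
  nonneg : ∀ u v, 0 ≤ P u v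
  row_sum : ∀ u, HasSum (P u) 1

open Classical in
/-- The entry `P^k_{uv}` of the `k`-th power of `P`. -/
def stepProb {V : Type*} (P : V → V → ℝ) : ℕ → V → V → ℝ
  | 0, u, v => if u = v then 1 else 0
  | k + 1, u, v => ∑' w, P u w * stepProb P k w v

/-- Square root decay of the transition probabilities: `P^k_{uv} ≤ C₀ k^{-1/2}` for all `u, v` and
all positive integers `k ≤ |V|²` (all positive integers `k` if `V` is infinite). -/
def HasSqrtDecay {V : Type*} (P : V → V → ℝ) (C₀ : ℝ) : Prop :=
  0 < C₀ ∧ ∀ k : ℕ, 1 ≤ k → (Finite V → k ≤ Nat.card V ^ 2) →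
    ∀ u v, stepProb P k u v ≤ C₀ * (k : ℝ) ^ (-(1 / 2) : ℝ)

/-- `P` is reversible with respect to the positive (not necessarily finite) measure `π` on `V`.
Summing over `v` shows that `π` is then stationary. -/
structure IsReversibleWrt {V : Type*} (P : V → V → ℝ) (π : V → ℝ) : Prop where
  pos : ∀ v, 0 < π v
  detailed_balance : ∀ v w, π v * P v w = π w * P w v

/-- `Δ = sup_{v,u} π_v / π_u`. -/
def IsSupRatio {V : Type*} (π : V → ℝ) (Δ : ℝ) : Prop :=
  IsLUB (Set.range fun p : V × V => π p.1 / π p.2) Δ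

/-! ### Poisson clocks, walks and fragmentation -/

section Walk

variable {V Ω : Type*}

/-- The time of the `k`-th ring (`k = 0, 1, …`) of the clock at `v`, where `gap v 0` is the waiting
time until the first ring of that clock and `gap v (k + 1)` is the time between the rings number `k`
and `k + 1`. -/
def ringTime (gap : V → ℕ → Ω → ℝ) (v : V) (k : ℕ) (ω : Ω) : ℝ :=
  ∑ i ∈ Finset.range (k + 1), gap v i ω

/-- The clocks on the vertices are independent Poisson processes of rate one: all the
waiting times are independent exponential random variables of parameter one. -/
structure IsUnitPoissonClocks [MeasurableSpace Ω] (μ : Measure Ω) (gap : V → ℕ → Ω → ℝ) :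
    Prop where
  measurable : ∀ v k, Measurable (gap v k)
  law : ∀ v k, μ.map (gap v k) = expMeasure 1
  indep : iIndepFun (fun (i : V × ℕ) (ω : Ω) => gap i.1 i.2 ω) μ

/-- `Y 0, Y 1, …` is a discrete time Markov chain on `V` with transition matrix `P`, started
at `o`. -/
structure IsMarkovChainFrom [MeasurableSpace V] [MeasurableSpace Ω] (μ : Measure Ω)
    (P : V → V → ℝ) (o : V) (Y : ℕ → Ω → V) : Prop where
  measurable : ∀ n, Measurable (Y n)
  start : ∀ᵐ ω ∂μ, Y 0 ω = o
  path : ∀ (n : ℕ) (y : ℕ → V), y 0 = o →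
    μ.real {ω | ∀ i ≤ n, Y i ω = y i} = ∏ i ∈ Finset.range n, P (y i) (y (i + 1))

/-- The randomness behind the continuous time Markov chain started at `o`: independent unit Poisson
clocks on the vertices and, independently of the clocks, the trajectory of a Markov chain with
transition matrix `P`. -/
structure IsClockedWalk [MeasurableSpace V] [MeasurableSpace Ω] (μ : Measure Ω)
    (P : V → V → ℝ) (o : V) (gap : V → ℕ → Ω → ℝ) (Y : ℕ → Ω → V) : Prop where
  clocks : IsUnitPoissonClocks μ gap
  chain : IsMarkovChainFrom μ P o Y
  indep : IndepFun (fun ω (i : V × ℕ) => gap i.1 i.2 ω) (fun ω (n : ℕ) => Y n ω) μ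

/-- The time of the `n`-th move: the walk moves away from its current vertex (to the next vertex of
its trajectory, which may be the same vertex) when the clock of that vertex rings. -/
def moveTime (gap : V → ℕ → Ω → ℝ) (Y : ℕ → Ω → V) : ℕ → Ω → ℝ
  | 0, _ => 0
  | n + 1, ω => sInf {s : ℝ | moveTime gap Y n ω < s ∧ ∃ k, ringTime gap (Y n ω) k ω = s}

/-- The position `X(t)` of the continuous time Markov chain: the vertex of the trajectory that is
reached after all the moves made up to time `t` (almost surely, these are finitely many). -/
def walkPosition (gap : V → ℕ → Ω → ℝ) (Y : ℕ → Ω → V) (t : ℝ) (ω : Ω) : V :=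
  Y (sSup {n : ℕ | moveTime gap Y n ω ≤ t}) ω

/-- The σ-algebra generated by the clock rings up to time `t`. -/
abbrev clockSigma (gap : V → ℕ → Ω → ℝ) (t : ℝ) : MeasurableSpace Ω :=
  MeasurableSpace.generateFrom
    {A | ∃ (v : V) (k : ℕ) (s : ℝ), s ≤ t ∧ A = {ω | ringTime gap v k ω ≤ s}}

/-- The fragmentation process: `m_t(v)` is the conditional probability of `X(t) = v` given the clock
rings up to time `t`. -/
def fragmentation [MeasurableSpace Ω] (μ : Measure Ω) (gap : V → ℕ → Ω → ℝ) (Y : ℕ → Ω → V)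
    (t : ℝ) (v : V) : Ω → ℝ :=
  μ[Set.indicator {ω | walkPosition gap Y t ω = v} (fun _ => (1 : ℝ)) | clockSigma gap t]

/-- `E[∑ᵥ m_t(v)²]`, as an extended nonnegative real number. -/
def fragmentationSecondMoment [MeasurableSpace Ω] (μ : Measure Ω) (gap : V → ℕ → Ω → ℝ)
    (Y : ℕ → Ω → V) (t : ℝ) : ℝ≥0∞ :=
  ∫⁻ ω, ∑' v, ENNReal.ofReal (fragmentation μ gap Y t v ω ^ 2) ∂μ

end Walk

/-- The transition matrix of the simple random walk on the line graph `ℤ`. -/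
def lineWalk (u v : ℤ) : ℝ := if |u - v| = 1 then 1 / 2 else 0

/-- Clocks and a trajectory as in `IsClockedWalk` exist for every stochastic matrix. -/
theorem exists_isClockedWalk.{u} {V : Type u} [Countable V] [MeasurableSpace V]
    [DiscreteMeasurableSpace V] (P : V → V → ℝ) (hP : IsStochasticMatrix P) (o : V) :
    ∃ (Ω : Type u) (_ : MeasurableSpace Ω) (μ : Measure Ω) (_ : IsProbabilityMeasure μ)
      (gap : V → ℕ → Ω → ℝ) (Y : ℕ → Ω → V), IsClockedWalk μ P o gap Y := by
  classical
  let row : V → PMF V := fun u => ⟨fun v => ENNReal.ofReal (P u v), by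
    have h := hP.row_sum u
    have := ENNReal.ofReal_tsum_of_nonneg (hP.nonneg u) h.summable
    rw [h.tsum_eq, ENNReal.ofReal_one] at this
    rw [this]
    exact ENNReal.summable.hasSum⟩
  have : IsProbabilityMeasure (expMeasure 1) := isProbabilityMeasure_expMeasure one_pos
  let μ1 : Measure (V × ℕ → ℝ) := Measure.infinitePi fun _ => expMeasure 1
  let μ2 : Measure (ℕ × V → V) := Measure.infinitePi fun i => (row i.2).toMeasure
  let W : ℕ → (ℕ × V → V) → V := fun n U => Nat.rec o (fun k y => U (k, y)) n
  have hW0 : ∀ U, W 0 U = o := fun _ => rfl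
  have hWs : ∀ n U, W (n+1) U = U (n, W n U) := fun _ _ => rfl
  have hWm : ∀ n, Measurable (W n) := by
    intro n
    induction n with
    | zero => exact measurable_const
    | succ n ih =>
      refine measurable_to_countable' fun v => ?_
      have : W (n+1) ⁻¹' {v} = ⋃ w, (W n ⁻¹' {w} ∩ {U | U (n, w) = v}) := by
        ext U; simp [hWs]
      rw [this]
      refine MeasurableSet.iUnion fun w => (ih (measurableSet_singleton w)).inter ?_
      exact (measurable_pi_apply (X := fun _ : ℕ × V => V) (n, w)) (measurableSet_singleton v)
  have hWall : Measurable fun (U : ℕ × V → V) (n : ℕ) => W n U := measurable_pi_iff.2 hWm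
  refine ⟨(V × ℕ → ℝ) × (ℕ × V → V), inferInstance, μ1.prod μ2, inferInstance,
    fun v k ω => ω.1 (v, k), fun n ω => W n ω.2, ?_, ?_, ?_⟩
  · have hfst : (μ1.prod μ2).map Prod.fst = μ1 := by simp
    refine ⟨fun v k => by fun_prop, fun v k => ?_, ?_⟩
    · have : (fun ω : (V × ℕ → ℝ) × (ℕ × V → V) => ω.1 (v, k)) =
        (fun x : V × ℕ → ℝ => x (v,k)) ∘ Prod.fst := rfl
      rw [this, ← Measure.map_map (by fun_prop) (by fun_prop), hfst]
      exact Measure.infinitePi_map_eval _ _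
    · rw [iIndepFun_iff_map_fun_eq_infinitePi_map (by fun_prop)]
      have h1 : ∀ i : V × ℕ, (μ1.prod μ2).map (fun ω => ω.1 (i.1, i.2)) = expMeasure 1 := by
        intro i
        have : (fun ω : (V × ℕ → ℝ) × (ℕ × V → V) => ω.1 (i.1, i.2)) =
          (fun x : V × ℕ → ℝ => x (i.1,i.2)) ∘ Prod.fst := rfl
        rw [this, ← Measure.map_map (by fun_prop) (by fun_prop), hfst]
        exact Measure.infinitePi_map_eval _ _
      simp only [h1]
      exact hfst
  · refine ⟨fun n => (hWm n).comp measurable_snd, ae_of_all _ fun ω => rfl, fun n y hy => ?_⟩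
    have hset : {ω : (V × ℕ → ℝ) × (ℕ × V → V) | ∀ i ≤ n, W i ω.2 = y i} =
        Set.univ ×ˢ {U | ∀ i ≤ n, W i U = y i} := by ext; simp
    have hset2 : {U : ℕ × V → V | ∀ i ≤ n, W i U = y i} =
        Set.pi ((Finset.range n).image fun i => (i, y i) : Finset (ℕ × V))
          (fun p => {y (p.1 + 1)}) := by
      ext U
      simp only [Set.mem_ofPred_eq, Set.mem_pi, Finset.coe_image, Set.mem_image, Finset.mem_coe,
        Finset.mem_range, Set.mem_singleton_iff, forall_exists_index, and_imp]
      constructor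
      · rintro h _ i hi rfl
        have := h (i+1) hi
        rw [hWs, h i hi.le] at this
        exact this
      · intro h i
        induction i with
        | zero => intro _; rw [hW0, hy]
        | succ i ih =>
          intro hi
          rw [hWs, ih (by omega)]
          exact h _ i (by omega) rfl
    rw [hset, measureReal_def, Measure.prod_prod, hset2, Measure.infinitePi_pi]
    · rw [Finset.prod_image (by intro a _ b _ h; exact (Prod.ext_iff.1 h).1)]
      simp only [measure_univ, one_mul, ENNReal.toReal_prod]
      refine Finset.prod_congr rfl fun i _ => ?_
      rw [PMF.toMeasure_apply_singleton _ _ (measurableSet_singleton _)]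
      exact ENNReal.toReal_ofReal (hP.nonneg _ _)
    · intro i _; exact measurableSet_singleton _
  · exact indepFun_prod (μ := μ1) (ν := μ2) (X := fun x => fun i : V × ℕ => x (i.1, i.2))
      (Y := fun U n => W n U) (by fun_prop) hWall

end

/-! Take two walks that use the same clocks and move independently given the clocks. Their
probability of meeting at time `t` is the second moment of the fragmentation, so the upper bound is
a decay estimate for a collision probability. The pair is itself a Markov chain: two walks apart
jump one at a time, each at rate 1, and two walks together jump at the same ring. Only this
interaction on the diagonal separates the pair from two independent walks.

Put `L = (1 + P) / 2`, make the pair discrete at rate four with step operator `T`, and apply `T` to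
`k_r(x, y) = L^r(x, y) / π(y)`. Off the diagonal, reversibility makes a jump of either coordinate
act as `P`, so `T k_r = k_{r+1}`. On the diagonal, `(3 + P²) / 4 = L + (1 - L)²` leaves an excess
`h_r(x) k_0`, where `h_r(x)` is the `(x, x)` entry of `(1 - L)² L^r` (`pairStep_lazyKernel`).
Iteration gives the Duhamel formula `T^N k_0 = k_N + ∑_s T^s (h_{N-1-s} k_0)`.

Because `P` is a self-adjoint contraction of `ℓ²(π)`, one has `0 ≤ L ≤ 1` and the return
probabilities of `L` are completely monotone (`polyEntry_lazy_pow_mul_nonneg`). Hence `h_r ≥ 0`, `∑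
h_r ≤ 1/2` and `h_r ≤ 4 / (r + 1)²`. The renewal equation is therefore subcritical: convolution with
`h` shrinks the slowly varying summable weight `w = slowWeight` by the factor 24/25
(`sum_slowWeight_mul_le`), and the excess in `∑ w(N - n) T^n k_0` is absorbed by that sum itself
(`pairStep_iterate_le_sum`). What remains is a `w`-average of `L^n(x, x) / π(x)`, which inherits the
square root decay of `P`.

Poisson averaging of `T^N` returns to continuous time (`exists_pairFlow_le`), and decomposing at the
first ring shows that the result dominates the collision probabilities (`collision_le_pairFlow`).
The ratio `Δ` pays for replacing the weights `1 / π(v)` by a constant.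

For the lower bound, `E[m_t(v)²] ≥ P(X(t) = v)²`, and the walk on `ℤ` has variance `t`, so half of
its mass lies on order `√t` sites. -/

/-! ### Powers of a stochastic matrix -/

/-- A nonnegative family whose extended sum is finite has this sum in the reals. -/
theorem hasSum_of_tsum_ofReal {ι : Type*} {f : ι → ℝ} {c : ℝ} (hf : ∀ i, 0 ≤ f i) (hc : 0 ≤ c)
    (h : ∑' i, ENNReal.ofReal (f i) = ENNReal.ofReal c) : HasSum f c := by
  have hs : Summable f := by
    have := ENNReal.summable_toReal (f := fun i => ENNReal.ofReal (f i))
      (by rw [h]; exact ENNReal.ofReal_ne_top)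
    simpa [ENNReal.toReal_ofReal, hf] using this
  have h2 := ENNReal.ofReal_tsum_of_nonneg hf hs
  rw [h] at h2
  have h3 : ∑' i, f i = c := (ENNReal.ofReal_eq_ofReal_iff (tsum_nonneg hf) hc).1 h2
  exact h3 ▸ hs.hasSum

theorem tsum_ofReal_eq {ι : Type*} {f : ι → ℝ} {c : ℝ} (hf : ∀ i, 0 ≤ f i)
    (h : HasSum f c) : ∑' i, ENNReal.ofReal (f i) = ENNReal.ofReal c := by
  rw [← ENNReal.ofReal_tsum_of_nonneg hf h.summable, h.tsum_eq]

section Powers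

variable {V : Type*} {P : V → V → ℝ}

theorem stepProb_nonneg (hP : IsStochasticMatrix P) (k : ℕ) (u v : V) : 0 ≤ stepProb P k u v := by
  induction k generalizing u with
  | zero => unfold stepProb; split_ifs <;> norm_num
  | succ k ih => exact tsum_nonneg fun w => mul_nonneg (hP.nonneg _ _) (ih w)

theorem stepProb_le_one (hP : IsStochasticMatrix P) (k : ℕ) (u v : V) : stepProb P k u v ≤ 1 := by
  induction k generalizing u with
  | zero => unfold stepProb; split_ifs <;> norm_num
  | succ k ih =>
    have h1 : ∀ w, P u w * stepProb P k w v ≤ P u w := fun w =>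
      mul_le_of_le_one_right (hP.nonneg _ _) (ih w)
    have hs : Summable fun w => P u w * stepProb P k w v :=
      Summable.of_nonneg_of_le (fun w => mul_nonneg (hP.nonneg _ _) (stepProb_nonneg hP k w v)) h1
        (hP.row_sum u).summable
    exact (hs.tsum_le_tsum h1 (hP.row_sum u).summable).trans (hP.row_sum u).tsum_eq.le

theorem hasSum_stepProb_succ (hP : IsStochasticMatrix P) (k : ℕ) (u v : V) :
    HasSum (fun w => P u w * stepProb P k w v) (stepProb P (k + 1) u v) :=
  (Summable.of_nonneg_of_le (fun w => mul_nonneg (hP.nonneg _ _) (stepProb_nonneg hP k w v))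
    (fun w => mul_le_of_le_one_right (hP.nonneg _ _) (stepProb_le_one hP k w v))
    (hP.row_sum u).summable).hasSum

/-- The powers of `P` with extended nonnegative entries. -/
noncomputable def eStepProb (P : V → V → ℝ) (k : ℕ) (u v : V) : ℝ≥0∞ :=
  ENNReal.ofReal (stepProb P k u v)

theorem eStepProb_zero [DecidableEq V] (u v : V) :
    eStepProb P 0 u v = if u = v then 1 else 0 := by
  unfold eStepProb stepProb
  split_ifs <;> simp

theorem eStepProb_succ (hP : IsStochasticMatrix P) (k : ℕ) (u v : V) :
    eStepProb P (k + 1) u v = ∑' w, ENNReal.ofReal (P u w) * eStepProb P k w v := by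
  unfold eStepProb
  rw [← tsum_ofReal_eq (fun w => mul_nonneg (hP.nonneg _ _) (stepProb_nonneg hP k w v))
    (hasSum_stepProb_succ hP k u v)]
  exact tsum_congr fun w => ENNReal.ofReal_mul (hP.nonneg _ _)

theorem tsum_ofReal_row (hP : IsStochasticMatrix P) (u : V) :
    ∑' w, ENNReal.ofReal (P u w) = 1 := by
  rw [tsum_ofReal_eq (hP.nonneg u) (hP.row_sum u), ENNReal.ofReal_one]

theorem eStepProb_add (hP : IsStochasticMatrix P) (i j : ℕ) (u v : V) :
    eStepProb P (i + j) u v = ∑' w, eStepProb P i u w * eStepProb P j w v := by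
  classical
  induction i generalizing u with
  | zero =>
    rw [tsum_eq_single u (fun w hw => by rw [eStepProb_zero, if_neg hw.symm, zero_mul]),
      eStepProb_zero, if_pos rfl, one_mul, zero_add]
  | succ i ih =>
    rw [show i + 1 + j = (i + j) + 1 by ring, eStepProb_succ hP]
    simp_rw [ih, ← ENNReal.tsum_mul_left]
    rw [ENNReal.tsum_comm]
    refine tsum_congr fun z => ?_
    rw [eStepProb_succ hP, ← ENNReal.tsum_mul_right]
    exact tsum_congr fun w => by rw [mul_assoc]

theorem tsum_eStepProb (hP : IsStochasticMatrix P) (k : ℕ) (u : V) :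
    ∑' v, eStepProb P k u v = 1 := by
  classical
  induction k generalizing u with
  | zero =>
    rw [tsum_eq_single u (fun w hw => by rw [eStepProb_zero, if_neg hw.symm]),
      eStepProb_zero, if_pos rfl]
  | succ k ih =>
    simp_rw [eStepProb_succ hP]
    rw [ENNReal.tsum_comm]
    simp_rw [ENNReal.tsum_mul_left, ih, mul_one, tsum_ofReal_row hP]

theorem hasSum_stepProb_add (hP : IsStochasticMatrix P) (i j : ℕ) (u v : V) :
    HasSum (fun w => stepProb P i u w * stepProb P j w v) (stepProb P (i + j) u v) := by
  refine hasSum_of_tsum_ofReal (fun w => mul_nonneg (stepProb_nonneg hP _ _ _)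
    (stepProb_nonneg hP _ _ _)) (stepProb_nonneg hP _ _ _) ?_
  have := eStepProb_add hP i j u v
  unfold eStepProb at this
  rw [this]
  exact tsum_congr fun w => ENNReal.ofReal_mul (stepProb_nonneg hP _ _ _)

theorem hasSum_stepProb (hP : IsStochasticMatrix P) (k : ℕ) (u : V) :
    HasSum (fun v => stepProb P k u v) 1 :=
  hasSum_of_tsum_ofReal (fun _ => stepProb_nonneg hP _ _ _) zero_le_one
    (by rw [ENNReal.ofReal_one]; exact tsum_eStepProb hP k u)

theorem stepProb_one (u v : V) : stepProb P 1 u v = P u v := by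
  classical
  simp only [stepProb]
  rw [tsum_eq_single v (fun w hw => by rw [if_neg hw, mul_zero]), if_pos rfl, mul_one]

theorem hasSum_stepProb_succ' (hP : IsStochasticMatrix P) (k : ℕ) (u v : V) :
    HasSum (fun w => stepProb P k u w * P w v) (stepProb P (k + 1) u v) := by
  simpa only [stepProb_one] using hasSum_stepProb_add hP k 1 u v

theorem stepProb_reversible {π : V → ℝ} (hP : IsStochasticMatrix P) (hπ : IsReversibleWrt P π)
    (k : ℕ) (u v : V) : π u * stepProb P k u v = π v * stepProb P k v u := by
  induction k generalizing u v with
  | zero =>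
    unfold stepProb
    by_cases h : u = v
    · subst h; rfl
    · rw [if_neg h, if_neg (Ne.symm h), mul_zero, mul_zero]
  | succ k ih =>
    refine ((hasSum_stepProb_succ hP k u v).mul_left (π u)).unique ?_
    -- One side is split at its first step and the other at its last step, so that reversing the
    -- path matches the terms.
    refine ((hasSum_stepProb_succ' hP k v u).mul_left (π v)).congr_fun fun w => ?_
    rw [← mul_assoc, hπ.detailed_balance, mul_assoc, mul_left_comm, ih, mul_left_comm,
      mul_comm (P w u)]

end Powers

/-! ### Polynomials in a stochastic matrix -/

section Poly

open Polynomial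

variable {V : Type*} {P : V → V → ℝ}

/-- The entry at `(u, v)` of a polynomial in `P`. -/
noncomputable def polyEntry (P : V → V → ℝ) (u v : V) : ℝ[X] →ₗ[ℝ] ℝ :=
  Polynomial.lsum fun k => LinearMap.mulRight ℝ (stepProb P k u v)

theorem polyEntry_monomial (u v : V) (k : ℕ) (a : ℝ) :
    polyEntry P u v (monomial k a) = a * stepProb P k u v := by
  simp [polyEntry, Polynomial.lsum_apply, Polynomial.sum_monomial_index]

theorem polyEntry_X_pow (u v : V) (k : ℕ) : polyEntry P u v (X ^ k) = stepProb P k u v := by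
  rw [X_pow_eq_monomial, polyEntry_monomial, one_mul]

theorem polyEntry_one (u : V) : polyEntry P u u 1 = 1 := by
  have h := polyEntry_X_pow (P := P) u u 0
  rw [pow_zero] at h
  rw [h, stepProb, if_pos rfl]

/-- Evaluation at `P` turns products of polynomials into matrix products. Operator identities
between functions of `P` thus become identities in `ℝ[X]`, which `ring` can check. -/
theorem hasSum_polyEntry_mul (hP : IsStochasticMatrix P) (p q : ℝ[X]) (u v : V) :
    HasSum (fun w => polyEntry P u w p * polyEntry P w v q) (polyEntry P u v (p * q)) := by
  induction p using Polynomial.induction_on' with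
  | add p₁ p₂ h₁ h₂ => simpa [add_mul] using h₁.add h₂
  | monomial i a =>
    induction q using Polynomial.induction_on' with
    | add q₁ q₂ h₁ h₂ => simpa [mul_add] using h₁.add h₂
    | monomial j b =>
      simp only [monomial_mul_monomial, polyEntry_monomial]
      refine ((hasSum_stepProb_add hP i j u v).mul_left (a * b)).congr_fun fun w => ?_
      ring

theorem hasSum_polyEntry_X_mul (hP : IsStochasticMatrix P) (q : ℝ[X]) (u v : V) :
    HasSum (fun w => P u w * polyEntry P w v q) (polyEntry P u v (X * q)) := by
  refine (hasSum_polyEntry_mul hP X q u v).congr_fun fun w => ?_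
  have h := polyEntry_X_pow (P := P) u w 1
  rw [pow_one, stepProb_one] at h
  rw [h]

theorem polyEntry_reversible {π : V → ℝ} (hP : IsStochasticMatrix P) (hπ : IsReversibleWrt P π)
    (p : ℝ[X]) (u v : V) : π u * polyEntry P u v p = π v * polyEntry P v u p := by
  induction p using Polynomial.induction_on' with
  | add p₁ p₂ h₁ h₂ => simp [mul_add, h₁, h₂]
  | monomial i a =>
    simp only [polyEntry_monomial]
    rw [mul_left_comm, stepProb_reversible hP hπ, mul_left_comm]

/-- Self-adjointness in `ℓ²(π)`: the inner product of the `x` columns of `p(P)` and `q(P)` is a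
diagonal entry of `(p q)(P)`. Positivity statements about operators are read off from such entries.
-/
theorem hasSum_mul_polyEntry_mul {π : V → ℝ} (hP : IsStochasticMatrix P)
    (hπ : IsReversibleWrt P π) (p q : ℝ[X]) (x : V) :
    HasSum (fun v => π v * (polyEntry P v x p * polyEntry P v x q))
      (π x * polyEntry P x x (p * q)) := by
  refine ((hasSum_polyEntry_mul hP p q x x).mul_left (π x)).congr_fun fun v => ?_
  rw [← mul_assoc, ← polyEntry_reversible hP hπ, mul_assoc]

theorem polyEntry_sq_nonneg {π : V → ℝ} (hP : IsStochasticMatrix P) (hπ : IsReversibleWrt P π)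
    (p : ℝ[X]) (x : V) : 0 ≤ polyEntry P x x (p * p) := by
  have h := (hasSum_mul_polyEntry_mul hP hπ p p x).nonneg fun v =>
    mul_nonneg (hπ.pos v).le (mul_self_nonneg _)
  exact nonneg_of_mul_nonneg_right h (hπ.pos x)

/-- The operator `P` is a contraction of the weighted `ℓ²` space. -/
theorem abs_polyEntry_X_mul_sq_le {π : V → ℝ} (hP : IsStochasticMatrix P)
    (hπ : IsReversibleWrt P π) (p : ℝ[X]) (x : V) :
    |polyEntry P x x (X * (p * p))| ≤ polyEntry P x x (p * p) := by
  set g : V → ℝ := fun v => polyEntry P v x p with hg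
  have h0 := hasSum_mul_polyEntry_mul hP hπ p p x
  have h1 := hasSum_mul_polyEntry_mul hP hπ p (X * p) x
  have hX : ∀ v, HasSum (fun w => P v w * g w) (polyEntry P v x (X * p)) := fun v =>
    hasSum_polyEntry_X_mul hP p v x
  -- Stationarity of `π` tested on `g²`. Working in `ℝ≥0∞` allows the exchange of sums before any
  -- summability is known; the summability of `P v w * g w ^ 2` in `w` is then deduced from it.
  have hE : ∑' v, ∑' w, ENNReal.ofReal (π v * (P v w * (g w * g w))) =
      ENNReal.ofReal (π x * polyEntry P x x (p * p)) := by
    rw [ENNReal.tsum_comm, ← tsum_ofReal_eq (fun v => mul_nonneg (hπ.pos v).le (mul_self_nonneg _)) h0]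
    refine tsum_congr fun w => ?_
    have : ∀ v, π v * (P v w * (g w * g w)) = π w * (g w * g w) * P w v := fun v => by
      rw [← mul_assoc, hπ.detailed_balance]; ring
    simp_rw [this]
    rw [tsum_ofReal_eq (fun v => mul_nonneg (mul_nonneg (hπ.pos w).le (mul_self_nonneg _))
      (hP.nonneg _ _)) ((hP.row_sum w).mul_left _), mul_one]
  have hsq : ∀ v, Summable fun w => P v w * (g w * g w) := by
    intro v
    have h2 : ∑' w, ENNReal.ofReal (π v * (P v w * (g w * g w))) ≠ ∞ := by
      refine ne_top_of_le_ne_top (b := ENNReal.ofReal (π x * polyEntry P x x (p * p)))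
        ENNReal.ofReal_ne_top ?_
      rw [← hE]; exact ENNReal.le_tsum v
    have h3 := ENNReal.summable_toReal h2
    have h4 : ∀ w, 0 ≤ π v * (P v w * (g w * g w)) := fun w =>
      mul_nonneg (hπ.pos v).le (mul_nonneg (hP.nonneg _ _) (mul_self_nonneg _))
    simp only [ENNReal.toReal_ofReal (h4 _)] at h3
    exact (summable_mul_left_iff (hπ.pos v).ne').1 h3
  have hnn : ∀ v, 0 ≤ ∑' w, P v w * (g w * g w) := fun v =>
    tsum_nonneg fun w => mul_nonneg (hP.nonneg _ _) (mul_self_nonneg _)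
  have h2 : HasSum (fun v => π v * ∑' w, P v w * (g w * g w)) (π x * polyEntry P x x (p * p)) := by
    refine hasSum_of_tsum_ofReal (fun v => mul_nonneg (hπ.pos v).le (hnn v))
      (mul_nonneg (hπ.pos x).le (polyEntry_sq_nonneg hP hπ p x)) ?_
    rw [← hE]
    refine tsum_congr fun v => ?_
    rw [← tsum_mul_left, ENNReal.ofReal_tsum_of_nonneg (fun w =>
      mul_nonneg (hπ.pos v).le (mul_nonneg (hP.nonneg _ _) (mul_self_nonneg _)))
      ((hsq v).mul_left _)]
  -- From `2 |g v * g w| ≤ g v ^ 2 + g w ^ 2`, averaged over the row `P v`.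
  have hpt : ∀ v, |g v * polyEntry P v x (X * p)| ≤
      (g v * g v + ∑' w, P v w * (g w * g w)) / 2 := by
    intro v
    have e1 := (hX v).mul_left (g v)
    have e2 : HasSum (fun w => P v w * ((g v * g v + g w * g w) / 2))
        ((g v * g v + ∑' w, P v w * (g w * g w)) / 2) := by
      have := (((hP.row_sum v).mul_left (g v * g v)).add (hsq v).hasSum).div_const 2
      rw [mul_one] at this
      refine this.congr_fun fun w => ?_
      ring
    rw [abs_le]
    constructor
    · refine hasSum_le (fun w => ?_) e2.neg e1
      nlinarith [mul_nonneg (hP.nonneg v w) (mul_self_nonneg (g v + g w))]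
    · refine hasSum_le (fun w => ?_) e1 e2
      nlinarith [mul_nonneg (hP.nonneg v w) (mul_self_nonneg (g v - g w))]
  have e3 := (h0.add h2).div_const 2
  have key : |π x * polyEntry P x x (p * (X * p))| ≤ π x * polyEntry P x x (p * p) := by
    have e4 : (π x * polyEntry P x x (p * p) + π x * polyEntry P x x (p * p)) / 2 =
      π x * polyEntry P x x (p * p) := by ring
    rw [e4] at e3
    rw [abs_le]
    constructor
    · refine hasSum_le (fun v => ?_) e3.neg h1
      have := mul_le_mul_of_nonneg_left (neg_le_of_abs_le (hpt v)) (hπ.pos v).le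
      simp only [hg] at this ⊢; linarith
    · refine hasSum_le (fun v => ?_) h1 e3
      have := mul_le_mul_of_nonneg_left (le_of_abs_le (hpt v)) (hπ.pos v).le
      simp only [hg] at this ⊢; linarith
  rw [abs_mul, abs_of_pos (hπ.pos x), show p * (X * p) = X * (p * p) by ring] at key
  exact le_of_mul_le_mul_left key (hπ.pos x)

end Poly

/-! ### Return probabilities of the lazy walk -/

section Lazy

open Polynomial

/-- The polynomial `(1 + X) / 2`, which turns `P` into its lazy version. -/
noncomputable def lazyPoly : ℝ[X] := C (1 / 2) * (1 + X)

theorem one_sub_lazyPoly : 1 - lazyPoly = C (1 / 2) * (1 - X) := by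
  have h : (C (1 / 2 : ℝ) * 2 : ℝ[X]) = 1 := by
    rw [show (2 : ℝ[X]) = C 2 from (map_ofNat C 2).symm, ← C_mul]; norm_num
  rw [lazyPoly]
  linear_combination -h

variable {V : Type*} {P : V → V → ℝ} {π : V → ℝ}

theorem polyEntry_C_mul (u v : V) (a : ℝ) (p : ℝ[X]) :
    polyEntry P u v (C a * p) = a * polyEntry P u v p := by
  rw [← smul_eq_C_mul, map_smul, smul_eq_mul]

theorem polyEntry_lazy_mul_sq_nonneg (hP : IsStochasticMatrix P) (hπ : IsReversibleWrt P π)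
    (p : ℝ[X]) (x : V) : 0 ≤ polyEntry P x x (lazyPoly * (p * p)) := by
  have h := neg_le_of_abs_le (abs_polyEntry_X_mul_sq_le hP hπ p x)
  rw [lazyPoly, mul_assoc, polyEntry_C_mul, add_mul, one_mul, map_add]
  linarith

theorem polyEntry_one_sub_lazy_mul_sq_nonneg (hP : IsStochasticMatrix P)
    (hπ : IsReversibleWrt P π) (p : ℝ[X]) (x : V) :
    0 ≤ polyEntry P x x ((1 - lazyPoly) * (p * p)) := by
  have h := le_of_abs_le (abs_polyEntry_X_mul_sq_le hP hπ p x)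
  rw [one_sub_lazyPoly, mul_assoc, polyEntry_C_mul, sub_mul, one_mul, map_sub]
  linarith

/-- The return probabilities of the lazy walk are completely monotone. -/
theorem polyEntry_lazy_pow_mul_nonneg (hP : IsStochasticMatrix P) (hπ : IsReversibleWrt P π)
    (i j : ℕ) (x : V) : 0 ≤ polyEntry P x x ((1 - lazyPoly) ^ i * lazyPoly ^ j) := by
  obtain ⟨a, rfl | rfl⟩ := Nat.even_or_odd' i <;> obtain ⟨b, rfl | rfl⟩ := Nat.even_or_odd' j
  -- Even powers are absorbed in a square, so only the parities of `i` and `j` matter.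
  · convert polyEntry_sq_nonneg hP hπ ((1 - lazyPoly) ^ a * lazyPoly ^ b) x using 2; ring
  · convert polyEntry_lazy_mul_sq_nonneg hP hπ ((1 - lazyPoly) ^ a * lazyPoly ^ b) x using 2; ring
  · convert polyEntry_one_sub_lazy_mul_sq_nonneg hP hπ ((1 - lazyPoly) ^ a * lazyPoly ^ b) x
      using 2; ring
  -- If both are odd, use `(1 - L) L = L (1 - L)² + (1 - L) L²`, a sum of two terms of the types
  -- already treated.
  · have h1 := polyEntry_lazy_mul_sq_nonneg hP hπ ((1 - lazyPoly) ^ (a + 1) * lazyPoly ^ b) x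
    have h2 := polyEntry_one_sub_lazy_mul_sq_nonneg hP hπ
      ((1 - lazyPoly) ^ a * lazyPoly ^ (b + 1)) x
    have h3 := add_nonneg h1 h2
    rw [← map_add] at h3
    refine h3.trans_eq (congrArg _ ?_)
    ring

/-- The second difference at time `r` of the return probabilities of the lazy walk. -/
noncomputable def lazySecondDiff (P : V → V → ℝ) (x : V) (r : ℕ) : ℝ :=
  polyEntry P x x ((1 - lazyPoly) ^ 2 * lazyPoly ^ r)

theorem lazySecondDiff_nonneg (hP : IsStochasticMatrix P) (hπ : IsReversibleWrt P π) (x : V)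
    (r : ℕ) : 0 ≤ lazySecondDiff P x r :=
  polyEntry_lazy_pow_mul_nonneg hP hπ 2 r x

/-- A factor `1 - L` is a backward difference in the power of `L`. Nonnegativity of the last term
then bounds partial sums of one order of differences by the order below. -/
theorem polyEntry_lazy_telescope (i n m : ℕ) (x : V) :
    ∑ r ∈ Finset.range n, polyEntry P x x ((1 - lazyPoly) ^ (i + 1) * lazyPoly ^ (m + r)) =
      polyEntry P x x ((1 - lazyPoly) ^ i * lazyPoly ^ m) -
        polyEntry P x x ((1 - lazyPoly) ^ i * lazyPoly ^ (m + n)) := by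
  induction n with
  | zero => simp
  | succ n ih =>
    have h : polyEntry P x x ((1 - lazyPoly) ^ (i + 1) * lazyPoly ^ (m + n)) =
        polyEntry P x x ((1 - lazyPoly) ^ i * lazyPoly ^ (m + n)) -
          polyEntry P x x ((1 - lazyPoly) ^ i * lazyPoly ^ (m + (n + 1))) := by
      rw [← map_sub]
      congr 1
      ring
    rw [Finset.sum_range_succ, ih, h]
    ring

theorem polyEntry_lazy_antitone (hP : IsStochasticMatrix P) (hπ : IsReversibleWrt P π)
    (i : ℕ) (x : V) : Antitone fun j => polyEntry P x x ((1 - lazyPoly) ^ i * lazyPoly ^ j) := by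
  refine antitone_nat_of_succ_le fun j => ?_
  have h := polyEntry_lazy_telescope (P := P) i 1 j x
  have h2 := polyEntry_lazy_pow_mul_nonneg hP hπ (i + 1) j x
  simp only [Finset.range_one, Finset.sum_singleton, add_zero] at h
  linarith

/-- The sum telescopes to at most the diagonal entry of `1 - L`, which is `(1 - P x x) / 2`. A total
mass strictly below 1 is what makes the later renewal argument subcritical. -/
theorem sum_lazySecondDiff_le (hP : IsStochasticMatrix P) (hπ : IsReversibleWrt P π) (x : V)
    (n : ℕ) : ∑ r ∈ Finset.range n, lazySecondDiff P x r ≤ 1 / 2 := by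
  have h := polyEntry_lazy_telescope (P := P) 1 n 0 x
  have h2 := polyEntry_lazy_pow_mul_nonneg hP hπ 1 (0 + n) x
  have h3 : polyEntry P x x ((1 - lazyPoly) ^ 1 * lazyPoly ^ 0) ≤ 1 / 2 := by
    have hX := polyEntry_X_pow (P := P) x x 1
    rw [pow_one, stepProb_one] at hX
    have := hP.nonneg x x
    rw [pow_zero, mul_one, pow_one, one_sub_lazyPoly, polyEntry_C_mul, map_sub, polyEntry_one, hX]
    linarith
  simp only [zero_add] at h h2
  unfold lazySecondDiff
  linarith

/-- Monotone differences cannot exceed their average over a block. Used twice, this gives a first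
difference of order `1 / k` and then a second difference of order `1 / k²`, with no assumption on
the decay of `P`. -/
theorem lazySecondDiff_le (hP : IsStochasticMatrix P) (hπ : IsReversibleWrt P π) (x : V)
    (r : ℕ) : lazySecondDiff P x r ≤ 4 / ((r : ℝ) + 1) ^ 2 := by
  set e : ℕ → ℕ → ℝ := fun i j => polyEntry P x x ((1 - lazyPoly) ^ i * lazyPoly ^ j) with he
  have hnn : ∀ i j, 0 ≤ e i j := fun i j => polyEntry_lazy_pow_mul_nonneg hP hπ i j x
  have ha : ∀ i, Antitone (e i) := fun i => polyEntry_lazy_antitone hP hπ i x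
  have hd : ∀ k : ℕ, ((k : ℝ) + 1) * e 1 k ≤ 1 := by
    intro k
    have h := polyEntry_lazy_telescope (P := P) 0 (k + 1) 0 x
    have h1 : ∑ _r ∈ Finset.range (k + 1), e 1 k ≤ ∑ r ∈ Finset.range (k + 1), e 1 (0 + r) :=
      Finset.sum_le_sum fun r hr => ha 1 (by have := Finset.mem_range.1 hr; omega)
    have h2 : e 0 0 = 1 := by simp only [he, pow_zero, mul_one, polyEntry_one]
    have h3 := hnn 0 (0 + (k + 1))
    simp only [zero_add] at h h1 h3
    simp only [Finset.sum_const, Finset.card_range, nsmul_eq_mul, Nat.cast_add, Nat.cast_one] at h1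
    simp only [he] at h1 h2 h3 ⊢
    linarith
  -- The block is `k, …, 2k`: it starts late enough for its sum to be controlled by `e 1 k`, and `e
  -- 2 (2 * k)` is its smallest term.
  have hh : ∀ k : ℕ, ((k : ℝ) + 1) * e 2 (2 * k) ≤ e 1 k := by
    intro k
    have h := polyEntry_lazy_telescope (P := P) 1 (k + 1) k x
    have h1 : ∑ _r ∈ Finset.range (k + 1), e 2 (2 * k) ≤ ∑ r ∈ Finset.range (k + 1), e 2 (k + r) :=
      Finset.sum_le_sum fun r hr => ha 2 (by have := Finset.mem_range.1 hr; omega)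
    have h3 := hnn 1 (k + (k + 1))
    simp only [Finset.sum_const, Finset.card_range, nsmul_eq_mul, Nat.cast_add, Nat.cast_one] at h1
    simp only [he] at h1 h3 ⊢
    linarith
  set k := r / 2 with hk
  have h1 : e 2 r ≤ e 2 (2 * k) := ha 2 (by omega)
  have hk2 : (r : ℝ) + 1 ≤ 2 * ((k : ℝ) + 1) := by
    have : r + 1 ≤ 2 * (k + 1) := by omega
    exact_mod_cast this
  have hkp : (0 : ℝ) < (k : ℝ) + 1 := by positivity
  have h2 : ((k : ℝ) + 1) ^ 2 * e 2 (2 * k) ≤ 1 := by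
    calc ((k : ℝ) + 1) ^ 2 * e 2 (2 * k) = ((k : ℝ) + 1) * (((k : ℝ) + 1) * e 2 (2 * k)) := by ring
      _ ≤ ((k : ℝ) + 1) * e 1 k := mul_le_mul_of_nonneg_left (hh k) hkp.le
      _ ≤ 1 := hd k
  change e 2 r ≤ _
  rw [le_div_iff₀ (by positivity)]
  have h4 : ((r : ℝ) + 1) ^ 2 ≤ 4 * ((k : ℝ) + 1) ^ 2 := by
    nlinarith [show (0 : ℝ) ≤ r from r.cast_nonneg]
  calc e 2 r * ((r : ℝ) + 1) ^ 2 ≤ e 2 (2 * k) * (4 * ((k : ℝ) + 1) ^ 2) :=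
        mul_le_mul h1 h4 (by positivity) (hnn _ _)
    _ ≤ 4 := by linarith

/-- The mean of `1 / (K + 1)` for a binomial `K`, computed through `(n + 1) * n.choose k = (k + 1) *
(n + 1).choose (k + 1)`. -/
theorem sum_choose_div_succ_le (n : ℕ) :
    ∑ k ∈ Finset.range (n + 1), (n.choose k : ℝ) / 2 ^ n * (1 / ((k : ℝ) + 1)) ≤
      2 / ((n : ℝ) + 1) := by
  have h1 : ∀ k ∈ Finset.range (n + 1), (n.choose k : ℝ) / 2 ^ n * (1 / ((k : ℝ) + 1)) =
      ((n + 1).choose (k + 1) : ℝ) / (2 ^ n * ((n : ℝ) + 1)) := by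
    intro k _
    have : ((n : ℝ) + 1) * n.choose k = (n + 1).choose (k + 1) * ((k : ℝ) + 1) := by
      exact_mod_cast Nat.add_one_mul_choose_eq n k
    field_simp
    linarith
  rw [Finset.sum_congr rfl h1, ← Finset.sum_div, div_le_div_iff₀ (by positivity) (by positivity)]
  have h2 : ∑ k ∈ Finset.range (n + 1), ((n + 1).choose (k + 1) : ℝ) ≤ 2 ^ (n + 1) := by
    have h3 := Nat.sum_range_choose (n + 1)
    rw [Finset.sum_range_succ'] at h3
    have h4 : ∑ k ∈ Finset.range (n + 1), (n + 1).choose (k + 1) ≤ 2 ^ (n + 1) := by omega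
    exact_mod_cast h4
  have h5 : (0 : ℝ) < (n : ℝ) + 1 := by positivity
  calc _ ≤ (2 : ℝ) ^ (n + 1) * ((n : ℝ) + 1) := mul_le_mul_of_nonneg_right h2 h5.le
    _ = _ := by ring

/-- Arithmetic-geometric mean inequality. With `c` the square root of the typical size of `a`, it
reduces binomial and Poisson averages of `1 / √(k + 1)` to those of `1 / (k + 1)`, which have closed
forms. -/
theorem inv_sqrt_le_of_pos {a c : ℝ} (ha : 0 < a) (hc : 0 < c) :
    1 / √a ≤ (c * (1 / a) + 1 / c) / 2 := by
  have hs := Real.sqrt_pos.2 ha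
  have h : (1 : ℝ) / a = (1 / √a) ^ 2 := by rw [div_pow, one_pow, Real.sq_sqrt ha.le]
  rw [h]
  set b := 1 / √a
  have : (c * b ^ 2 + 1 / c) / 2 - b = (c * b - 1) ^ 2 / (2 * c) := by field_simp; ring
  have h2 : 0 ≤ (c * b - 1) ^ 2 / (2 * c) := by positivity
  linarith

theorem polyEntry_lazy_pow (n : ℕ) (x : V) : polyEntry P x x (lazyPoly ^ n) =
    ∑ k ∈ Finset.range (n + 1), (n.choose k : ℝ) / 2 ^ n * stepProb P k x x := by
  rw [lazyPoly, mul_pow, ← C_pow, polyEntry_C_mul, add_comm (1 : ℝ[X]), add_pow, map_sum,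
    Finset.mul_sum]
  refine Finset.sum_congr rfl fun k _ => ?_
  rw [one_pow, mul_one, ← C_eq_natCast, mul_comm (X ^ k), polyEntry_C_mul, polyEntry_X_pow, one_div,
    inv_pow]
  ring

theorem polyEntry_lazy_pow_le {B : ℝ} (n : ℕ) (x : V)
    (hB : ∀ k ≤ n, stepProb P k x x ≤ B / √((k : ℝ) + 1)) (hB0 : 0 ≤ B) :
    polyEntry P x x (lazyPoly ^ n) ≤ 2 * B / √((n : ℝ) + 1) := by
  have hn : (0 : ℝ) < (n : ℝ) + 1 := by positivity
  have hs := Real.sqrt_pos.2 hn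
  rw [polyEntry_lazy_pow]
  have h1 : ∀ k ∈ Finset.range (n + 1), (n.choose k : ℝ) / 2 ^ n * stepProb P k x x ≤
      B / 2 * (√((n : ℝ) + 1) * ((n.choose k : ℝ) / 2 ^ n * (1 / ((k : ℝ) + 1))) +
        1 / √((n : ℝ) + 1) * (1 / 2 ^ n * (n.choose k : ℝ))) := by
    intro k hk
    have h2 := hB k (Nat.lt_succ_iff.1 (Finset.mem_range.1 hk))
    have h3 := inv_sqrt_le_of_pos (a := (k : ℝ) + 1) (by positivity) hs
    have h4 : B / √((k : ℝ) + 1) ≤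
        B * ((√((n : ℝ) + 1) * (1 / ((k : ℝ) + 1)) + 1 / √((n : ℝ) + 1)) / 2) := by
      rw [div_eq_mul_one_div]; exact mul_le_mul_of_nonneg_left h3 hB0
    refine (mul_le_mul_of_nonneg_left (h2.trans h4) (by positivity)).trans (le_of_eq ?_)
    ring
  refine (Finset.sum_le_sum h1).trans ?_
  rw [← Finset.mul_sum, Finset.sum_add_distrib, ← Finset.mul_sum, ← Finset.mul_sum,
    ← Finset.mul_sum]
  have h5 : ∑ k ∈ Finset.range (n + 1), (n.choose k : ℝ) = 2 ^ n := by
    exact_mod_cast Nat.sum_range_choose n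
  have h6 : √((n : ℝ) + 1) * (2 / ((n : ℝ) + 1)) = 2 / √((n : ℝ) + 1) := by
    nth_rewrite 2 [← Real.mul_self_sqrt hn.le]
    field_simp
  have h7 := mul_le_mul_of_nonneg_left (sum_choose_div_succ_le n) hs.le
  rw [h6] at h7
  rw [h5, one_div_mul_cancel (by positivity), mul_one]
  calc _ ≤ B / 2 * (2 / √((n : ℝ) + 1) + 1 / √((n : ℝ) + 1)) :=
        mul_le_mul_of_nonneg_left (by linarith) (by positivity)
    _ ≤ _ := by
        have : 0 ≤ B / √((n : ℝ) + 1) := by positivity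
        have e : B / 2 * (2 / √((n : ℝ) + 1) + 1 / √((n : ℝ) + 1)) =
          3 / 2 * (B / √((n : ℝ) + 1)) := by ring
        have e2 : 2 * B / √((n : ℝ) + 1) = 2 * (B / √((n : ℝ) + 1)) := by ring
        linarith

theorem rpow_neg_half (x : ℝ) (hx : 0 ≤ x) : x ^ (-(1 / 2) : ℝ) = 1 / √x := by
  rw [Real.rpow_neg hx, ← Real.sqrt_eq_rpow, one_div]

/-- Square root decay of `P` bounds the return probabilities of the lazy walk. -/
theorem lazy_return_le {C₀ : ℝ} (hP : IsStochasticMatrix P) (hπ : IsReversibleWrt P π)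
    (hC : HasSqrtDecay P C₀) {t : ℝ} (ht : 0 < t)
    (hV : Finite V → t ≤ (Nat.card V : ℝ) ^ 2 / 3) (x : V) (n : ℕ) :
    polyEntry P x x (lazyPoly ^ n) ≤
      2 * (1 + 2 * C₀) * (1 / √((n : ℝ) + 1) + 1 / √t) := by
  have hC0 := hC.1
  -- The summand 1 takes care of `k = 0`, and the factor 2 of `√(k + 1) ≤ 2 √k` for `k ≥ 1`.
  have hk : ∀ k : ℕ, (Finite V → k ≤ Nat.card V ^ 2) →
      stepProb P k x x ≤ (1 + 2 * C₀) / √((k : ℝ) + 1) := by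
    intro k hkV
    rcases Nat.eq_zero_or_pos k with rfl | hk1
    · refine (stepProb_le_one hP 0 x x).trans ?_
      simp only [Nat.cast_zero, zero_add, Real.sqrt_one, div_one]
      linarith
    · refine (hC.2 k hk1 hkV x x).trans ?_
      have hk0 : (0 : ℝ) < k := by exact_mod_cast hk1
      rw [rpow_neg_half _ hk0.le, mul_one_div, div_le_div_iff₀ (Real.sqrt_pos.2 hk0)
        (Real.sqrt_pos.2 (by linarith))]
      have h1 : √((k : ℝ) + 1) ≤ 2 * √k := by
        rw [show (2 : ℝ) = √4 by rw [show (4 : ℝ) = 2 ^ 2 by norm_num]; simp, ← Real.sqrt_mul (by norm_num)]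
        have : (1 : ℝ) ≤ k := by exact_mod_cast hk1
        exact Real.sqrt_le_sqrt (by linarith)
      have h2 := Real.sqrt_nonneg (k : ℝ)
      nlinarith
  have hfac : 0 ≤ 1 + 2 * C₀ := by linarith
  have hmul : ∀ a : ℝ, 2 * (1 + 2 * C₀) / a = 2 * (1 + 2 * C₀) * (1 / a) := fun a => by ring
  have hst : 0 ≤ 1 / √t := by positivity
  by_cases hn : Finite V → n ≤ Nat.card V ^ 2
  · refine (polyEntry_lazy_pow_le n x (fun k hkn => hk k fun h => hkn.trans (hn h)) hfac).trans ?_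
    rw [hmul]
    exact mul_le_mul_of_nonneg_left (by linarith) (by linarith)
  -- Beyond `|V|²` the decay hypothesis is silent, but lazy return probabilities decrease. Their
  -- value at time `|V|²` is of order `1 / |V|`, hence at most of order `1 / √t` for the allowed
  -- `t`; this is the source of the extra term.
  · push Not at hn
    obtain ⟨hfin, hlt⟩ := hn
    have ha := polyEntry_lazy_antitone hP hπ 0 x hlt.le
    simp only [pow_zero, one_mul] at ha
    refine ha.trans ((polyEntry_lazy_pow_le _ x (fun k hkn => hk k fun _ => hkn) hfac).trans ?_)
    rw [hmul]
    refine mul_le_mul_of_nonneg_left ?_ (by linarith)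
    have h1 := hV hfin
    have h2 : 1 / √(((Nat.card V ^ 2 : ℕ) : ℝ) + 1) ≤ 1 / √t := by
      refine one_div_le_one_div_of_le (Real.sqrt_pos.2 ht) (Real.sqrt_le_sqrt ?_)
      push_cast
      nlinarith [sq_nonneg (Nat.card V : ℝ)]
    have h3 : 0 ≤ 1 / √((n : ℝ) + 1) := by positivity
    linarith

end Lazy

/-! ### The chain of two walks driven by the same clocks -/

section Pair

variable {V : Type*}

open Classical in
/-- The total jump rate of two walks that are driven by the same clocks. -/
noncomputable def pairRate (x y : V) : ℕ := if x = y then 1 else 2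

open Classical in
/-- The jump kernel of two walks driven by the same clocks, applied to a function: the walks move
independently and one at a time when they are apart, and simultaneously when they are together. -/
noncomputable def pairJump (P : V → V → ℝ) (φ : V → V → ℝ≥0∞) (x y : V) : ℝ≥0∞ :=
  if x = y then ∑' z, ∑' w, ENNReal.ofReal (P x z) * ENNReal.ofReal (P y w) * φ z w
  else ∑' z, ENNReal.ofReal (P x z) * φ z y + ∑' w, ENNReal.ofReal (P y w) * φ x w

/-- One step of the pair of walks, made discrete at rate four. -/
noncomputable def pairStep (P : V → V → ℝ) (φ : V → V → ℝ≥0∞) (x y : V) : ℝ≥0∞ :=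
  4⁻¹ * (((4 - pairRate x y : ℕ) : ℝ≥0∞) * φ x y + pairJump P φ x y)

variable {P : V → V → ℝ}

theorem pairJump_add (φ ψ : V → V → ℝ≥0∞) :
    pairJump P (φ + ψ) = pairJump P φ + pairJump P ψ := by
  ext x y
  simp only [pairJump, Pi.add_apply, mul_add, ENNReal.tsum_add]
  split_ifs
  · rfl
  · ring

theorem pairJump_tsum {ι : Type*} (c : ι → ℝ≥0∞) (φ : ι → V → V → ℝ≥0∞) (x y : V) :
    pairJump P (fun z w => ∑' i, c i * φ i z w) x y = ∑' i, c i * pairJump P (φ i) x y := by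
  have h : ∀ a b c : ℝ≥0∞, a * (b * c) = b * (a * c) := fun a b c => mul_left_comm _ _ _
  unfold pairJump
  split_ifs
  · simp_rw [← ENNReal.tsum_mul_left]
    rw [ENNReal.tsum_comm (α := ι)]
    refine tsum_congr fun z => ?_
    rw [ENNReal.tsum_comm (α := ι)]
    exact tsum_congr fun w => tsum_congr fun i => h _ _ _
  · simp_rw [mul_add, ← ENNReal.tsum_mul_left]
    rw [ENNReal.tsum_add, ENNReal.tsum_comm (α := ι), ENNReal.tsum_comm (α := ι)]
    simp_rw [h]

theorem pairJump_smul (c : ℝ≥0∞) (φ : V → V → ℝ≥0∞) :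
    pairJump P (c • φ) = c • pairJump P φ := by
  ext x y
  have h : ∀ a b : ℝ≥0∞, a * (c * b) = c * (a * b) := fun a b => mul_left_comm _ _ _
  simp only [pairJump, Pi.smul_apply, smul_eq_mul, h, ENNReal.tsum_mul_left]
  split_ifs
  · rfl
  · rw [mul_add]

theorem pairJump_mono {φ ψ : V → V → ℝ≥0∞} (h : φ ≤ ψ) : pairJump P φ ≤ pairJump P ψ := by
  intro x y
  unfold pairJump
  split_ifs
  · exact ENNReal.tsum_le_tsum fun z => ENNReal.tsum_le_tsum fun w => by gcongr; exact h z w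
  · exact add_le_add (ENNReal.tsum_le_tsum fun z => by gcongr; exact h z y)
      (ENNReal.tsum_le_tsum fun w => by gcongr; exact h x w)

theorem pairStep_add (φ ψ : V → V → ℝ≥0∞) :
    pairStep P (φ + ψ) = pairStep P φ + pairStep P ψ := by
  ext x y
  simp only [pairStep, pairJump_add, Pi.add_apply]
  ring

theorem pairStep_smul (c : ℝ≥0∞) (φ : V → V → ℝ≥0∞) :
    pairStep P (c • φ) = c • pairStep P φ := by
  ext x y
  simp only [pairStep, pairJump_smul, Pi.smul_apply, smul_eq_mul]
  ring

theorem pairStep_mono {φ ψ : V → V → ℝ≥0∞} (h : φ ≤ ψ) : pairStep P φ ≤ pairStep P ψ := by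
  intro x y
  unfold pairStep
  gcongr
  · exact h x y
  · exact pairJump_mono h x y

theorem pairStep_iterate_add (n : ℕ) (φ ψ : V → V → ℝ≥0∞) :
    (pairStep P)^[n] (φ + ψ) = (pairStep P)^[n] φ + (pairStep P)^[n] ψ := by
  induction n generalizing φ ψ with
  | zero => rfl
  | succ n ih => simp only [Function.iterate_succ_apply, pairStep_add, ih]

theorem pairStep_iterate_smul (n : ℕ) (c : ℝ≥0∞) (φ : V → V → ℝ≥0∞) :
    (pairStep P)^[n] (c • φ) = c • (pairStep P)^[n] φ := by
  induction n generalizing φ with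
  | zero => rfl
  | succ n ih => simp only [Function.iterate_succ_apply, pairStep_smul, ih]

theorem pairStep_iterate_mono (n : ℕ) {φ ψ : V → V → ℝ≥0∞} (h : φ ≤ ψ) :
    (pairStep P)^[n] φ ≤ (pairStep P)^[n] ψ := by
  induction n generalizing φ ψ with
  | zero => exact h
  | succ n ih => simp only [Function.iterate_succ_apply]; exact ih (pairStep_mono h)

theorem pairStep_iterate_sum {ι : Type*} (n : ℕ) (s : Finset ι) (φ : ι → V → V → ℝ≥0∞) :
    (pairStep P)^[n] (∑ i ∈ s, φ i) = ∑ i ∈ s, (pairStep P)^[n] (φ i) := by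
  classical
  induction s using Finset.induction_on with
  | empty =>
    have h := pairStep_iterate_smul (P := P) n 0 0
    simpa using h
  | insert a s ha ih => rw [Finset.sum_insert ha, Finset.sum_insert ha, pairStep_iterate_add, ih]

theorem pairRate_cast_add (x y : V) :
    ((4 - pairRate x y : ℕ) : ℝ≥0∞) + (pairRate x y : ℝ≥0∞) = 4 := by
  unfold pairRate
  split_ifs <;> norm_num

theorem pairJump_le {φ : V → V → ℝ≥0∞} {M : ℝ≥0∞} (hP : IsStochasticMatrix P)
    (h : ∀ x y, φ x y ≤ M) (x y : V) : pairJump P φ x y ≤ (pairRate x y : ℝ≥0∞) * M := by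
  refine (pairJump_mono (ψ := fun _ _ => M) h x y).trans (le_of_eq ?_)
  unfold pairJump pairRate
  split_ifs
  · simp only [ENNReal.tsum_mul_right, ENNReal.tsum_mul_left, tsum_ofReal_row hP]; norm_num
  · simp only [ENNReal.tsum_mul_right, tsum_ofReal_row hP]; push_cast; ring

/-- The step is an average, since the holding and jump rates add up to four. The bound supplies the
finiteness needed to cancel terms in `ℝ≥0∞`. -/
theorem pairStep_iterate_le {φ : V → V → ℝ≥0∞} {M : ℝ≥0∞} (hP : IsStochasticMatrix P)
    (h : ∀ x y, φ x y ≤ M) (n : ℕ) (x y : V) : (pairStep P)^[n] φ x y ≤ M := by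
  induction n generalizing φ with
  | zero => exact h x y
  | succ n ih =>
    refine ih fun x y => ?_
    unfold pairStep
    calc 4⁻¹ * (((4 - pairRate x y : ℕ) : ℝ≥0∞) * φ x y + pairJump P φ x y)
        ≤ 4⁻¹ * (((4 - pairRate x y : ℕ) : ℝ≥0∞) * M + (pairRate x y : ℝ≥0∞) * M) := by
          gcongr
          · exact h x y
          · exact pairJump_le hP h x y
      _ = M := by
          rw [← add_mul, pairRate_cast_add, ← mul_assoc,
            ENNReal.inv_mul_cancel (by norm_num) (by norm_num), one_mul]

end Pair

/-! ### Action of the pair chain on the kernels of the lazy walk -/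

section LazyKernel

open Polynomial

variable {V : Type*} {P : V → V → ℝ} {π : V → ℝ}

/-- The transition kernel of the lazy walk, relative to `π`. -/
noncomputable def lazyKernel (P : V → V → ℝ) (π : V → ℝ) (r : ℕ) (x y : V) : ℝ≥0∞ :=
  ENNReal.ofReal (polyEntry P x y (lazyPoly ^ r) / π y)

theorem polyEntry_lazy_pow_succ (r : ℕ) (x y : V) :
    polyEntry P x y (lazyPoly ^ (r + 1)) =
      (polyEntry P x y (lazyPoly ^ r) + polyEntry P x y (X * lazyPoly ^ r)) / 2 := by
  rw [pow_succ', lazyPoly, mul_assoc, polyEntry_C_mul, add_mul, one_mul, map_add]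
  ring

theorem polyEntry_lazy_pow_nonneg (hP : IsStochasticMatrix P) (r : ℕ) (x y : V) :
    0 ≤ polyEntry P x y (lazyPoly ^ r) := by
  induction r generalizing x with
  | zero =>
    rw [pow_zero, ← pow_zero X, polyEntry_X_pow]; exact stepProb_nonneg hP _ _ _
  | succ r ih =>
    have := (hasSum_polyEntry_X_mul hP (lazyPoly ^ r) x y).nonneg fun w =>
      mul_nonneg (hP.nonneg x w) (ih w)
    rw [polyEntry_lazy_pow_succ]
    linarith [ih x]

theorem hasSum_polyEntry_mul_X (hP : IsStochasticMatrix P) (q : ℝ[X]) (u v : V) :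
    HasSum (fun w => polyEntry P u w q * P w v) (polyEntry P u v (X * q)) := by
  rw [mul_comm]
  refine (hasSum_polyEntry_mul hP q X u v).congr_fun fun w => ?_
  have h := polyEntry_X_pow (P := P) w v 1
  rw [pow_one, stepProb_one] at h
  rw [h]

/-- A jump of the first coordinate multiplies by `P` on the left. A jump of the second multiplies by
`P` on the right, because detailed balance moves the division by `π` through the sum. Powers of `L`
commute with `P`, so the two contributions agree. -/
theorem pairJump_lazyKernel_of_ne (hP : IsStochasticMatrix P) (hπ : IsReversibleWrt P π) (r : ℕ)
    {x y : V} (hxy : x ≠ y) : pairJump P (lazyKernel P π r) x y =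
      ENNReal.ofReal (2 * polyEntry P x y (X * lazyPoly ^ r) / π y) := by
  have hq := polyEntry_lazy_pow_nonneg hP r
  have h1 : HasSum (fun z => P x z * (polyEntry P z y (lazyPoly ^ r) / π y))
      (polyEntry P x y (X * lazyPoly ^ r) / π y) := by
    refine ((hasSum_polyEntry_X_mul hP (lazyPoly ^ r) x y).div_const (π y)).congr_fun fun z => ?_
    ring
  have h2 : HasSum (fun w => P y w * (polyEntry P x w (lazyPoly ^ r) / π w))
      (polyEntry P x y (X * lazyPoly ^ r) / π y) := by
    refine ((hasSum_polyEntry_mul_X hP (lazyPoly ^ r) x y).div_const (π y)).congr_fun fun w => ?_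
    have hb := hπ.detailed_balance y w
    have := hπ.pos w
    have := hπ.pos y
    field_simp
    linear_combination (polyEntry P x w (lazyPoly ^ r)) * hb
  have e : ∀ a b : V, 0 ≤ polyEntry P a b (lazyPoly ^ r) / π b := fun a b =>
    div_nonneg (hq a b) (hπ.pos b).le
  have n1 := h1.nonneg fun z => mul_nonneg (hP.nonneg _ _) (e _ _)
  unfold pairJump lazyKernel
  rw [if_neg hxy]
  simp_rw [← ENNReal.ofReal_mul (hP.nonneg _ _)]
  rw [tsum_ofReal_eq (fun z => mul_nonneg (hP.nonneg _ _) (e _ _)) h1,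
    tsum_ofReal_eq (fun z => mul_nonneg (hP.nonneg _ _) (e _ _)) h2, ← ENNReal.ofReal_add n1 n1]
  congr 1
  ring

/-- Here both coordinates jump at once, which gives one factor `P` from each side. -/
theorem pairJump_lazyKernel_self (hP : IsStochasticMatrix P) (hπ : IsReversibleWrt P π) (r : ℕ)
    (x : V) : pairJump P (lazyKernel P π r) x x =
      ENNReal.ofReal (polyEntry P x x (X * (X * lazyPoly ^ r)) / π x) := by
  have hq := polyEntry_lazy_pow_nonneg hP r
  have e : ∀ a b : V, 0 ≤ polyEntry P a b (lazyPoly ^ r) / π b := fun a b =>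
    div_nonneg (hq a b) (hπ.pos b).le
  have h2 : ∀ z, HasSum (fun w => P x w * (polyEntry P z w (lazyPoly ^ r) / π w))
      (polyEntry P z x (X * lazyPoly ^ r) / π x) := fun z => by
    refine ((hasSum_polyEntry_mul_X hP (lazyPoly ^ r) z x).div_const (π x)).congr_fun fun w => ?_
    have hb := hπ.detailed_balance x w
    have := hπ.pos w
    have := hπ.pos x
    field_simp
    linear_combination (polyEntry P z w (lazyPoly ^ r)) * hb
  have n2 : ∀ z, 0 ≤ polyEntry P z x (X * lazyPoly ^ r) / π x := fun z =>
    (h2 z).nonneg fun w => mul_nonneg (hP.nonneg _ _) (e _ _)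
  have h1 : HasSum (fun z => P x z * (polyEntry P z x (X * lazyPoly ^ r) / π x))
      (polyEntry P x x (X * (X * lazyPoly ^ r)) / π x) := by
    refine ((hasSum_polyEntry_X_mul hP (X * lazyPoly ^ r) x x).div_const (π x)).congr_fun
      fun z => ?_
    ring
  unfold pairJump lazyKernel
  rw [if_pos rfl, ← tsum_ofReal_eq (fun z => mul_nonneg (hP.nonneg _ _) (n2 z)) h1]
  refine tsum_congr fun z => ?_
  rw [ENNReal.ofReal_mul (hP.nonneg _ _), ← tsum_ofReal_eq (fun w => mul_nonneg (hP.nonneg _ _)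
    (e _ _)) (h2 z), ← ENNReal.tsum_mul_left]
  exact tsum_congr fun w => by rw [ENNReal.ofReal_mul (hP.nonneg _ _), mul_assoc]

theorem four_inv_eq : (4⁻¹ : ℝ≥0∞) = ENNReal.ofReal (1 / 4) := by
  rw [one_div, ENNReal.ofReal_inv_of_pos (by norm_num)]; norm_num

/-- The pair chain differs from the lazy walk only by a source term on the diagonal. -/
theorem pairStep_lazyKernel (hP : IsStochasticMatrix P) (hπ : IsReversibleWrt P π) (r : ℕ)
    (x y : V) : pairStep P (lazyKernel P π r) x y = lazyKernel P π (r + 1) x y +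
      ENNReal.ofReal (lazySecondDiff P x r) * lazyKernel P π 0 x y := by
  have hpos := hπ.pos y
  by_cases hxy : x = y
  · subst hxy
    have e1 := polyEntry_lazy_pow_nonneg hP r x x
    have e2 := lazySecondDiff_nonneg hP hπ x r
    have e3 := polyEntry_lazy_pow_nonneg hP (r + 1) x x
    have e5 : ((4 - pairRate x x : ℕ) : ℝ≥0∞) = ENNReal.ofReal 3 := by simp [pairRate]
    -- This is `L + (1 - L)² = (3 + X²) / 4` multiplied by `L^r`. The 3 is the holding rate on the
    -- diagonal.
    have e6 : lazyPoly ^ (r + 1) + (1 - lazyPoly) ^ 2 * lazyPoly ^ r =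
        C (1 / 4) * (C 3 * lazyPoly ^ r + X * (X * lazyPoly ^ r)) := by
      have h2 : (C (1 / 2 : ℝ) * 2 : ℝ[X]) = 1 := by
        rw [show (2 : ℝ[X]) = C 2 from (map_ofNat C 2).symm, ← C_mul]; norm_num
      have h4 : (C (1 / 4 : ℝ) : ℝ[X]) = C (1 / 2) * C (1 / 2) := by rw [← C_mul]; norm_num
      have h3 : (C (3 : ℝ) : ℝ[X]) = 3 := map_ofNat C 3
      rw [one_sub_lazyPoly, pow_succ', h4, h3]
      set q := lazyPoly ^ r
      rw [lazyPoly]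
      linear_combination (-(C (1 / 2) * (1 + X) * q)) * h2
    have e7 : polyEntry P x x (lazyPoly ^ (r + 1)) + lazySecondDiff P x r =
        1 / 4 * (3 * polyEntry P x x (lazyPoly ^ r) +
          polyEntry P x x (X * (X * lazyPoly ^ r))) := by
      rw [lazySecondDiff, ← map_add, e6, polyEntry_C_mul, map_add, polyEntry_C_mul]
    have e8 : 0 ≤ polyEntry P x x (X * (X * lazyPoly ^ r)) :=
      (hasSum_polyEntry_X_mul hP (X * lazyPoly ^ r) x x).nonneg fun w => mul_nonneg (hP.nonneg _ _)
        ((hasSum_polyEntry_X_mul hP (lazyPoly ^ r) w x).nonneg fun z => mul_nonneg (hP.nonneg _ _)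
          (polyEntry_lazy_pow_nonneg hP r z x))
    unfold pairStep
    rw [pairJump_lazyKernel_self hP hπ, e5, four_inv_eq]
    unfold lazyKernel
    rw [← ENNReal.ofReal_mul (by norm_num), ← ENNReal.ofReal_add (by positivity) (by positivity),
      ← ENNReal.ofReal_mul (by norm_num), ← ENNReal.ofReal_mul e2,
      ← ENNReal.ofReal_add (by positivity) (mul_nonneg e2 (by rw [pow_zero, polyEntry_one]; positivity)),
      pow_zero, polyEntry_one]
    congr 1
    field_simp
    linarith
  · have e1 := polyEntry_lazy_pow_nonneg hP r x y
    have e5 : ((4 - pairRate x y : ℕ) : ℝ≥0∞) = ENNReal.ofReal 2 := by simp [pairRate, hxy]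
    have e8 : 0 ≤ polyEntry P x y (X * lazyPoly ^ r) :=
      (hasSum_polyEntry_X_mul hP (lazyPoly ^ r) x y).nonneg fun z => mul_nonneg (hP.nonneg _ _)
          (polyEntry_lazy_pow_nonneg hP r z y)
    have e9 : lazyKernel P π 0 x y = 0 := by
      rw [lazyKernel, pow_zero, ← pow_zero X, polyEntry_X_pow, stepProb, if_neg hxy]; simp
    unfold pairStep
    rw [pairJump_lazyKernel_of_ne hP hπ r hxy, e5, four_inv_eq, e9, mul_zero, add_zero]
    unfold lazyKernel
    rw [← ENNReal.ofReal_mul (by norm_num), ← ENNReal.ofReal_add (by positivity) (by positivity),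
      ← ENNReal.ofReal_mul (by norm_num), polyEntry_lazy_pow_succ]
    congr 1
    ring

/-- Duhamel formula: each step leaves a source on the diagonal, which the pair chain carries for the
remaining `s` steps. The general `r` is needed by the induction; only `r = 0` is used later. -/
theorem pairStep_iterate_lazyKernel (hP : IsStochasticMatrix P) (hπ : IsReversibleWrt P π)
    (n r : ℕ) : (pairStep P)^[n] (lazyKernel P π r) = lazyKernel P π (n + r) +
      ∑ s ∈ Finset.range n, (pairStep P)^[s]
        (fun x y => ENNReal.ofReal (lazySecondDiff P x (n - 1 - s + r)) * lazyKernel P π 0 x y) := by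
  induction n generalizing r with
  | zero => simp
  | succ n ih =>
    have h : pairStep P (lazyKernel P π r) = lazyKernel P π (r + 1) + fun x y =>
        ENNReal.ofReal (lazySecondDiff P x r) * lazyKernel P π 0 x y := by
      ext x y; exact pairStep_lazyKernel hP hπ r x y
    rw [Function.iterate_succ_apply, h, pairStep_iterate_add, ih, Finset.sum_range_succ, add_assoc]
    have e1 : n + (r + 1) = n + 1 + r := by ring
    have e2 : n + 1 - 1 - n + r = r := by omega
    rw [e1, e2]
    congr 2
    refine Finset.sum_congr rfl fun s hs => ?_
    have e3 : n - 1 - s + (r + 1) = n + 1 - 1 - s + r := by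
      have := Finset.mem_range.1 hs; omega
    rw [e3]

end LazyKernel

/-! ### A slowly varying weight -/

section Weight

/-- A summable weight that varies slowly. -/
noncomputable def slowWeight (m : ℕ) : ℝ := (2048 / (2048 + (m : ℝ))) ^ 2

theorem slowWeight_pos (m : ℕ) : 0 < slowWeight m := by unfold slowWeight; positivity

theorem slowWeight_zero : slowWeight 0 = 1 := by norm_num [slowWeight]

theorem sum_slowWeight_le (n : ℕ) : ∑ m ∈ Finset.range n, slowWeight m ≤ 4096 := by
  have h : ∀ n : ℕ, ∑ m ∈ Finset.range n, slowWeight m ≤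
      2048 ^ 2 * (1 / 2047 - 1 / (2047 + (n : ℝ))) := by
    intro n
    induction n with
    | zero => simp
    | succ n ih =>
      rw [Finset.sum_range_succ]
      have h1 : slowWeight n ≤ 2048 ^ 2 * (1 / (2047 + (n : ℝ)) - 1 / (2048 + (n : ℝ))) := by
        have hn : (0 : ℝ) ≤ n := n.cast_nonneg
        have e : 1 / (2047 + (n : ℝ)) - 1 / (2048 + (n : ℝ)) =
            1 / ((2047 + (n : ℝ)) * (2048 + (n : ℝ))) := by
          field_simp; ring
        unfold slowWeight
        rw [e, div_pow, div_eq_mul_one_div]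
        refine mul_le_mul_of_nonneg_left (one_div_le_one_div_of_le (by positivity) ?_)
          (by positivity)
        nlinarith
      push_cast
      rw [show (2047 : ℝ) + (n + 1) = 2048 + n by ring]
      linarith
  refine (h n).trans ?_
  have : (0 : ℝ) < 1 / (2047 + (n : ℝ)) := by positivity
  linarith

/-- Convolution with a kernel of total mass at most one half and with quadratic decay contracts the
weight. -/
theorem sum_slowWeight_mul_le {h : ℕ → ℝ} (h0 : ∀ r, 0 ≤ h r)
    (hs : ∀ n, ∑ r ∈ Finset.range n, h r ≤ 1 / 2) (hd : ∀ r : ℕ, h r ≤ 4 / ((r : ℝ) + 1) ^ 2)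
    (m : ℕ) : ∑ r ∈ Finset.range m, slowWeight (m - 1 - r) * h r ≤ 24 / 25 * slowWeight m := by
  have hm : (0 : ℝ) < 2048 + (m : ℝ) := by positivity
  have hpt : ∀ r ∈ Finset.range m, slowWeight (m - 1 - r) * h r ≤
      16 / 9 * slowWeight m * h r + 64 / (2048 + (m : ℝ)) ^ 2 * slowWeight (m - 1 - r) := by
    intro r hr
    have hr' := Finset.mem_range.1 hr
    have hcast : ((m - 1 - r : ℕ) : ℝ) = (m : ℝ) - 1 - r := by
      rw [Nat.cast_sub (by omega), Nat.cast_sub (by omega)]; norm_num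
    have hp1 := slowWeight_pos (m - 1 - r)
    have hp2 := slowWeight_pos m
    -- For small `r` the shifted denominator is at least 3/4 of the original, so the weight grows by
    -- at most 16/9. For large `r` the quadratic decay of `h` gives `4 * 4² = 64`.
    by_cases hc : (r : ℝ) + 1 ≤ (2048 + m) / 4
    · have h1 : slowWeight (m - 1 - r) ≤ 16 / 9 * slowWeight m := by
        have h2 : 2048 / (2048 + ((m - 1 - r : ℕ) : ℝ)) ≤ 4 / 3 * (2048 / (2048 + (m : ℝ))) := by
          rw [hcast, ← mul_div_assoc, div_le_div_iff₀ (by linarith) hm]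
          nlinarith
        unfold slowWeight
        refine (pow_le_pow_left₀ (by positivity) h2 2).trans (le_of_eq ?_)
        ring
      have h3 : 0 ≤ 64 / (2048 + (m : ℝ)) ^ 2 * slowWeight (m - 1 - r) := by positivity
      have h4 := mul_le_mul_of_nonneg_right h1 (h0 r)
      linarith
    · push Not at hc
      have h1 : h r ≤ 64 / (2048 + (m : ℝ)) ^ 2 := by
        refine (hd r).trans ?_
        rw [div_le_div_iff₀ (by positivity) (by positivity)]
        nlinarith
      have h3 : 0 ≤ 16 / 9 * slowWeight m * h r := mul_nonneg (by positivity) (h0 r)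
      have h4 := mul_le_mul_of_nonneg_left h1 hp1.le
      linarith
  refine (Finset.sum_le_sum hpt).trans ?_
  rw [Finset.sum_add_distrib, ← Finset.mul_sum, ← Finset.mul_sum,
    Finset.sum_range_reflect slowWeight m]
  have h1 := mul_le_mul_of_nonneg_left (hs m) (by have := slowWeight_pos m; positivity :
    0 ≤ 16 / 9 * slowWeight m)
  have h2 := mul_le_mul_of_nonneg_left (sum_slowWeight_le m)
    (by positivity : 0 ≤ 64 / (2048 + (m : ℝ)) ^ 2)
  -- The total factor is `16/9 * 1/2 + 1/16 = 137/144 < 24/25`. The scale 2048 is chosen to make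
  -- this second contribution small.
  have h3 : 64 / (2048 + (m : ℝ)) ^ 2 * 4096 = 1 / 16 * slowWeight m := by
    unfold slowWeight; field_simp; norm_num
  linarith [slowWeight_pos m]

/-- The weight decays like `m⁻²`, which leaves room for the factor `√(m + 1)` lost when `1 / √(n +
1)` is compared with `1 / √(N + 1)` for `m = N - n`. -/
theorem exists_sum_slowWeight_mul_sqrt_le :
    ∃ K : ℝ, 0 < K ∧ ∀ n, ∑ m ∈ Finset.range n, slowWeight m * √((m : ℝ) + 1) ≤ K := by
  have hs : Summable fun m : ℕ => slowWeight m * √((m : ℝ) + 1) := by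
    have h1 : Summable fun m : ℕ => 2048 ^ 2 * (1 / ((m + 1 : ℕ) : ℝ) ^ (3 / 2 : ℝ)) :=
      ((summable_nat_add_iff 1).2 (Real.summable_one_div_nat_rpow.2 (by norm_num))).mul_left _
    refine Summable.of_nonneg_of_le (fun m => by have := slowWeight_pos m; positivity)
      (fun m => ?_) h1
    have hm : (0 : ℝ) < (m : ℝ) + 1 := by positivity
    push_cast
    have e : ((m : ℝ) + 1) ^ (3 / 2 : ℝ) * √((m : ℝ) + 1) = ((m : ℝ) + 1) ^ 2 := by
      rw [Real.sqrt_eq_rpow, ← Real.rpow_add hm, ← Real.rpow_natCast]; norm_num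
    unfold slowWeight
    rw [mul_one_div, le_div_iff₀ (by positivity), mul_assoc, mul_comm (√_), e, div_pow, div_mul_eq_mul_div,
      div_le_iff₀ (by positivity)]
    exact mul_le_mul_of_nonneg_left (pow_le_pow_left₀ hm.le (by linarith) 2) (by positivity)
  refine ⟨∑' m, slowWeight m * √((m : ℝ) + 1) + 1, ?_, fun n => ?_⟩
  · have : 0 ≤ ∑' m, slowWeight m * √((m : ℝ) + 1) :=
      tsum_nonneg fun m => by have := slowWeight_pos m; positivity
    linarith
  · have := hs.sum_le_tsum (Finset.range n)
      (fun m _ => by have := slowWeight_pos m; positivity)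
    linarith

theorem le_of_le_add_mul_self {a b : ℝ≥0∞} (ha : a ≠ ∞)
    (h : a ≤ b + ENNReal.ofReal (24 / 25) * a) : a ≤ ENNReal.ofReal 25 * b := by
  by_cases hb : b = ∞
  · rw [hb, ENNReal.mul_top (by simp)]; exact le_top
  lift a to NNReal using ha
  lift b to NNReal using hb
  have e1 : ENNReal.ofReal (24 / 25) = ((24 / 25 : NNReal) : ℝ≥0∞) := by
    rw [ENNReal.ofReal]; congr 1; ext; norm_num
  have e2 : ENNReal.ofReal 25 = ((25 : NNReal) : ℝ≥0∞) := by
    rw [ENNReal.ofReal]; congr 1; ext; norm_num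
  rw [e1, ← ENNReal.coe_mul, ← ENNReal.coe_add, ENNReal.coe_le_coe, ← NNReal.coe_le_coe] at h
  rw [e2, ← ENNReal.coe_mul, ENNReal.coe_le_coe, ← NNReal.coe_le_coe]
  push_cast at h ⊢
  linarith

end Weight

/-! ### Decay of the collision probability of the pair chain -/

section PairDecay

open Polynomial

variable {V : Type*} {P : V → V → ℝ} {π : V → ℝ}

theorem lazyKernel_zero_le {M : ℝ} (hM : ∀ v, 1 / π v ≤ M) (hM0 : 0 ≤ M) (x y : V) :
    lazyKernel P π 0 x y ≤ ENNReal.ofReal M := by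
  refine ENNReal.ofReal_le_ofReal ?_
  rw [pow_zero, ← pow_zero X, polyEntry_X_pow, stepProb]
  split_ifs
  · exact hM y
  · rwa [zero_div]

theorem sum_range_sum_range_eq {M : Type*} [AddCommMonoid M] (N : ℕ) (F : ℕ → ℕ → M) :
    ∑ n ∈ Finset.range (N + 1), ∑ s ∈ Finset.range n, F n s =
      ∑ s ∈ Finset.range (N + 1), ∑ r ∈ Finset.range (N - s), F (s + 1 + r) s := by
  rw [Finset.sum_comm' (t' := Finset.range (N + 1)) (s' := fun s => Finset.Ico (s + 1) (N + 1))
    (fun n s => by simp only [Finset.mem_range, Finset.mem_Ico]; omega)]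
  refine Finset.sum_congr rfl fun s _ => ?_
  rw [Finset.sum_Ico_eq_sum_range]
  exact Finset.sum_congr (by congr 1; omega) fun r _ => rfl

/-- Sum the Duhamel formula against the weights. After regrouping by the number `s` of steps
following the source, the inner sum is a convolution of the weight with `h`, at most 24/25 of the
weight, so the double sum is at most 24/25 of `Φ` and can be absorbed because `Φ` is finite. -/
theorem pairStep_iterate_le_sum (hP : IsStochasticMatrix P) (hπ : IsReversibleWrt P π) {M : ℝ}
    (hM : ∀ v, 1 / π v ≤ M) (hM0 : 0 ≤ M) (N : ℕ) (x y : V) :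
    (pairStep P)^[N] (lazyKernel P π 0) x y ≤ ENNReal.ofReal 25 *
      ∑ n ∈ Finset.range (N + 1), ENNReal.ofReal (slowWeight (N - n)) * lazyKernel P π n x y := by
  set f := lazyKernel P π 0 with hf
  set w : ℕ → ℝ≥0∞ := fun m => ENNReal.ofReal (slowWeight m) with hw
  set H : ℕ → V → V → ℝ≥0∞ := fun r x y => ENNReal.ofReal (lazySecondDiff P x r) * f x y with hH
  set Φ : V → V → ℝ≥0∞ := ∑ n ∈ Finset.range (N + 1), w (N - n) • (pairStep P)^[n] f with hΦ
  have hbd : ∀ n x y, (pairStep P)^[n] f x y ≤ ENNReal.ofReal M := fun n =>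
    pairStep_iterate_le hP (lazyKernel_zero_le hM hM0) n
  have hfin : Φ x y ≠ ∞ := by
    rw [hΦ, Finset.sum_apply, Finset.sum_apply]
    refine ENNReal.sum_ne_top.2 fun n _ => ?_
    exact ENNReal.mul_ne_top ENNReal.ofReal_ne_top
      (ne_top_of_le_ne_top ENNReal.ofReal_ne_top (hbd n x y))
  -- The source strength depends on the vertex, but the contraction holds at every vertex with the
  -- same constant. It can therefore be applied before the monotone operator `(pairStep P)^[s]`.
  have hcontr : ∀ m, ∑ r ∈ Finset.range m, w (m - 1 - r) • H r ≤
      (ENNReal.ofReal (24 / 25) * w m) • f := by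
    intro m x y
    rw [Finset.sum_apply, Finset.sum_apply]
    simp only [Pi.smul_apply, smul_eq_mul, hH, hw, ← mul_assoc]
    rw [← Finset.sum_mul]
    gcongr
    have hnn := lazySecondDiff_nonneg hP hπ x
    simp_rw [← ENNReal.ofReal_mul (slowWeight_pos _).le]
    rw [← ENNReal.ofReal_sum_of_nonneg (fun r _ => mul_nonneg (slowWeight_pos _).le (hnn r)),
      ← ENNReal.ofReal_mul (by norm_num)]
    exact ENNReal.ofReal_le_ofReal (sum_slowWeight_mul_le hnn (sum_lazySecondDiff_le hP hπ x)
      (lazySecondDiff_le hP hπ x) m)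
  have hexp : Φ = ∑ n ∈ Finset.range (N + 1), w (N - n) • lazyKernel P π n +
      ∑ s ∈ Finset.range (N + 1), (pairStep P)^[s]
        (∑ r ∈ Finset.range (N - s), w (N - s - 1 - r) • H r) := by
    have e1 : ∀ n, w (N - n) • (pairStep P)^[n] f = w (N - n) • lazyKernel P π n +
        ∑ s ∈ Finset.range n, w (N - n) • (pairStep P)^[s] (H (n - 1 - s)) := by
      intro n
      rw [hf, pairStep_iterate_lazyKernel hP hπ n 0, smul_add, Finset.smul_sum]
      rfl
    rw [hΦ, Finset.sum_congr rfl fun n _ => e1 n, Finset.sum_add_distrib, sum_range_sum_range_eq]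
    congr 1
    refine Finset.sum_congr rfl fun s _ => ?_
    rw [pairStep_iterate_sum]
    refine Finset.sum_congr rfl fun r _ => ?_
    rw [pairStep_iterate_smul]
    have e2 : N - (s + 1 + r) = N - s - 1 - r := by omega
    have e3 : s + 1 + r - 1 - s = r := by omega
    rw [e2, e3]
  have hle : Φ ≤ ∑ n ∈ Finset.range (N + 1), w (N - n) • lazyKernel P π n +
      ENNReal.ofReal (24 / 25) • Φ := by
    nth_rewrite 1 [hexp]
    refine add_le_add le_rfl ?_
    rw [hΦ, Finset.smul_sum]
    refine Finset.sum_le_sum fun s _ => ?_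
    refine (pairStep_iterate_mono s (hcontr (N - s))).trans (le_of_eq ?_)
    rw [pairStep_iterate_smul, mul_smul]
  have h1 := le_of_le_add_mul_self hfin (hle x y)
  -- Keep the term `n = N`, whose weight is `slowWeight 0 = 1`.
  have h2 : (pairStep P)^[N] f x y ≤ Φ x y := by
    rw [hΦ, Finset.sum_apply, Finset.sum_apply]
    refine le_trans (le_of_eq ?_) (Finset.single_le_sum (f := fun n =>
      (w (N - n) • (pairStep P)^[n] f) x y) (fun _ _ => zero_le) (Finset.self_mem_range_succ N))
    simp [hw, slowWeight_zero]
  refine h2.trans (h1.trans (le_of_eq ?_))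
  rw [Finset.sum_apply, Finset.sum_apply]
  rfl

/-- Decay of the collision probability of the pair chain, from the decay of the return
probabilities of the lazy walk. -/
theorem exists_pairStep_iterate_le : ∃ K : ℝ, 0 < K ∧
    ∀ {V : Type*} {P : V → V → ℝ} {π : V → ℝ}, IsStochasticMatrix P → IsReversibleWrt P π →
      ∀ M : ℝ, (∀ v, 1 / π v ≤ M) → ∀ (x : V) (B η : ℝ), 0 ≤ B → 0 ≤ η →
        (∀ n : ℕ, polyEntry P x x (lazyPoly ^ n) ≤ B * (1 / √((n : ℝ) + 1) + η)) → ∀ N : ℕ,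
          (pairStep P)^[N] (lazyKernel P π 0) x x ≤
            ENNReal.ofReal (K * B / π x * (1 / √((N : ℝ) + 1) + η)) := by
  obtain ⟨K, hK0, hK⟩ := exists_sum_slowWeight_mul_sqrt_le
  refine ⟨25 * K, by positivity, ?_⟩
  intro V P π hP hπ M hM x B η hB hη hx N
  have hM0 : 0 ≤ M := le_trans (by have := hπ.pos x; positivity) (hM x)
  have hpx := hπ.pos x
  refine (pairStep_iterate_le_sum hP hπ hM hM0 N x x).trans ?_
  unfold lazyKernel
  simp_rw [← ENNReal.ofReal_mul (slowWeight_pos _).le]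
  have hq := fun n => polyEntry_lazy_pow_nonneg hP n x x
  rw [← ENNReal.ofReal_sum_of_nonneg (fun n _ => mul_nonneg (slowWeight_pos _).le
    (div_nonneg (hq n) hpx.le)), ← ENNReal.ofReal_mul (by norm_num)]
  refine ENNReal.ofReal_le_ofReal ?_
  have h1 : ∀ n ∈ Finset.range (N + 1),
      slowWeight (N - n) * (polyEntry P x x (lazyPoly ^ n) / π x) ≤
      B / π x * (1 / √((N : ℝ) + 1) + η) * (slowWeight (N - n) * √(((N - n : ℕ) : ℝ) + 1)) := by
    intro n hn
    have hn' : n ≤ N := Nat.lt_succ_iff.1 (Finset.mem_range.1 hn)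
    have hw := slowWeight_pos (N - n)
    -- Equivalent to `N + 1 ≤ (n + 1) * (N - n + 1)`.
    have h2 : 1 / √((n : ℝ) + 1) ≤ 1 / √((N : ℝ) + 1) * √(((N - n : ℕ) : ℝ) + 1) := by
      rw [one_div_mul_eq_div, div_le_div_iff₀ (Real.sqrt_pos.2 (by positivity))
        (Real.sqrt_pos.2 (by positivity)), one_mul, ← Real.sqrt_mul (by positivity)]
      refine Real.sqrt_le_sqrt ?_
      have h5 : (N : ℝ) = (N - n : ℕ) + n := by rw [← Nat.cast_add]; congr 1; omega
      have h6 : (0 : ℝ) ≤ ((N - n : ℕ) : ℝ) * n := by positivity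
      nlinarith
    have h3 : η ≤ η * √(((N - n : ℕ) : ℝ) + 1) := by
      refine le_mul_of_one_le_right hη ?_
      rw [Real.one_le_sqrt]
      have : (0 : ℝ) ≤ ((N - n : ℕ) : ℝ) := Nat.cast_nonneg _
      linarith
    have h4 : polyEntry P x x (lazyPoly ^ n) ≤
        B * ((1 / √((N : ℝ) + 1) + η) * √(((N - n : ℕ) : ℝ) + 1)) :=
      (hx n).trans (mul_le_mul_of_nonneg_left (by linarith) hB)
    calc slowWeight (N - n) * (polyEntry P x x (lazyPoly ^ n) / π x) ≤ slowWeight (N - n) *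
          (B * ((1 / √((N : ℝ) + 1) + η) * √(((N - n : ℕ) : ℝ) + 1)) / π x) := by gcongr
      _ = _ := by ring
  have h5 := Finset.sum_le_sum h1
  rw [← Finset.mul_sum] at h5
  have h6 : ∑ n ∈ Finset.range (N + 1), slowWeight (N - n) * √(((N - n : ℕ) : ℝ) + 1) ≤ K := by
    have := hK (N + 1)
    rwa [← Finset.sum_range_reflect] at this
  have h7 : 0 ≤ B / π x * (1 / √((N : ℝ) + 1) + η) := by positivity
  calc _ ≤ 25 * (B / π x * (1 / √((N : ℝ) + 1) + η) * K) :=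
        mul_le_mul_of_nonneg_left (h5.trans (mul_le_mul_of_nonneg_left h6 h7)) (by norm_num)
    _ = _ := by ring

end PairDecay

/-! ### Poissonization -/

section Poisson

/-- The Poisson weights with parameter `4 t`. -/
noncomputable def poissonFour (N : ℕ) (t : ℝ) : ℝ :=
  Real.exp (-(4 * t)) * ((4 * t) ^ N / N.factorial)

theorem poissonFour_nonneg (N : ℕ) {t : ℝ} (ht : 0 ≤ t) : 0 ≤ poissonFour N t := by
  unfold poissonFour; positivity

theorem hasSum_poissonFour (t : ℝ) : HasSum (fun N => poissonFour N t) 1 := by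
  have h := (NormedSpace.expSeries_div_hasSum_exp (4 * t)).mul_left (Real.exp (-(4 * t)))
  rwa [← Real.exp_eq_exp_ℝ, ← Real.exp_add, neg_add_cancel, Real.exp_zero] at h

theorem continuous_poissonFour (N : ℕ) : Continuous (poissonFour N) := by
  unfold poissonFour; fun_prop

theorem hasDerivAt_poissonFour_zero (t : ℝ) :
    HasDerivAt (poissonFour 0) (-(4 * poissonFour 0 t)) t := by
  have h : poissonFour 0 = fun t => Real.exp (-(4 * t)) := by
    ext t; simp [poissonFour]
  rw [h]
  have h1 : HasDerivAt (fun t : ℝ => -(4 * t)) (-(4 * 1)) t := ((hasDerivAt_id t).const_mul 4).neg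
  refine h1.exp.congr_deriv ?_
  ring

theorem hasDerivAt_poissonFour_succ (N : ℕ) (t : ℝ) :
    HasDerivAt (poissonFour (N + 1)) (4 * poissonFour N t - 4 * poissonFour (N + 1) t) t := by
  have h1 : HasDerivAt (fun t : ℝ => Real.exp (-(4 * t))) (Real.exp (-(4 * t)) * -(4 * 1)) t :=
    (((hasDerivAt_id t).const_mul 4).neg).exp
  have h2 : HasDerivAt (fun t : ℝ => (4 * t) ^ (N + 1) / ((N + 1).factorial : ℝ))
      (((N + 1 : ℕ) : ℝ) * (4 * t) ^ N * (4 * 1) / ((N + 1).factorial : ℝ)) t := by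
    have := (((hasDerivAt_id t).const_mul 4).pow (N + 1)).div_const ((N + 1).factorial : ℝ)
    simpa using this
  refine (h1.mul h2).congr_deriv ?_
  unfold poissonFour
  rw [Nat.factorial_succ]
  push_cast
  have : (N.factorial : ℝ) ≠ 0 := by positivity
  field_simp
  ring

/-- The Poisson weights integrated against an exponential. -/
noncomputable def expConv (r : ℝ) (N : ℕ) (t : ℝ) : ℝ :=
  ∫ s in (0 : ℝ)..t, Real.exp (-(r * s)) * poissonFour N (t - s)

theorem continuous_exp_mul_poissonFour (r : ℝ) (N : ℕ) (t : ℝ) :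
    Continuous fun s => Real.exp (-(r * s)) * poissonFour N (t - s) := by
  have := continuous_poissonFour N
  fun_prop

theorem hasDerivAt_exp_neg_mul (r s : ℝ) :
    HasDerivAt (fun s : ℝ => Real.exp (-(r * s))) (-(r * Real.exp (-(r * s)))) s := by
  have h1 : HasDerivAt (fun s : ℝ => -(r * s)) (-(r * 1)) s := ((hasDerivAt_id s).const_mul r).neg
  refine h1.exp.congr_deriv ?_
  ring

/-- Integrate the derivative of `exp (-r s) * poissonFour 0 (t - s)` over `[0, t]`. Together with
`poissonFour_succ_eq`, this compares a chain jumping at rate `r` with its version at rate four,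
where the remaining rate `4 - r` produces no motion. -/
theorem poissonFour_zero_eq (r t : ℝ) :
    poissonFour 0 t + (4 - r) * expConv r 0 t = Real.exp (-(r * t)) := by
  have hd : ∀ s ∈ Set.uIcc 0 t, HasDerivAt (fun s => Real.exp (-(r * s)) * poissonFour 0 (t - s))
      ((4 - r) * (Real.exp (-(r * s)) * poissonFour 0 (t - s))) s := by
    intro s _
    have h2 := (hasDerivAt_poissonFour_zero (t - s)).comp_const_sub t s
    refine ((hasDerivAt_exp_neg_mul r s).mul h2).congr_deriv ?_
    ring
  have h := intervalIntegral.integral_eq_sub_of_hasDerivAt hd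
    ((continuous_const.mul (continuous_exp_mul_poissonFour r 0 t)).intervalIntegrable 0 t)
  rw [intervalIntegral.integral_const_mul] at h
  unfold expConv
  rw [h]
  simp [poissonFour]

theorem poissonFour_succ_eq (r t : ℝ) (N : ℕ) :
    poissonFour (N + 1) t + (4 - r) * expConv r (N + 1) t = 4 * expConv r N t := by
  have hd : ∀ s ∈ Set.uIcc 0 t,
      HasDerivAt (fun s => Real.exp (-(r * s)) * poissonFour (N + 1) (t - s))
      ((4 - r) * (Real.exp (-(r * s)) * poissonFour (N + 1) (t - s)) -
        4 * (Real.exp (-(r * s)) * poissonFour N (t - s))) s := by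
    intro s _
    have h2 := (hasDerivAt_poissonFour_succ N (t - s)).comp_const_sub t s
    refine ((hasDerivAt_exp_neg_mul r s).mul h2).congr_deriv ?_
    ring
  have c1 : Continuous fun s => (4 - r) * (Real.exp (-(r * s)) * poissonFour (N + 1) (t - s)) :=
    continuous_const.mul (continuous_exp_mul_poissonFour r (N + 1) t)
  have c2 : Continuous fun s => 4 * (Real.exp (-(r * s)) * poissonFour N (t - s)) :=
    continuous_const.mul (continuous_exp_mul_poissonFour r N t)
  have h := intervalIntegral.integral_eq_sub_of_hasDerivAt hd
    ((c1.sub c2).intervalIntegrable 0 t)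
  rw [intervalIntegral.integral_sub (c1.intervalIntegrable 0 t) (c2.intervalIntegrable 0 t),
    intervalIntegral.integral_const_mul, intervalIntegral.integral_const_mul] at h
  have e : poissonFour (N + 1) (t - t) = 0 := by simp [poissonFour]
  have e2 : Real.exp (-(r * 0)) * poissonFour (N + 1) (t - 0) = poissonFour (N + 1) t := by simp
  rw [e, e2] at h
  unfold expConv
  linarith

theorem expConv_nonneg (r : ℝ) (N : ℕ) {t : ℝ} (ht : 0 ≤ t) : 0 ≤ expConv r N t :=
  intervalIntegral.integral_nonneg ht fun s hs =>
    mul_nonneg (Real.exp_pos _).le (poissonFour_nonneg N (by linarith [hs.2]))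

theorem lintegral_exp_mul_poissonFour (r : ℝ) (N : ℕ) {t : ℝ} (ht : 0 ≤ t) :
    ∫⁻ s in Set.Ioc 0 t, ENNReal.ofReal (Real.exp (-(r * s))) *
      ENNReal.ofReal (poissonFour N (t - s)) = ENNReal.ofReal (expConv r N t) := by
  unfold expConv
  rw [intervalIntegral.integral_of_le ht, ofReal_integral_eq_lintegral_ofReal]
  · exact lintegral_congr fun s => (ENNReal.ofReal_mul (Real.exp_pos _).le).symm
  · exact ((continuous_exp_mul_poissonFour r N t).intervalIntegrable 0 t).1
  · refine (ae_restrict_iff' measurableSet_Ioc).2 (ae_of_all _ fun s hs => ?_)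
    exact mul_nonneg (Real.exp_pos _).le (poissonFour_nonneg N (by linarith [hs.2]))

theorem tsum_expConv_le (r : ℝ) (hr : 0 ≤ r) {t : ℝ} (ht : 0 ≤ t) :
    ∑' N, ENNReal.ofReal (expConv r N t) ≤ ENNReal.ofReal t := by
  simp_rw [← lintegral_exp_mul_poissonFour r _ ht]
  rw [← lintegral_tsum fun N => by
    have := (continuous_poissonFour N).measurable
    exact Measurable.aemeasurable (by fun_prop)]
  calc _ ≤ ∫⁻ s in Set.Ioc 0 t, 1 := by
        refine setLIntegral_mono measurable_const fun s hs => ?_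
        rw [ENNReal.tsum_mul_left, tsum_ofReal_eq (fun N => poissonFour_nonneg N
          (by linarith [hs.2])) (hasSum_poissonFour _), ENNReal.ofReal_one, mul_one,
          ← ENNReal.ofReal_one]
        refine ENNReal.ofReal_le_ofReal (Real.exp_le_one_iff.2 ?_)
        have := mul_nonneg hr hs.1.le
        linarith
    _ = _ := by simp

theorem hasSum_poissonFour_div_succ {t : ℝ} (ht : 0 < t) :
    ∑' N, ENNReal.ofReal (poissonFour N t * (1 / ((N : ℝ) + 1))) ≤ ENNReal.ofReal (1 / (4 * t)) := by
  have e : ∀ N : ℕ, poissonFour N t * (1 / ((N : ℝ) + 1)) =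
      1 / (4 * t) * poissonFour (N + 1) t := by
    intro N
    unfold poissonFour
    rw [Nat.factorial_succ]
    push_cast
    field_simp
    ring
  simp_rw [e, ENNReal.ofReal_mul (show 0 ≤ 1 / (4 * t) by positivity)]
  rw [ENNReal.tsum_mul_left]
  refine mul_le_of_le_one_right zero_le ?_
  calc _ ≤ ∑' N, ENNReal.ofReal (poissonFour N t) :=
        ENNReal.tsum_comp_le_tsum_of_injective (add_left_injective 1) _
    _ = 1 := by
      rw [tsum_ofReal_eq (fun N => poissonFour_nonneg N ht.le) (hasSum_poissonFour _),
        ENNReal.ofReal_one]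

/-- The arithmetic-geometric mean bound with `c = √(4 * t)`, the square root of the Poisson mean.
The exact outcome is `3 / (2 √t)`, rounded up. -/
theorem tsum_poissonFour_mul_le {t : ℝ} (ht : 0 < t) :
    ∑' N : ℕ, ENNReal.ofReal (poissonFour N t * (1 / √((N : ℝ) + 1) + 1 / √t)) ≤
      ENNReal.ofReal (2 / √t) := by
  have h4 : 0 < 4 * t := by linarith
  have hs := Real.sqrt_pos.2 h4
  have hp := fun N => poissonFour_nonneg N ht.le
  have h1 : ∀ N : ℕ, ENNReal.ofReal (poissonFour N t * (1 / √((N : ℝ) + 1) + 1 / √t)) ≤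
      ENNReal.ofReal (√(4 * t) / 2) * ENNReal.ofReal (poissonFour N t * (1 / ((N : ℝ) + 1))) +
        ENNReal.ofReal (1 / √(4 * t) / 2 + 1 / √t) * ENNReal.ofReal (poissonFour N t) := by
    intro N
    have hN := hp N
    rw [← ENNReal.ofReal_mul (by positivity), ← ENNReal.ofReal_mul (by positivity),
      ← ENNReal.ofReal_add (by positivity) (by positivity)]
    refine ENNReal.ofReal_le_ofReal ?_
    have h2 := inv_sqrt_le_of_pos (a := (N : ℝ) + 1) (by positivity) hs
    have h3 := mul_le_mul_of_nonneg_left h2 hN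
    linarith
  refine (ENNReal.tsum_le_tsum h1).trans ?_
  rw [ENNReal.tsum_add, ENNReal.tsum_mul_left, ENNReal.tsum_mul_left,
    tsum_ofReal_eq hp (hasSum_poissonFour _), ENNReal.ofReal_one, mul_one]
  calc _ ≤ ENNReal.ofReal (√(4 * t) / 2) * ENNReal.ofReal (1 / (4 * t)) +
        ENNReal.ofReal (1 / √(4 * t) / 2 + 1 / √t) := by
          gcongr; exact hasSum_poissonFour_div_succ ht
    _ ≤ _ := by
      rw [← ENNReal.ofReal_mul (by positivity), ← ENNReal.ofReal_add (by positivity) (by positivity)]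
      refine ENNReal.ofReal_le_ofReal ?_
      have hst := Real.sqrt_pos.2 ht
      have e2 : √(4 * t) = 2 * √t := by
        rw [Real.sqrt_mul (by norm_num), show (4 : ℝ) = 2 ^ 2 by norm_num]; simp
      have e3 : 1 / (4 * t) = 1 / (4 * (√t * √t)) := by rw [Real.mul_self_sqrt ht.le]
      rw [e2, e3]
      have : 2 * √t / 2 * (1 / (4 * (√t * √t))) + (1 / (2 * √t) / 2 + 1 / √t) = 3 / 2 / √t := by
        field_simp; norm_num
      rw [this]
      gcongr
      norm_num

end Poisson

/-! ### The pair chain in continuous time and its first jump inequality -/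

section Supersolution

variable {V : Type*} {P : V → V → ℝ} {π : V → ℝ}

/-- The pair chain at rate four, run for time `t`. -/
noncomputable def pairFlow (P : V → V → ℝ) (φ : V → V → ℝ≥0∞) (t : ℝ) (x y : V) : ℝ≥0∞ :=
  ∑' N, ENNReal.ofReal (poissonFour N t) * (pairStep P)^[N] φ x y

theorem four_mul_pairStep (φ : V → V → ℝ≥0∞) (x y : V) :
    4 * pairStep P φ x y = ((4 - pairRate x y : ℕ) : ℝ≥0∞) * φ x y + pairJump P φ x y := by
  unfold pairStep
  rw [← mul_assoc, ENNReal.mul_inv_cancel (by norm_num) (by norm_num), one_mul]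

/-- The flow satisfies the first jump inequality of the pair of walks. -/
theorem pairFlow_first_jump (hP : IsStochasticMatrix P) {φ : V → V → ℝ≥0∞} {M : ℝ}
    (hφ : ∀ x y, φ x y ≤ ENNReal.ofReal M) {t : ℝ} (ht : 0 ≤ t) (x y : V) :
    ENNReal.ofReal (Real.exp (-((pairRate x y : ℝ) * t))) * φ x y +
      ∫⁻ s in Set.Ioc 0 t, ENNReal.ofReal (Real.exp (-((pairRate x y : ℝ) * s))) *
        pairJump P (pairFlow P φ (t - s)) x y ≤ pairFlow P φ t x y := by
  set r : ℝ := (pairRate x y : ℝ) with hr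
  set a : ℕ → ℝ≥0∞ := fun N => (pairStep P)^[N] φ x y with ha
  set q : ℕ → ℝ≥0∞ := fun N => pairJump P ((pairStep P)^[N] φ) x y with hq
  set I : ℕ → ℝ≥0∞ := fun N => ENNReal.ofReal (expConv r N t) with hI
  set d : ℝ≥0∞ := ((4 - pairRate x y : ℕ) : ℝ≥0∞) with hd
  have hr0 : 0 ≤ r := Nat.cast_nonneg _
  have hdr : d = ENNReal.ofReal (4 - r) ∧ 0 ≤ 4 - r := by
    have hle : pairRate x y ≤ 4 := by unfold pairRate; split_ifs <;> norm_num
    have e : (4 : ℝ) - r = ((4 - pairRate x y : ℕ) : ℝ) := by rw [Nat.cast_sub hle]; norm_num [hr]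
    rw [e, hd]
    exact ⟨(ENNReal.ofReal_natCast _).symm, Nat.cast_nonneg _⟩
  have h4 : (4 : ℝ≥0∞) = ENNReal.ofReal 4 := by norm_num
  -- A step of the chain at rate four is either idle, at rate `d`, or a genuine jump. The next two
  -- identities are the matching recursion for the Poisson coefficients.
  have hrec : ∀ N, 4 * a (N + 1) = d * a N + q N := fun N => by
    simp only [ha, hq, hd, Function.iterate_succ_apply']
    exact four_mul_pairStep _ x y
  have hc0 : ENNReal.ofReal (poissonFour 0 t) + d * I 0 = ENNReal.ofReal (Real.exp (-(r * t))) := by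
    rw [hdr.1, hI, ← ENNReal.ofReal_mul hdr.2, ← ENNReal.ofReal_add (poissonFour_nonneg 0 ht)
      (mul_nonneg hdr.2 (expConv_nonneg r 0 ht)), poissonFour_zero_eq]
  have hcs : ∀ N, ENNReal.ofReal (poissonFour (N + 1) t) + d * I (N + 1) = 4 * I N := fun N => by
    rw [hdr.1, hI, h4, ← ENNReal.ofReal_mul hdr.2, ← ENNReal.ofReal_add (poissonFour_nonneg _ ht)
      (mul_nonneg hdr.2 (expConv_nonneg r _ ht)), poissonFour_succ_eq,
      ENNReal.ofReal_mul (by norm_num)]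
  have hint : ∫⁻ s in Set.Ioc 0 t, ENNReal.ofReal (Real.exp (-(r * s))) *
      pairJump P (pairFlow P φ (t - s)) x y = ∑' N, I N * q N := by
    have e1 : ∀ s, ENNReal.ofReal (Real.exp (-(r * s))) * pairJump P (pairFlow P φ (t - s)) x y =
        ∑' N, ENNReal.ofReal (Real.exp (-(r * s))) * ENNReal.ofReal (poissonFour N (t - s)) *
          q N := by
      intro s
      unfold pairFlow
      rw [pairJump_tsum, ← ENNReal.tsum_mul_left]
      exact tsum_congr fun N => (mul_assoc _ _ _).symm
    simp_rw [e1]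
    have hm : ∀ N, Measurable fun s => ENNReal.ofReal (Real.exp (-(r * s))) *
        ENNReal.ofReal (poissonFour N (t - s)) := fun N => by
      have := (continuous_poissonFour N).measurable
      fun_prop
    rw [lintegral_tsum fun N => ((hm N).mul_const _).aemeasurable]
    refine tsum_congr fun N => ?_
    rw [lintegral_mul_const _ (hm N), lintegral_exp_mul_poissonFour r N ht]
  have hbd : ∀ N, a N ≤ ENNReal.ofReal M := fun N => pairStep_iterate_le hP hφ N x y
  have hfin : ∑' N, d * I N * a N ≠ ∞ := by
    refine ne_top_of_le_ne_top (b := d * ENNReal.ofReal t * ENNReal.ofReal M) ?_ ?_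
    · exact ENNReal.mul_ne_top (ENNReal.mul_ne_top (ENNReal.natCast_ne_top _)
        ENNReal.ofReal_ne_top) ENNReal.ofReal_ne_top
    · calc _ ≤ ∑' N, d * I N * ENNReal.ofReal M := ENNReal.tsum_le_tsum fun N => by
            gcongr; exact hbd N
        _ = d * (∑' N, I N) * ENNReal.ofReal M := by
            rw [ENNReal.tsum_mul_right, ENNReal.tsum_mul_left]
        _ ≤ _ := by gcongr; exact tsum_expConv_le r hr0 ht
  rw [hint]
  -- The idle contribution is added to both sides, as subtraction is not available in `ℝ≥0∞`; it is
  -- finite by `hfin`. The two sides are then equal term by term.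
  refine (ENNReal.add_le_add_iff_right hfin).1 (le_of_eq ?_)
  have hR : pairFlow P φ t x y + ∑' N, d * I N * a N =
      ENNReal.ofReal (Real.exp (-(r * t))) * a 0 + ∑' N, 4 * I N * a (N + 1) := by
    have e2 : pairFlow P φ t x y + ∑' N, d * I N * a N =
        ∑' N, (ENNReal.ofReal (poissonFour N t) + d * I N) * a N := by
      simp_rw [add_mul]
      rw [ENNReal.tsum_add]
      rfl
    rw [e2, tsum_eq_zero_add' ENNReal.summable, hc0]
    simp_rw [hcs]
  rw [hR]
  have e3 : ∀ N, 4 * I N * a (N + 1) = I N * q N + d * I N * a N := fun N => by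
    rw [mul_comm 4, mul_assoc, hrec]; ring
  simp_rw [e3]
  rw [ENNReal.tsum_add, ← add_assoc]
  rfl

open Polynomial in
/-- Decay of the collision probability of the pair of walks. -/
theorem exists_pairFlow_le : ∃ K : ℝ, 0 < K ∧
    ∀ {V : Type*} {P : V → V → ℝ} {π : V → ℝ}, IsStochasticMatrix P → IsReversibleWrt P π →
      ∀ M : ℝ, (∀ v, 1 / π v ≤ M) → ∀ (x : V) (B t : ℝ), 0 ≤ B → 0 < t →
        (∀ n : ℕ, polyEntry P x x (lazyPoly ^ n) ≤ B * (1 / √((n : ℝ) + 1) + 1 / √t)) →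
          pairFlow P (lazyKernel P π 0) t x x ≤ ENNReal.ofReal (K * B / π x / √t) := by
  obtain ⟨K, hK0, hK⟩ := exists_pairStep_iterate_le
  refine ⟨2 * K, by positivity, ?_⟩
  intro V P π hP hπ M hM x B t hB ht hx
  have hpx := hπ.pos x
  have hk : 0 ≤ K * B / π x := by positivity
  have h := hK hP hπ M hM x B (1 / √t) hB (by positivity) hx
  unfold pairFlow
  calc _ ≤ ∑' N : ℕ, ENNReal.ofReal (K * B / π x) *
        ENNReal.ofReal (poissonFour N t * (1 / √((N : ℝ) + 1) + 1 / √t)) := by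
        refine ENNReal.tsum_le_tsum fun N => ?_
        refine (mul_le_mul_right (h N) _).trans (le_of_eq ?_)
        rw [← ENNReal.ofReal_mul (poissonFour_nonneg N ht.le), ← ENNReal.ofReal_mul hk]
        congr 1; ring
    _ ≤ ENNReal.ofReal (K * B / π x) * ENNReal.ofReal (2 / √t) := by
        rw [ENNReal.tsum_mul_left]; gcongr; exact tsum_poissonFour_mul_le ht
    _ = _ := by rw [← ENNReal.ofReal_mul hk]; congr 1; ring

end Supersolution

/-! ### Shifting a clock -/

section Clock

/-- The time of ring number `k` of a clock with the given waiting times. -/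
noncomputable def ring' (g : ℕ → ℝ) (k : ℕ) : ℝ := ∑ i ∈ Finset.range (k + 1), g i

/-- The number of rings of a clock up to time `s`. -/
noncomputable def nextIdx (s : ℝ) (g : ℕ → ℝ) : ℕ := sInf {k | s < ring' g k}

/-- The waiting times of a clock, seen from time `s`. -/
noncomputable def shiftClock (s : ℝ) (g : ℕ → ℝ) (j : ℕ) : ℝ :=
  if j = 0 then ring' g (nextIdx s g) - s else g (nextIdx s g + j)

/-- The clock with first waiting time `s`, followed by the waiting times `b`. -/
def consClock (s : ℝ) (b : ℕ → ℝ) (j : ℕ) : ℝ := Nat.casesOn j s b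

/-- The waiting times are positive and the rings do not accumulate. -/
structure GoodClock (g : ℕ → ℝ) : Prop where
  pos : ∀ i, 0 < g i
  unbounded : ∀ s, ∃ k, s < ring' g k

theorem ring'_zero (g : ℕ → ℝ) : ring' g 0 = g 0 := by simp [ring']

theorem ring'_succ (g : ℕ → ℝ) (k : ℕ) : ring' g (k + 1) = ring' g k + g (k + 1) :=
  Finset.sum_range_succ _ _

theorem ring'_consClock_zero (s : ℝ) (b : ℕ → ℝ) : ring' (consClock s b) 0 = s := ring'_zero _

theorem ring'_consClock_succ (s : ℝ) (b : ℕ → ℝ) (k : ℕ) :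
    ring' (consClock s b) (k + 1) = s + ring' b k := by
  unfold ring'
  rw [Finset.sum_range_succ', add_comm]
  rfl

theorem ring'_shiftClock (s : ℝ) (g : ℕ → ℝ) (j : ℕ) :
    ring' (shiftClock s g) j = ring' g (nextIdx s g + j) - s := by
  induction j with
  | zero => rw [ring'_zero]; rfl
  | succ j ih =>
    have h : nextIdx s g + (j + 1) = nextIdx s g + j + 1 := rfl
    rw [ring'_succ, ih, shiftClock, if_neg j.succ_ne_zero, h, ring'_succ g]
    ring

theorem nextIdx_le {s : ℝ} {g : ℕ → ℝ} {k : ℕ} (h : s < ring' g k) : nextIdx s g ≤ k :=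
  Nat.sInf_le h

theorem nextIdx_eq_zero_of_lt {s : ℝ} {g : ℕ → ℝ} (h : s < g 0) : nextIdx s g = 0 :=
  Nat.le_zero.1 (nextIdx_le (by rwa [ring'_zero]))

theorem shiftClock_of_lt {s : ℝ} {g : ℕ → ℝ} (h : s < g 0) :
    shiftClock s g = fun j => if j = 0 then g 0 - s else g j := by
  ext j
  rw [shiftClock, nextIdx_eq_zero_of_lt h, ring'_zero, zero_add]

theorem shiftClock_zero_of_lt {s : ℝ} {g : ℕ → ℝ} (h : s < g 0) : shiftClock s g 0 = g 0 - s := by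
  rw [shiftClock_of_lt h]
  rfl

theorem shiftClock_consClock_of_lt {s r : ℝ} (b : ℕ → ℝ) (h : s < r) :
    shiftClock s (consClock r b) = consClock (r - s) b := by
  rw [shiftClock_of_lt (show s < consClock r b 0 from h)]
  ext j
  cases j <;> rfl

namespace GoodClock

variable {g : ℕ → ℝ}

theorem strictMono (hg : GoodClock g) : StrictMono (ring' g) :=
  strictMono_nat_of_lt_succ fun k => by rw [ring'_succ]; linarith [hg.pos (k + 1)]

theorem lt_ring'_nextIdx (hg : GoodClock g) (s : ℝ) : s < ring' g (nextIdx s g) :=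
  Nat.sInf_mem (hg.unbounded s)

theorem lt_ring'_iff (hg : GoodClock g) (s : ℝ) (k : ℕ) : s < ring' g k ↔ nextIdx s g ≤ k :=
  ⟨nextIdx_le, fun h => (hg.lt_ring'_nextIdx s).trans_le (hg.strictMono.monotone h)⟩

theorem shift (hg : GoodClock g) (s : ℝ) : GoodClock (shiftClock s g) := by
  refine ⟨fun i => ?_, fun r => ?_⟩
  · unfold shiftClock
    split_ifs
    · exact sub_pos.2 (hg.lt_ring'_nextIdx s)
    · exact hg.pos _
  · obtain ⟨k, hk⟩ := hg.unbounded (r + s)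
    refine ⟨k, ?_⟩
    rw [ring'_shiftClock]
    have := hg.strictMono.monotone (Nat.le_add_left k (nextIdx s g))
    linarith

theorem nextIdx_add (hg : GoodClock g) {a : ℝ} (ha : 0 ≤ a) (b : ℝ) :
    nextIdx (a + b) g = nextIdx b g + nextIdx a (shiftClock b g) := by
  have hs := hg.shift b
  have key : ∀ j, a + b < ring' g (nextIdx b g + j) ↔ nextIdx a (shiftClock b g) ≤ j := fun j => by
    rw [← hs.lt_ring'_iff, ring'_shiftClock]
    constructor <;> intro h <;> linarith
  apply le_antisymm
  · exact nextIdx_le ((key _).2 le_rfl)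
  · have h1 := hg.lt_ring'_nextIdx (a + b)
    have h2 : nextIdx b g ≤ nextIdx (a + b) g := nextIdx_le (by linarith)
    obtain ⟨j, hj⟩ := Nat.exists_eq_add_of_le h2
    rw [hj] at h1 ⊢
    exact Nat.add_le_add_left ((key j).1 h1) _

/-- Flow property of the time shift. The sign of `a` matters, since the shifted clock has forgotten
the rings up to time `b`. -/
theorem shift_shift (hg : GoodClock g) {a : ℝ} (ha : 0 ≤ a) (b : ℝ) :
    shiftClock a (shiftClock b g) = shiftClock (a + b) g := by
  ext j
  have h := hg.nextIdx_add ha b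
  by_cases hj : j = 0
  · subst hj
    rw [shiftClock, if_pos rfl, shiftClock, if_pos rfl, ring'_shiftClock, h]
    ring
  · rw [shiftClock, if_neg hj, shiftClock, if_neg (by omega), shiftClock, if_neg hj, h, add_assoc]

theorem shift_zero (hg : GoodClock g) : shiftClock 0 g = g := by
  rw [shiftClock_of_lt (hg.pos 0)]
  ext j
  split_ifs with h
  · rw [h, sub_zero]
  · rfl

theorem cons {b : ℕ → ℝ} (hb : GoodClock b) {r : ℝ} (hr : 0 < r) : GoodClock (consClock r b) := by
  refine ⟨fun i => ?_, fun s => ?_⟩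
  · cases i with
    | zero => exact hr
    | succ i => exact hb.pos i
  · obtain ⟨k, hk⟩ := hb.unbounded (s - r)
    exact ⟨k + 1, by rw [ring'_consClock_succ]; linarith⟩

theorem shift_cons_self {b : ℕ → ℝ} (hb : GoodClock b) (r : ℝ) :
    nextIdx r (consClock r b) = 1 ∧ shiftClock r (consClock r b) = b := by
  have h1 : nextIdx r (consClock r b) = 1 := by
    apply le_antisymm
    · exact nextIdx_le (by rw [ring'_consClock_succ, ring'_zero]; linarith [hb.pos 0])
    · by_contra h
      have h0 : nextIdx r (consClock r b) = 0 := by omega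
      have h2 : r < ring' (consClock r b) (nextIdx r (consClock r b)) :=
        Nat.sInf_mem (s := {k | r < ring' (consClock r b) k})
          ⟨1, by change r < ring' (consClock r b) (0 + 1); rw [ring'_consClock_succ, ring'_zero]; linarith [hb.pos 0]⟩
      rw [h0, ring'_consClock_zero] at h2
      exact lt_irrefl _ h2
  refine ⟨h1, ?_⟩
  ext j
  rw [shiftClock, h1]
  split_ifs with hj
  · rw [hj, show 1 = 0 + 1 from rfl, ring'_consClock_succ, ring'_zero]; ring
  · rw [add_comm]; rfl

theorem shift_cons_of_le {b : ℕ → ℝ} (hb : GoodClock b) {r s : ℝ} (hr : 0 < r) (hs : r ≤ s) :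
    nextIdx s (consClock r b) = nextIdx (s - r) b + 1 ∧
      shiftClock s (consClock r b) = shiftClock (s - r) b := by
  have h1 := (hb.cons hr).nextIdx_add (sub_nonneg.2 hs) r
  have h2 := (hb.cons hr).shift_shift (sub_nonneg.2 hs) r
  rw [sub_add_cancel] at h1 h2
  rw [(hb.shift_cons_self r).1, (hb.shift_cons_self r).2] at h1
  rw [(hb.shift_cons_self r).2] at h2
  exact ⟨h1.trans (add_comm _ _), h2.symm⟩

end GoodClock

@[fun_prop]
theorem measurable_ring' (k : ℕ) : Measurable fun g => ring' g k := by
  unfold ring'; fun_prop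

theorem measurable_nextIdx : Measurable fun p : ℝ × (ℕ → ℝ) => nextIdx p.1 p.2 := by
  refine measurable_to_countable' fun k => ?_
  have hlt : ∀ j, MeasurableSet {p : ℝ × (ℕ → ℝ) | p.1 < ring' p.2 j} := fun j =>
    measurableSet_lt measurable_fst ((measurable_ring' j).comp measurable_snd)
  -- The second set covers the clocks without any ring after `s`, where `sInf ∅ = 0`.
  have e : (fun p : ℝ × (ℕ → ℝ) => nextIdx p.1 p.2) ⁻¹' {k} =
      ({p | p.1 < ring' p.2 k} ∩ ⋂ j ∈ Set.Iio k, {p | p.1 < ring' p.2 j}ᶜ) ∪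
        ({_p | k = 0} ∩ ⋂ j, {p | p.1 < ring' p.2 j}ᶜ) := by
    ext ⟨s, g⟩
    simp only [Set.mem_preimage, Set.mem_singleton_iff, Set.mem_union, Set.mem_inter_iff,
      Set.mem_ofPred_eq, Set.mem_iInter, Set.mem_compl_iff, Set.mem_Iio]
    constructor
    · intro h
      by_cases hne : ∃ j, s < ring' g j
      · left
        have h1 : s < ring' g (nextIdx s g) := Nat.sInf_mem (s := {k | s < ring' g k}) hne
        rw [h] at h1
        exact ⟨h1, fun j hj hlt => absurd (nextIdx_le hlt) (by omega)⟩
      · right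
        push Not at hne
        refine ⟨?_, fun j => not_lt.2 (hne j)⟩
        rw [← h, nextIdx]
        have : {k | s < ring' g k} = ∅ := by ext j; simpa using hne j
        rw [this, Nat.sInf_empty]
    · rintro (⟨h1, h2⟩ | ⟨rfl, h2⟩)
      · apply le_antisymm (nextIdx_le h1)
        by_contra hlt'
        exact h2 _ (not_le.1 hlt') (Nat.sInf_mem (s := {k | s < ring' g k}) ⟨k, h1⟩)
      · have : {k | s < ring' g k} = ∅ := by ext j; simpa using h2 j
        rw [nextIdx, this, Nat.sInf_empty]
  rw [e]
  refine ((hlt k).inter (MeasurableSet.biInter (Set.to_countable _) fun j _ => (hlt j).compl)).union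
    (MeasurableSet.inter (MeasurableSet.const _) (MeasurableSet.iInter fun j => (hlt j).compl))

theorem measurable_shiftClock : Measurable fun p : ℝ × (ℕ → ℝ) => shiftClock p.1 p.2 := by
  refine measurable_pi_iff.2 fun j => ?_
  have h : Measurable fun q : (ℝ × (ℕ → ℝ)) × ℕ =>
      if j = 0 then ring' q.1.2 q.2 - q.1.1 else q.1.2 (q.2 + j) := by
    refine measurable_from_prod_countable_left fun k => ?_
    split_ifs
    · exact ((measurable_ring' k).comp measurable_snd).sub measurable_fst
    · exact (measurable_pi_apply (k + j)).comp measurable_snd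
  exact h.comp (measurable_id.prodMk measurable_nextIdx)

@[fun_prop]
theorem measurable_consClock : Measurable fun p : ℝ × (ℕ → ℝ) => consClock p.1 p.2 := by
  refine measurable_pi_iff.2 fun j => ?_
  cases j with
  | zero => exact measurable_fst
  | succ j => exact (measurable_pi_apply j).comp measurable_snd

end Clock

/-! ### The law of a clock -/

section ClockLaw

instance : IsProbabilityMeasure (expMeasure 1) := isProbabilityMeasure_expMeasure one_pos

theorem lintegral_expMeasure {h : ℝ → ℝ≥0∞} (hh : Measurable h) :
    ∫⁻ s, h s ∂expMeasure 1 = ∫⁻ s in Set.Ioi 0, ENNReal.ofReal (Real.exp (-s)) * h s := by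
  have e : expMeasure 1 = volume.withDensity (exponentialPDF 1) := rfl
  have hm : Measurable (exponentialPDF 1) := (measurable_exponentialPDFReal 1).ennreal_ofReal
  rw [e, lintegral_withDensity_eq_lintegral_mul _ hm hh, setLIntegral_congr Ioi_ae_eq_Ici,
    ← lintegral_indicator measurableSet_Ici]
  refine lintegral_congr fun s => ?_
  by_cases hs : 0 ≤ s
  · rw [Set.indicator_of_mem (Set.mem_Ici.2 hs), Pi.mul_apply, exponentialPDF_of_nonneg hs]; simp
  · rw [Set.indicator_of_notMem (by simpa using hs), Pi.mul_apply,
      exponentialPDF_of_neg (not_le.1 hs), zero_mul]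

/-- The exponential distribution has no memory. -/
theorem lintegral_expMeasure_of_lt {h : ℝ → ℝ≥0∞} (hh : Measurable h) {s : ℝ} (hs : 0 ≤ s) :
    ∫⁻ r, (if s < r then h (r - s) else 0) ∂expMeasure 1 =
      ENNReal.ofReal (Real.exp (-s)) * ∫⁻ r, h r ∂expMeasure 1 := by
  have hm : Measurable fun r => if s < r then h (r - s) else 0 :=
    Measurable.ite measurableSet_Ioi (by fun_prop) measurable_const
  rw [lintegral_expMeasure hm, lintegral_expMeasure hh, ← lintegral_indicator measurableSet_Ioi,
    ← lintegral_indicator measurableSet_Ioi, ← lintegral_const_mul _ ((by fun_prop :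
      Measurable fun r => ENNReal.ofReal (Real.exp (-r)) * h r).indicator measurableSet_Ioi),
    ← lintegral_add_right_eq_self _ s]
  refine lintegral_congr fun r => ?_
  by_cases hr : 0 < r
  · rw [Set.indicator_of_mem (Set.mem_Ioi.2 (by linarith)), if_pos (by linarith),
      Set.indicator_of_mem (Set.mem_Ioi.2 hr), ← mul_assoc,
      ← ENNReal.ofReal_mul (Real.exp_pos _).le, ← Real.exp_add, add_sub_cancel_right]
    congr 3
    ring
  · rw [Set.indicator_of_notMem (s := Set.Ioi 0) (a := r) (by simpa using hr), mul_zero]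
    by_cases h0 : 0 < r + s
    · rw [Set.indicator_of_mem (Set.mem_Ioi.2 h0), if_neg (by linarith), mul_zero]
    · rw [Set.indicator_of_notMem (by simpa using h0)]

theorem expMeasure_Ioi {s : ℝ} (hs : 0 ≤ s) :
    expMeasure 1 (Set.Ioi s) = ENNReal.ofReal (Real.exp (-s)) := by
  have h := lintegral_expMeasure_of_lt (h := fun _ => 1) measurable_const hs
  simp only [lintegral_const, measure_univ, mul_one] at h
  rw [← h, ← lintegral_indicator_one measurableSet_Ioi]
  rfl

theorem expMeasure_Iic_lt_one (s : ℝ) : expMeasure 1 (Set.Iic s) < 1 := by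
  have h1 : expMeasure 1 (Set.Iic s) ≤ expMeasure 1 (Set.Iic (max s 0)) :=
    measure_mono (Set.Iic_subset_Iic.2 (le_max_left _ _))
  refine h1.trans_lt ?_
  have h2 := prob_compl_eq_one_sub (μ := expMeasure 1) (measurableSet_Ioi (a := max s 0))
  rw [Set.compl_Ioi, expMeasure_Ioi (le_max_right _ _)] at h2
  rw [h2]
  exact ENNReal.sub_lt_self ENNReal.one_ne_top one_ne_zero
    (ENNReal.ofReal_pos.2 (Real.exp_pos _)).ne'

theorem ae_expMeasure_pos : ∀ᵐ s ∂expMeasure 1, 0 < s := by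
  have h : expMeasure 1 (Set.Ioi 0) = 1 := by rw [expMeasure_Ioi le_rfl]; simp
  have h2 := (prob_compl_eq_zero_iff (μ := expMeasure 1) (measurableSet_Ioi (a := (0 : ℝ)))).2 h
  exact h2

instance : NullSingletonClass (expMeasure 1) := by
  have e : expMeasure 1 = volume.withDensity (exponentialPDF 1) := rfl
  rw [e]
  infer_instance

/-- The law of a unit Poisson clock. -/
noncomputable def clockLaw : Measure (ℕ → ℝ) := Measure.infinitePi fun _ => expMeasure 1

instance : IsProbabilityMeasure clockLaw := by unfold clockLaw; infer_instance

/-- Regeneration: a unit Poisson clock is an exponential time followed by an independent unit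
Poisson clock. The properties of `clockLaw` below come from conditioning on the first waiting time
in this way. -/
theorem map_consClock :
    ((expMeasure 1).prod clockLaw).map (fun p => consClock p.1 p.2) = clockLaw := by
  refine Measure.eq_infinitePi _ fun s t ht => ?_
  classical
  rw [Measure.map_apply measurable_consClock (.pi s.countable_toSet fun _ _ => ht _)]
  set T : Set ℝ := if 0 ∈ s then t 0 else Set.univ with hT
  set s' : Finset ℕ := s.preimage Nat.succ Nat.succ_injective.injOn with hs'
  have e : (fun p : ℝ × (ℕ → ℝ) => consClock p.1 p.2) ⁻¹' ((s : Set ℕ).pi t) =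
      T ×ˢ ((s' : Set ℕ).pi fun j => t (j + 1)) := by
    ext ⟨a, b⟩
    simp only [Set.mem_preimage, Set.mem_pi, Finset.mem_coe, Set.mem_prod, hs', Finset.mem_preimage]
    constructor
    · intro h
      refine ⟨?_, fun j hj => h (j + 1) hj⟩
      rw [hT]; split_ifs with h0
      · exact h 0 h0
      · trivial
    · rintro ⟨h0, h1⟩ j hj
      cases j with
      | zero => rw [hT, if_pos hj] at h0; exact h0
      | succ j => exact h1 j hj
  rw [e, Measure.prod_prod, clockLaw, Measure.infinitePi_pi _ fun i _ => ht _]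
  have e2 : ∏ j ∈ s', expMeasure 1 (t (j + 1)) =
      ∏ i ∈ s.erase 0, expMeasure 1 (t i) := by
    refine Finset.prod_bij (fun j _ => j + 1) (fun j hj => ?_) (fun a _ b _ h => by omega)
      (fun i hi => ?_) (fun _ _ => rfl)
    · rw [Finset.mem_erase]; exact ⟨by omega, by simpa [hs'] using hj⟩
    · rw [Finset.mem_erase] at hi
      obtain ⟨j, rfl⟩ := Nat.exists_eq_succ_of_ne_zero hi.1
      exact ⟨j, by simpa [hs'] using hi.2, rfl⟩
  rw [e2, hT]
  split_ifs with h0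
  · exact Finset.mul_prod_erase s (fun i => expMeasure 1 (t i)) h0
  · rw [measure_univ, one_mul, Finset.erase_eq_of_notMem h0]

theorem lintegral_clockLaw {Φ : (ℕ → ℝ) → ℝ≥0∞} (hΦ : Measurable Φ) :
    ∫⁻ g, Φ g ∂clockLaw = ∫⁻ s, ∫⁻ b, Φ (consClock s b) ∂clockLaw ∂expMeasure 1 := by
  rw [← map_consClock, lintegral_map hΦ measurable_consClock, map_consClock]
  exact lintegral_prod _ (hΦ.comp measurable_consClock).aemeasurable

theorem clockLaw_apply {S : Set (ℕ → ℝ)} (hS : MeasurableSet S) :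
    clockLaw S = ∫⁻ s, clockLaw {b | consClock s b ∈ S} ∂expMeasure 1 := by
  rw [← lintegral_indicator_one hS, lintegral_clockLaw (measurable_one.indicator hS)]
  refine lintegral_congr fun s => ?_
  exact lintegral_indicator_one (hS.preimage (by fun_prop : Measurable fun b => consClock s b))

theorem ae_goodClock : ∀ᵐ g ∂clockLaw, GoodClock g := by
  have h1 : ∀ᵐ g ∂clockLaw, ∀ i, 0 < g i := by
    rw [ae_all_iff]
    intro i
    have hm : clockLaw.map (fun g => g i) = expMeasure 1 := Measure.infinitePi_map_eval _ i
    have h := ae_expMeasure_pos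
    rw [← hm] at h
    exact ae_of_ae_map (measurable_pi_apply i).aemeasurable h
  have h2 : ∀ n : ℕ, ∀ᵐ g ∂clockLaw, ∃ k, (n : ℝ) < ring' g k := by
    intro n
    have hS : MeasurableSet {g | ∀ k, ring' g k ≤ n} := by
      simp only [Set.ofPred_forall]
      exact MeasurableSet.iInter fun k => measurableSet_le (measurable_ring' k) measurable_const
    -- If all rings occur by time `n`, then so does the first one, and removing it leaves a clock
    -- with the same property. The probability is thus at most itself times a number below 1, hence
    -- zero.
    have h0 : clockLaw {g | ∀ k, ring' g k ≤ n} ≤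
        expMeasure 1 (Set.Iic (n : ℝ)) * clockLaw {g | ∀ k, ring' g k ≤ n} := by
      nth_rewrite 1 [clockLaw_apply hS]
      rw [mul_comm, ← lintegral_indicator_const measurableSet_Iic]
      refine lintegral_mono_ae ?_
      filter_upwards [ae_expMeasure_pos] with s hs
      by_cases hsn : s ≤ n
      · rw [Set.indicator_of_mem (Set.mem_Iic.2 hsn)]
        refine measure_mono fun b hb k => ?_
        have := hb (k + 1)
        rw [ring'_consClock_succ] at this
        linarith
      · have e : {b | consClock s b ∈ {g | ∀ k, ring' g k ≤ n}} = ∅ := by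
          ext b
          simp only [Set.mem_ofPred_eq, Set.mem_empty_iff_false, iff_false, not_forall]
          exact ⟨0, by rwa [ring'_consClock_zero]⟩
        exact (measure_mono_null e.le measure_empty).le.trans zero_le
    have h3 : clockLaw {g | ∀ k, ring' g k ≤ n} = 0 := by
      have hq := expMeasure_Iic_lt_one (n : ℝ)
      have ha : clockLaw {g | ∀ k, ring' g k ≤ n} ≠ ∞ := measure_ne_top _ _
      lift clockLaw {g | ∀ k, ring' g k ≤ n} to NNReal using ha with a
      lift expMeasure 1 (Set.Iic (n : ℝ)) to NNReal using hq.ne_top with q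
      norm_cast at h0 hq ⊢
      by_contra hne
      have : q * a < 1 * a := mul_lt_mul_of_pos_right hq (pos_iff_ne_zero.2 hne)
      rw [one_mul] at this
      exact absurd h0 (not_le.2 this)
    filter_upwards [measure_eq_zero_iff_ae_notMem.1 h3] with g hg
    simpa using hg
  filter_upwards [h1, ae_all_iff.2 h2] with g hg1 hg2
  refine ⟨hg1, fun s => ?_⟩
  obtain ⟨n, hn⟩ := exists_nat_gt s
  obtain ⟨k, hk⟩ := hg2 n
  exact ⟨k, hn.trans hk⟩

/-- The clock seen from a later time is a unit Poisson clock, which is independent of the time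
until the first ring as long as this ring has not occurred. -/
theorem lintegral_shiftClock_of_lt {Φ : (ℕ → ℝ) → ℝ≥0∞} (hΦ : Measurable Φ) {s : ℝ} (hs : 0 ≤ s) :
    ∫⁻ g, (if s < g 0 then Φ (shiftClock s g) else 0) ∂clockLaw =
      ENNReal.ofReal (Real.exp (-s)) * ∫⁻ g, Φ g ∂clockLaw := by
  have hsh : Measurable (shiftClock s) := measurable_shiftClock.comp (measurable_const.prodMk measurable_id)
  have hmi : Measurable fun g : ℕ → ℝ => if s < g 0 then Φ (shiftClock s g) else 0 :=
    Measurable.ite (measurableSet_lt measurable_const (measurable_pi_apply 0)) (hΦ.comp hsh)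
      measurable_const
  rw [lintegral_clockLaw hmi, lintegral_clockLaw hΦ]
  have hm : Measurable fun r => ∫⁻ b, Φ (consClock r b) ∂clockLaw :=
    (hΦ.comp measurable_consClock).lintegral_prod_right'
  rw [← lintegral_expMeasure_of_lt hm hs]
  refine lintegral_congr fun r => ?_
  split_ifs with h
  · refine lintegral_congr fun b => ?_
    rw [if_pos (show s < consClock r b 0 from h), shiftClock_consClock_of_lt b h]
  · refine Eq.trans (lintegral_congr fun b => ?_) lintegral_zero
    exact if_neg h

/-- The clock seen from `s` is fresh and independent of the number of rings up to `s`. Without rings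
this is the lack of memory; otherwise, conditioning on the first ring reduces both `k` and the
remaining time. -/
theorem lintegral_shiftClock_of_nextIdx_eq {Φ : (ℕ → ℝ) → ℝ≥0∞} (hΦ : Measurable Φ)
    (hfin : ∫⁻ g, Φ g ∂clockLaw ≠ ∞) (k : ℕ) {s : ℝ} (hs : 0 ≤ s) :
    ∫⁻ g, (if nextIdx s g = k then Φ (shiftClock s g) else 0) ∂clockLaw =
      (∫⁻ g, (if nextIdx s g = k then 1 else 0) ∂clockLaw) * ∫⁻ g, Φ g ∂clockLaw := by
  induction k generalizing s with
  | zero =>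
    have h : ∀ Ψ : (ℕ → ℝ) → ℝ≥0∞, Measurable Ψ →
        ∫⁻ g, (if nextIdx s g = 0 then Ψ (shiftClock s g) else 0) ∂clockLaw =
          ENNReal.ofReal (Real.exp (-s)) * ∫⁻ g, Ψ g ∂clockLaw := by
      intro Ψ hΨ
      rw [← lintegral_shiftClock_of_lt hΨ hs]
      refine lintegral_congr_ae ?_
      filter_upwards [ae_goodClock] with g hg
      have : nextIdx s g = 0 ↔ s < g 0 := by
        rw [← ring'_zero g, hg.lt_ring'_iff, Nat.le_zero]
      simp only [this]
    rw [h Φ hΦ, h (fun _ => 1) measurable_const, lintegral_const, measure_univ, mul_one, mul_one]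
  | succ k ih =>
    have hms : ∀ s, Measurable (shiftClock s) := fun s =>
      measurable_shiftClock.comp (measurable_const.prodMk measurable_id)
    have hmi : ∀ s, Measurable (nextIdx s) := fun s =>
      measurable_nextIdx.comp (measurable_const.prodMk measurable_id)
    have h : ∀ Ψ : (ℕ → ℝ) → ℝ≥0∞, Measurable Ψ →
        ∫⁻ g, (if nextIdx s g = k + 1 then Ψ (shiftClock s g) else 0) ∂clockLaw =
          ∫⁻ r, (if r ≤ s then ∫⁻ b, (if nextIdx (s - r) b = k then Ψ (shiftClock (s - r) b) else 0)
            ∂clockLaw else 0) ∂expMeasure 1 := by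
      intro Ψ hΨ
      have hm : Measurable fun g => if nextIdx s g = k + 1 then Ψ (shiftClock s g) else 0 :=
        Measurable.ite (hmi s (measurableSet_singleton _)) (hΨ.comp (hms s)) measurable_const
      rw [lintegral_clockLaw hm]
      refine lintegral_congr_ae ?_
      filter_upwards [ae_expMeasure_pos] with r hr
      split_ifs with hrs
      · refine lintegral_congr_ae ?_
        filter_upwards [ae_goodClock] with b hb
        rw [(hb.shift_cons_of_le hr hrs).1, (hb.shift_cons_of_le hr hrs).2]
        simp only [Nat.add_right_cancel_iff]
      · refine Eq.trans (lintegral_congr fun b => if_neg ?_) lintegral_zero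
        rw [nextIdx_eq_zero_of_lt (show s < consClock r b 0 from not_le.1 hrs)]
        omega
    rw [h Φ hΦ, h (fun _ => 1) measurable_const, ← lintegral_mul_const' _ _ hfin]
    refine lintegral_congr fun r => ?_
    split_ifs with hrs
    · exact ih (sub_nonneg.2 hrs)
    · rw [zero_mul]

/-- The law of a unit Poisson clock is stationary. -/
theorem map_shiftClock {s : ℝ} (hs : 0 ≤ s) : clockLaw.map (shiftClock s) = clockLaw := by
  have hms : Measurable (shiftClock s) :=
    measurable_shiftClock.comp (measurable_const.prodMk measurable_id)
  have hmi : Measurable (nextIdx s) :=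
    measurable_nextIdx.comp (measurable_const.prodMk measurable_id)
  ext A hA
  have hΦ : Measurable (A.indicator (1 : (ℕ → ℝ) → ℝ≥0∞)) := measurable_one.indicator hA
  have hsplit : ∀ Ψ : (ℕ → ℝ) → ℝ≥0∞, Measurable Ψ → ∫⁻ g, Ψ (shiftClock s g) ∂clockLaw =
      ∑' k, ∫⁻ g, (if nextIdx s g = k then Ψ (shiftClock s g) else 0) ∂clockLaw := by
    intro Ψ hΨ
    have hm : ∀ k, Measurable fun g => if nextIdx s g = k then Ψ (shiftClock s g) else 0 :=
      fun k => Measurable.ite (hmi (measurableSet_singleton k)) (hΨ.comp hms) measurable_const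
    rw [← lintegral_tsum fun k => (hm k).aemeasurable]
    refine lintegral_congr fun g => ?_
    rw [tsum_eq_single (nextIdx s g) fun k hk => if_neg hk.symm, if_pos rfl]
  have hfin : ∫⁻ g, A.indicator (1 : (ℕ → ℝ) → ℝ≥0∞) g ∂clockLaw ≠ ∞ := by
    rw [lintegral_indicator_one hA]; exact measure_ne_top _ _
  have h1 := hsplit _ hΦ
  simp_rw [lintegral_shiftClock_of_nextIdx_eq hΦ hfin _ hs] at h1
  rw [ENNReal.tsum_mul_right, ← hsplit (fun _ => 1) measurable_const, lintegral_const, measure_univ,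
    mul_one, one_mul, lintegral_indicator_one hA] at h1
  rw [Measure.map_apply hms hA, ← h1, ← lintegral_indicator_one (hms hA)]
  rfl

end ClockLaw

/-! ### Independent clocks on the vertices -/

section Clocks

variable {V : Type*}

/-- The law of independent unit Poisson clocks on the vertices. -/
noncomputable def clocksLaw (V : Type*) : Measure (V → ℕ → ℝ) := Measure.infinitePi fun _ => clockLaw

instance : IsProbabilityMeasure (clocksLaw V) := by unfold clocksLaw; infer_instance

/-- All the clocks, seen from time `s`. -/
noncomputable def shiftClocks (s : ℝ) (g : V → ℕ → ℝ) (v : V) : ℕ → ℝ := shiftClock s (g v)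

theorem ae_goodClocks [Countable V] : ∀ᵐ g ∂clocksLaw V, ∀ v, GoodClock (g v) := by
  rw [ae_all_iff]
  intro v
  have hm : (clocksLaw V).map (fun g => g v) = clockLaw := Measure.infinitePi_map_eval _ v
  have h := ae_goodClock
  rw [← hm] at h
  exact ae_of_ae_map (measurable_pi_apply v).aemeasurable h

theorem measurable_shiftClocks :
    Measurable fun p : ℝ × (V → ℕ → ℝ) => shiftClocks p.1 p.2 := by
  refine measurable_pi_iff.2 fun v => ?_
  have h : Measurable fun p : ℝ × (V → ℕ → ℝ) => (p.1, p.2 v) :=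
    measurable_fst.prodMk ((measurable_pi_apply v).comp measurable_snd)
  have h2 : Measurable ((fun p : ℝ × (ℕ → ℝ) => shiftClock p.1 p.2) ∘
    fun p : ℝ × (V → ℕ → ℝ) => (p.1, p.2 v)) := Measurable.comp measurable_shiftClock h
  exact h2

theorem measurable_shiftClocks_right (s : ℝ) :
    Measurable (shiftClocks s : (V → ℕ → ℝ) → V → ℕ → ℝ) :=
  measurable_shiftClocks.comp (measurable_const.prodMk measurable_id)

theorem map_shiftClocks {s : ℝ} (hs : 0 ≤ s) : (clocksLaw V).map (shiftClocks s) = clocksLaw V := by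
  have h := Measure.infinitePi_map_pi (μ := fun _ : V => clockLaw) (f := fun _ => shiftClock s)
    fun _ => measurable_shiftClock.comp (measurable_const.prodMk measurable_id)
  rw [map_shiftClock hs] at h
  exact h

theorem lintegral_shiftClocks {s : ℝ} (hs : 0 ≤ s) {Φ : (V → ℕ → ℝ) → ℝ≥0∞} (hΦ : Measurable Φ) :
    ∫⁻ g, Φ (shiftClocks s g) ∂clocksLaw V = ∫⁻ g, Φ g ∂clocksLaw V := by
  conv_rhs => rw [← map_shiftClocks hs, lintegral_map hΦ (measurable_shiftClocks_right s)]

open Classical in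
theorem measurable_updateClock (x : V) :
    Measurable fun p : (ℕ → ℝ) × (V → ℕ → ℝ) => Function.update p.2 x p.1 := by
  refine measurable_pi_iff.2 fun v => ?_
  by_cases h : v = x
  · subst h; simpa using measurable_fst
  · simp only [Function.update_of_ne h]
    exact (measurable_pi_apply v).comp measurable_snd

open Classical in
-- Resampling the clock of one vertex. It isolates that clock as an independent factor without
-- splitting the product over `V`.
theorem map_updateClock (x : V) : (clockLaw.prod (clocksLaw V)).map
    (fun p => Function.update p.2 x p.1) = clocksLaw V := by
  refine Measure.eq_infinitePi _ fun s t ht => ?_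
  rw [Measure.map_apply (measurable_updateClock x) (.pi s.countable_toSet fun _ _ => ht _)]
  set T : Set (ℕ → ℝ) := if x ∈ s then t x else Set.univ with hT
  have e : (fun p : (ℕ → ℝ) × (V → ℕ → ℝ) => Function.update p.2 x p.1) ⁻¹' ((s : Set V).pi t) =
      T ×ˢ (((s.erase x : Finset V) : Set V).pi t) := by
    ext ⟨a, g⟩
    simp only [Set.mem_preimage, Set.mem_pi, Finset.mem_coe, Set.mem_prod, Finset.mem_erase]
    constructor
    · intro h
      refine ⟨?_, fun v hv => ?_⟩
      · rw [hT]; split_ifs with h0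
        · simpa using h x h0
        · trivial
      · have := h v hv.2
        rwa [Function.update_of_ne hv.1] at this
    · rintro ⟨h0, h1⟩ v hv
      by_cases hvx : v = x
      · subst hvx
        rw [hT, if_pos hv] at h0
        simpa using h0
      · rw [Function.update_of_ne hvx]; exact h1 v ⟨hvx, hv⟩
  rw [e, Measure.prod_prod, clocksLaw, Measure.infinitePi_pi _ fun i _ => ht _, hT]
  split_ifs with h0
  · exact Finset.mul_prod_erase s (fun i => clockLaw (t i)) h0
  · rw [measure_univ, one_mul, Finset.erase_eq_of_notMem h0]

open Classical in
theorem lintegral_updateClock (x : V) {Φ : (V → ℕ → ℝ) → ℝ≥0∞} (hΦ : Measurable Φ) :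
    ∫⁻ g, Φ g ∂clocksLaw V =
      ∫⁻ a, ∫⁻ g, Φ (Function.update g x a) ∂clocksLaw V ∂clockLaw := by
  rw [← map_updateClock x, lintegral_map hΦ (measurable_updateClock x), map_updateClock x]
  exact lintegral_prod _ (hΦ.comp (measurable_updateClock x)).aemeasurable

open Classical in
theorem shiftClocks_update (s : ℝ) (g : V → ℕ → ℝ) (x : V) (a : ℕ → ℝ) :
    shiftClocks s (Function.update g x a) =
      Function.update (shiftClocks s g) x (shiftClock s a) := by
  ext1 v
  by_cases h : v = x
  · subst h; simp [shiftClocks]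
  · simp [shiftClocks, Function.update_of_ne h]

theorem measurable_first (x : V) : Measurable fun g : V → ℕ → ℝ => g x 0 :=
  (measurable_pi_apply 0).comp (measurable_pi_apply x)

theorem lintegral_shiftClocks_of_lt (x : V) {s : ℝ} (hs : 0 ≤ s) {Φ : (V → ℕ → ℝ) → ℝ≥0∞}
    (hΦ : Measurable Φ) : ∫⁻ g, (if s < g x 0 then Φ (shiftClocks s g) else 0) ∂clocksLaw V =
      ENNReal.ofReal (Real.exp (-s)) * ∫⁻ g, Φ g ∂clocksLaw V := by
  classical
  have hm : Measurable fun g : V → ℕ → ℝ => if s < g x 0 then Φ (shiftClocks s g) else 0 :=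
    Measurable.ite (measurableSet_lt measurable_const (measurable_first x))
      (hΦ.comp (measurable_shiftClocks_right s)) measurable_const
  have hΨ : Measurable fun a => ∫⁻ g, Φ (Function.update g x a) ∂clocksLaw V :=
    (hΦ.comp (measurable_updateClock x)).lintegral_prod_right'
  rw [lintegral_updateClock x hm, lintegral_updateClock x hΦ, ← lintegral_shiftClock_of_lt hΨ hs]
  refine lintegral_congr fun a => ?_
  simp only [Function.update_self]
  split_ifs with h
  · simp_rw [shiftClocks_update]
    exact lintegral_shiftClocks hs (hΦ.comp ((measurable_updateClock x).comp
      (measurable_const.prodMk measurable_id)) : Measurable fun g =>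
        Φ (Function.update g x (shiftClock s a)))
  · exact lintegral_zero

open Classical in
/-- Decomposition at the first ring of the clock at `x`. -/
theorem lintegral_first_ring (x : V) {C : ℝ → (V → ℕ → ℝ) → Prop} {c : ℝ → ℝ≥0∞}
    (hC : MeasurableSet {p : ℝ × (V → ℕ → ℝ) | C p.1 p.2}) (hc : Measurable c)
    (hCx : ∀ s g a, C s (Function.update g x a) ↔ C s g)
    (hCc : ∀ s, 0 < s → ∀ Ψ : (V → ℕ → ℝ) → ℝ≥0∞, Measurable Ψ →
      ∫⁻ g, (if C s g then Ψ (shiftClocks s g) else 0) ∂clocksLaw V = c s * ∫⁻ g, Ψ g ∂clocksLaw V)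
    {Φ : ℝ → (V → ℕ → ℝ) → ℝ≥0∞} (hΦ : Measurable fun p : ℝ × (V → ℕ → ℝ) => Φ p.1 p.2) (t : ℝ) :
    ∫⁻ g, (if g x 0 ≤ t ∧ C (g x 0) g then Φ (g x 0) (shiftClocks (g x 0) g) else 0) ∂clocksLaw V =
      ∫⁻ s in Set.Ioc 0 t, ENNReal.ofReal (Real.exp (-s)) * (c s * ∫⁻ g, Φ s g ∂clocksLaw V) := by
  have hfx := measurable_first x
  have hm : Measurable fun g : V → ℕ → ℝ =>
      if g x 0 ≤ t ∧ C (g x 0) g then Φ (g x 0) (shiftClocks (g x 0) g) else 0 := by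
    refine Measurable.ite ((measurableSet_le hfx measurable_const).inter
      (hC.preimage (hfx.prodMk measurable_id))) ?_ measurable_const
    exact hΦ.comp (hfx.prodMk (measurable_shiftClocks.comp (hfx.prodMk measurable_id)))
  have hI : Measurable fun s => ∫⁻ g, Φ s g ∂clocksLaw V := hΦ.lintegral_prod_right'
  have hm2 : Measurable fun a : ℕ → ℝ => ∫⁻ g, (fun g : V → ℕ → ℝ =>
      if g x 0 ≤ t ∧ C (g x 0) g then Φ (g x 0) (shiftClocks (g x 0) g) else 0)
        (Function.update g x a) ∂clocksLaw V :=
    (hm.comp (measurable_updateClock x)).lintegral_prod_right'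
  have hm3 : Measurable fun s => if s ≤ t then c s * ∫⁻ g, Φ s g ∂clocksLaw V else 0 :=
    Measurable.ite measurableSet_Iic (hc.mul hI) measurable_const
  rw [lintegral_updateClock x hm, lintegral_clockLaw hm2]
  have h1 : ∀ᵐ s ∂expMeasure 1, ∫⁻ b, ∫⁻ g, (fun g : V → ℕ → ℝ =>
      if g x 0 ≤ t ∧ C (g x 0) g then Φ (g x 0) (shiftClocks (g x 0) g) else 0)
        (Function.update g x (consClock s b)) ∂clocksLaw V ∂clockLaw =
      if s ≤ t then c s * ∫⁻ g, Φ s g ∂clocksLaw V else 0 := by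
    filter_upwards [ae_expMeasure_pos] with s hs
    have e0 : ∀ b, consClock s b 0 = s := fun b => rfl
    simp only [Function.update_self, e0, hCx]
    by_cases hst : s ≤ t
    · simp only [hst, true_and, if_true]
      have hΦs : Measurable (Φ s) := hΦ.comp (measurable_const.prodMk measurable_id)
      -- If the clock at `x` first rings at `s`, it continues as `b`. The other clocks are only
      -- shifted by `s`, and `hCc` says that they are fresh given `C s`, an event of probability `c
      -- s`.
      have h2 : ∀ᵐ b ∂clockLaw, ∫⁻ g, (if C s g then
          Φ s (shiftClocks s (Function.update g x (consClock s b))) else 0) ∂clocksLaw V =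
          c s * ∫⁻ g, Φ s (Function.update g x b) ∂clocksLaw V := by
        filter_upwards [ae_goodClock] with b hb
        simp_rw [shiftClocks_update, (hb.shift_cons_self s).2]
        exact hCc s hs (fun g => Φ s (Function.update g x b)) (hΦs.comp
          ((measurable_updateClock x).comp (measurable_const.prodMk measurable_id)))
      have hm4 : Measurable fun a => ∫⁻ g, Φ s (Function.update g x a) ∂clocksLaw V :=
        (hΦs.comp (measurable_updateClock x)).lintegral_prod_right'
      rw [lintegral_congr_ae h2, lintegral_const_mul _ hm4, ← lintegral_updateClock x hΦs]
    · simp [hst]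
  rw [lintegral_congr_ae h1, lintegral_expMeasure hm3, ← lintegral_indicator measurableSet_Ioi,
    ← lintegral_indicator measurableSet_Ioc]
  refine lintegral_congr fun s => ?_
  by_cases h0 : 0 < s <;> by_cases hst : s ≤ t <;> simp [Set.indicator, h0, hst]

theorem lintegral_first_ring_self (x : V)
    {Φ : ℝ → (V → ℕ → ℝ) → ℝ≥0∞} (hΦ : Measurable fun p : ℝ × (V → ℕ → ℝ) => Φ p.1 p.2) (t : ℝ) :
    ∫⁻ g, (if g x 0 ≤ t then Φ (g x 0) (shiftClocks (g x 0) g) else 0) ∂clocksLaw V =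
      ∫⁻ s in Set.Ioc 0 t, ENNReal.ofReal (Real.exp (-s)) * ∫⁻ g, Φ s g ∂clocksLaw V := by
  have h := lintegral_first_ring x (C := fun _ _ => True) (c := fun _ => 1) (by simp)
    measurable_const (by simp) (fun s hs Ψ hΨ => by simpa using lintegral_shiftClocks hs.le hΨ) hΦ t
  simpa using h

/-- The rate 2 combines the density `exp (-s)` of the first ring at `x` with the probability `exp
(-s)` that `y` has not rung by then. -/
theorem lintegral_first_ring_of_lt {x y : V} (hxy : x ≠ y)
    {Φ : ℝ → (V → ℕ → ℝ) → ℝ≥0∞} (hΦ : Measurable fun p : ℝ × (V → ℕ → ℝ) => Φ p.1 p.2) (t : ℝ) :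
    ∫⁻ g, (if g x 0 ≤ t ∧ g x 0 < g y 0 then Φ (g x 0) (shiftClocks (g x 0) g) else 0)
      ∂clocksLaw V =
      ∫⁻ s in Set.Ioc 0 t, ENNReal.ofReal (Real.exp (-(2 * s))) * ∫⁻ g, Φ s g ∂clocksLaw V := by
  classical
  have h := lintegral_first_ring x (C := fun s g => s < g y 0)
    (c := fun s => ENNReal.ofReal (Real.exp (-s)))
    (measurableSet_lt measurable_fst ((measurable_first y).comp measurable_snd)) (by fun_prop)
    (fun s g a => by rw [Function.update_of_ne hxy.symm])
    (fun s hs Ψ hΨ => by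
      convert! lintegral_shiftClocks_of_lt y hs.le hΨ) hΦ t
  have e : ∀ s : ℝ, Real.exp (-(2 * s)) = Real.exp (-s) * Real.exp (-s) := fun s => by
    rw [← Real.exp_add]; ring_nf
  simp_rw [e, ENNReal.ofReal_mul (Real.exp_pos _).le, mul_assoc]
  convert! h

theorem ae_first_ne {x y : V} (hxy : x ≠ y) : ∀ᵐ g ∂clocksLaw V, g x 0 ≠ g y 0 := by
  classical
  have hS : MeasurableSet {g : V → ℕ → ℝ | g x 0 = g y 0} :=
    measurableSet_eq_fun (measurable_first x) (measurable_first y)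
  rw [ae_iff]
  simp only [ne_eq, not_not]
  have hm : Measurable (Function.uncurry fun (a : ℕ → ℝ) (g : V → ℕ → ℝ) =>
      ({g | g x 0 = g y 0}.indicator 1 (Function.update g x a) : ℝ≥0∞)) :=
    (measurable_one.indicator hS).comp (measurable_updateClock x)
  rw [← lintegral_indicator_one hS, lintegral_updateClock x (measurable_one.indicator hS),
    lintegral_lintegral_swap hm.aemeasurable]
  refine Eq.trans (lintegral_congr fun g => ?_) lintegral_zero
  have e : (fun a => ({g : V → ℕ → ℝ | g x 0 = g y 0}.indicator 1 (Function.update g x a) : ℝ≥0∞)) =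
      {a : ℕ → ℝ | a 0 = g y 0}.indicator 1 := by
    ext a
    simp [Set.indicator, Function.update_of_ne hxy.symm]
  have hm : clockLaw.map (fun g => g 0) = expMeasure 1 := Measure.infinitePi_map_eval _ 0
  have h0 : clockLaw {a : ℕ → ℝ | a 0 = g y 0} = expMeasure 1 {g y 0} := by
    rw [← hm, Measure.map_apply (measurable_pi_apply 0) (measurableSet_singleton _)]
    rfl
  rw [e, lintegral_indicator_one (measurableSet_eq_fun (measurable_pi_apply 0) measurable_const), h0,
    measure_singleton]

end Clocks

/-! ### The walk with given clocks -/

section Moves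

variable {V : Type*}

open Classical in
/-- Given the clocks `g`, the probability that the walk started at `x` makes exactly `n` moves up to
time `t` and ends at `v`. -/
noncomputable def exactMoves (P : V → V → ℝ) : ℕ → ℝ → V → V → (V → ℕ → ℝ) → ℝ≥0∞
  | 0, t, x, v, g => if x = v ∧ 0 ≤ t ∧ t < g x 0 then 1 else 0
  | n + 1, t, x, v, g =>
    ∑' z, ENNReal.ofReal (P x z) * exactMoves P n (t - g x 0) z v (shiftClocks (g x 0) g)

/-- Given the clocks `g`, the probability that the walk started at `x` makes fewer than `n` moves
up to time `t` and ends at `v`. -/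
noncomputable def fewMoves (P : V → V → ℝ) (n : ℕ) (t : ℝ) (x v : V) (g : V → ℕ → ℝ) : ℝ≥0∞ :=
  ∑ i ∈ Finset.range n, exactMoves P i t x v g

variable {P : V → V → ℝ}

theorem measurable_shiftClocks_first (x : V) :
    Measurable fun g : V → ℕ → ℝ => (g x 0, shiftClocks (g x 0) g) := by
  have hfx := measurable_first x
  have h : Measurable ((fun p : ℝ × (V → ℕ → ℝ) => shiftClocks p.1 p.2) ∘
      fun g : V → ℕ → ℝ => (g x 0, g)) := measurable_shiftClocks.comp (hfx.prodMk measurable_id)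
  exact hfx.prodMk h

theorem measurable_exactMoves [Countable V] (n : ℕ) (x v : V) :
    Measurable fun p : ℝ × (V → ℕ → ℝ) => exactMoves P n p.1 x v p.2 := by
  have hfx : ∀ x : V, Measurable fun p : ℝ × (V → ℕ → ℝ) => p.2 x 0 := fun x =>
    (measurable_first x).comp measurable_snd
  induction n generalizing x with
  | zero =>
    refine Measurable.ite ?_ measurable_const measurable_const
    exact (MeasurableSet.const _).inter ((measurableSet_le measurable_const measurable_fst).inter
      (measurableSet_lt measurable_fst (hfx x)))
  | succ n ih =>
    refine Measurable.tsum fun z => measurable_const.mul ?_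
    have h1 : Measurable fun p : ℝ × (V → ℕ → ℝ) => shiftClocks (p.2 x 0) p.2 := by
      have h3 : Measurable fun p : ℝ × (V → ℕ → ℝ) => (p.2 x 0, p.2) :=
        (hfx x).prodMk measurable_snd
      exact Measurable.comp measurable_shiftClocks h3
    have h2 : Measurable fun p : ℝ × (V → ℕ → ℝ) =>
        (p.1 - p.2 x 0, shiftClocks (p.2 x 0) p.2) :=
      (measurable_fst.sub (hfx x)).prodMk h1
    exact Measurable.comp (ih z) h2

theorem measurable_exactMoves_right [Countable V] (n : ℕ) (t : ℝ) (x v : V) :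
    Measurable (exactMoves P n t x v) :=
  (measurable_exactMoves n x v).comp (measurable_const.prodMk measurable_id)

theorem measurable_fewMoves [Countable V] (n : ℕ) (x v : V) :
    Measurable fun p : ℝ × (V → ℕ → ℝ) => fewMoves P n p.1 x v p.2 :=
  Finset.measurable_fun_sum _ fun i _ => measurable_exactMoves i x v

theorem goodClocks_shift {g : V → ℕ → ℝ} (hg : ∀ v, GoodClock (g v)) (s : ℝ) (v : V) :
    GoodClock (shiftClocks s g v) :=
  (hg v).shift s

/-- The recursion for `exactMoves` does not ask whether the next ring comes before `t`. A late ring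
makes the remaining time negative, and the test in the base case rejects it. -/
theorem exactMoves_of_neg {g : V → ℕ → ℝ} (hg : ∀ v, GoodClock (g v)) (n : ℕ) {t : ℝ} (ht : t < 0)
    (x v : V) : exactMoves P n t x v g = 0 := by
  induction n generalizing t x g with
  | zero => rw [exactMoves, if_neg]; rintro ⟨_, h, _⟩; linarith
  | succ n ih =>
    rw [exactMoves, ENNReal.tsum_eq_zero]
    intro z
    rw [ih (goodClocks_shift hg _) (by linarith [(hg x).pos 0]), mul_zero]

/-- As long as the walk waits at `x`, only the future of the clocks matters. This restarts one walk
of a pair at the moment when the other one moves. -/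
theorem exactMoves_shift {g : V → ℕ → ℝ} (hg : ∀ v, GoodClock (g v)) (n : ℕ) {s t : ℝ} {x : V}
    (hs : 0 ≤ s) (hsx : s < g x 0) (hst : s ≤ t) (v : V) :
    exactMoves P n t x v g = exactMoves P n (t - s) x v (shiftClocks s g) := by
  have h0 : shiftClocks s g x 0 = g x 0 - s := shiftClock_zero_of_lt hsx
  cases n with
  | zero =>
    rw [exactMoves, exactMoves, h0]
    congr 1
    rw [eq_iff_iff]
    constructor
    · rintro ⟨h1, h2, h3⟩; exact ⟨h1, by linarith, by linarith⟩
    · rintro ⟨h1, h2, h3⟩; exact ⟨h1, by linarith, by linarith⟩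
  | succ n =>
    rw [exactMoves, exactMoves, h0]
    have e : shiftClocks (g x 0 - s) (shiftClocks s g) = shiftClocks (g x 0) g := by
      ext1 v
      have := (hg v).shift_shift (sub_nonneg.2 hsx.le) s
      rwa [sub_add_cancel] at this
    rw [e, sub_sub_sub_cancel_right]

theorem fewMoves_zero (t : ℝ) (x v : V) (g : V → ℕ → ℝ) : fewMoves P 0 t x v g = 0 := by
  simp [fewMoves]

theorem fewMoves_shift {g : V → ℕ → ℝ} (hg : ∀ v, GoodClock (g v)) (n : ℕ) {s t : ℝ} {x : V}
    (hs : 0 ≤ s) (hsx : s < g x 0) (hst : s ≤ t) (v : V) :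
    fewMoves P n t x v g = fewMoves P n (t - s) x v (shiftClocks s g) :=
  Finset.sum_congr rfl fun i _ => exactMoves_shift hg i hs hsx hst v

open Classical in
theorem fewMoves_succ_of_lt {g : V → ℕ → ℝ} (hg : ∀ v, GoodClock (g v)) (n : ℕ) {t : ℝ} {x : V}
    (ht : 0 ≤ t) (hx : t < g x 0) (v : V) :
    fewMoves P (n + 1) t x v g = if x = v then 1 else 0 := by
  rw [fewMoves, Finset.sum_range_succ', Finset.sum_eq_zero, zero_add]
  · simp only [exactMoves, ht, hx, and_true]
  · intro i _
    rw [exactMoves, ENNReal.tsum_eq_zero]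
    intro z
    rw [exactMoves_of_neg (goodClocks_shift hg _) i (by linarith), mul_zero]

theorem fewMoves_succ_of_le {g : V → ℕ → ℝ} (n : ℕ) {t : ℝ} {x : V}
    (hx : g x 0 ≤ t) (v : V) : fewMoves P (n + 1) t x v g =
      ∑' z, ENNReal.ofReal (P x z) * fewMoves P n (t - g x 0) z v (shiftClocks (g x 0) g) := by
  rw [fewMoves, Finset.sum_range_succ']
  have h0 : exactMoves P 0 t x v g = 0 := by
    rw [exactMoves, if_neg]; rintro ⟨_, _, h⟩; linarith
  rw [h0, add_zero]
  simp only [exactMoves, fewMoves, Finset.mul_sum]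
  rw [Summable.tsum_finsetSum fun _ _ => ENNReal.summable]

theorem integral_exp_mul_pow (n : ℕ) (t : ℝ) :
    ∫ s in (0 : ℝ)..t, Real.exp (-s) * (Real.exp (-(t - s)) * ((t - s) ^ n / n.factorial)) =
      Real.exp (-t) * (t ^ (n + 1) / (n + 1).factorial) := by
  have e : ∀ s, Real.exp (-s) * (Real.exp (-(t - s)) * ((t - s) ^ n / n.factorial)) =
      Real.exp (-t) / n.factorial * (t - s) ^ n := fun s => by
    rw [← mul_assoc, ← Real.exp_add]; ring_nf
  simp_rw [e]
  rw [intervalIntegral.integral_const_mul, intervalIntegral.integral_comp_sub_left (fun s => s ^ n),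
    integral_pow, Nat.factorial_succ]
  push_cast
  have : (n.factorial : ℝ) ≠ 0 := by positivity
  field_simp
  simp

theorem lintegral_exp_mul_pow (n : ℕ) {t : ℝ} (ht : 0 ≤ t) :
    ∫⁻ s in Set.Ioc 0 t, ENNReal.ofReal (Real.exp (-s)) *
      ENNReal.ofReal (Real.exp (-(t - s)) * ((t - s) ^ n / n.factorial)) =
      ENNReal.ofReal (Real.exp (-t) * (t ^ (n + 1) / (n + 1).factorial)) := by
  have hc : Continuous fun s : ℝ =>
    Real.exp (-s) * (Real.exp (-(t - s)) * ((t - s) ^ n / n.factorial)) := by fun_prop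
  rw [← integral_exp_mul_pow, intervalIntegral.integral_of_le ht,
    ofReal_integral_eq_lintegral_ofReal (hc.intervalIntegrable 0 t).1]
  · exact lintegral_congr fun s => (ENNReal.ofReal_mul (Real.exp_pos _).le).symm
  · refine (ae_restrict_iff' measurableSet_Ioc).2 (ae_of_all _ fun s hs => ?_)
    have : 0 ≤ t - s := by linarith [hs.2]
    change 0 ≤ _
    positivity

/-- The law of the position of a single walk. -/
theorem lintegral_exactMoves [Countable V] (hP : IsStochasticMatrix P) (n : ℕ) {t : ℝ} (ht : 0 ≤ t)
    (x v : V) : ∫⁻ g, exactMoves P n t x v g ∂clocksLaw V =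
      ENNReal.ofReal (Real.exp (-t) * (t ^ n / n.factorial)) * eStepProb P n x v := by
  classical
  induction n generalizing x t with
  | zero =>
    have h := lintegral_shiftClocks_of_lt x ht (Φ := fun _ => if x = v then 1 else 0)
      measurable_const
    rw [lintegral_const, measure_univ, mul_one] at h
    simp only [pow_zero, Nat.factorial_zero, Nat.cast_one, div_one, mul_one]
    rw [eStepProb_zero, ← h]
    refine lintegral_congr fun g => ?_
    rw [exactMoves]
    by_cases h1 : x = v <;> by_cases h2 : t < g x 0 <;> simp [h1, h2, ht]
  | succ n ih =>
    set Φ : ℝ → (V → ℕ → ℝ) → ℝ≥0∞ := fun s g =>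
      ∑' z, ENNReal.ofReal (P x z) * exactMoves P n (t - s) z v g with hΦ
    have hmE : ∀ z, Measurable fun p : ℝ × (V → ℕ → ℝ) => exactMoves P n (t - p.1) z v p.2 := by
      intro z
      have h2 : Measurable fun p : ℝ × (V → ℕ → ℝ) => (t - p.1, p.2) :=
        (measurable_const.sub measurable_fst).prodMk measurable_snd
      exact Measurable.comp (measurable_exactMoves n z v) h2
    have hm : Measurable fun p : ℝ × (V → ℕ → ℝ) => Φ p.1 p.2 :=
      Measurable.tsum fun z => measurable_const.mul (hmE z)
    have h1 : ∀ᵐ g ∂clocksLaw V, exactMoves P (n + 1) t x v g =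
        if g x 0 ≤ t then Φ (g x 0) (shiftClocks (g x 0) g) else 0 := by
      filter_upwards [ae_goodClocks] with g hg
      split_ifs with h
      · rfl
      · rw [exactMoves, ENNReal.tsum_eq_zero]
        intro z
        rw [exactMoves_of_neg (goodClocks_shift hg _) n (by linarith), mul_zero]
    have h2 : ∀ s ∈ Set.Ioc 0 t, ∫⁻ g, Φ s g ∂clocksLaw V =
        ENNReal.ofReal (Real.exp (-(t - s)) * ((t - s) ^ n / n.factorial)) *
          eStepProb P (n + 1) x v := by
      intro s hs
      have hmz : ∀ z, Measurable (exactMoves P n (t - s) z v) := fun z =>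
        measurable_exactMoves_right n (t - s) z v
      have hmz2 : ∀ z, AEMeasurable (fun g => ENNReal.ofReal (P x z) *
          exactMoves P n (t - s) z v g) (clocksLaw V) := fun z => ((hmz z).const_mul _).aemeasurable
      rw [hΦ]
      simp only
      rw [lintegral_tsum hmz2, eStepProb_succ hP, ← ENNReal.tsum_mul_left]
      refine tsum_congr fun z => ?_
      rw [lintegral_const_mul _ (hmz z), ih (by linarith [hs.2]), mul_left_comm]
    rw [lintegral_congr_ae h1, lintegral_first_ring_self x hm t, ← lintegral_exp_mul_pow n ht,
      ← lintegral_mul_const _ (by fun_prop)]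
    refine setLIntegral_congr_fun measurableSet_Ioc fun s hs => ?_
    simp only [h2 s hs, mul_assoc]

end Moves

/-! ### Two walks with the same clocks -/

section TwoWalks

variable {V : Type*} {P : V → V → ℝ}

theorem tsum_mul_tsum_mul_tsum {ι : Type*} (w : ι → ℝ≥0∞) {α β : Type*} (a : α → ℝ≥0∞)
    (b : β → ℝ≥0∞) (F : α → ι → ℝ≥0∞) (G : β → ι → ℝ≥0∞) :
    ∑' v, w v * ((∑' z, a z * F z v) * ∑' y, b y * G y v) =
      ∑' z, ∑' y, a z * b y * ∑' v, w v * (F z v * G y v) := by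
  have e : ∀ v, w v * ((∑' z, a z * F z v) * ∑' y, b y * G y v) =
      ∑' z, ∑' y, a z * b y * (w v * (F z v * G y v)) := by
    intro v
    rw [← ENNReal.tsum_mul_right, ← ENNReal.tsum_mul_left]
    refine tsum_congr fun z => ?_
    rw [← ENNReal.tsum_mul_left, ← ENNReal.tsum_mul_left]
    exact tsum_congr fun y => by ring
  simp_rw [e]
  rw [ENNReal.tsum_comm]
  refine tsum_congr fun z => ?_
  rw [ENNReal.tsum_comm]
  exact tsum_congr fun y => ENNReal.tsum_mul_left

theorem tsum_mul_tsum_mul {ι : Type*} (w : ι → ℝ≥0∞) {α : Type*} (a : α → ℝ≥0∞)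
    (F : α → ι → ℝ≥0∞) (G : ι → ℝ≥0∞) :
    ∑' v, w v * ((∑' z, a z * F z v) * G v) = ∑' z, a z * ∑' v, w v * (F z v * G v) := by
  have h := tsum_mul_tsum_mul_tsum w a (fun _ : Unit => 1) F (fun _ => G)
  simpa using h

/-- The weighted collision probability of two walks with the same clocks and with bounded numbers of
moves. -/
noncomputable def collision (P : V → V → ℝ) (w : V → ℝ≥0∞) (i j : ℕ) (t : ℝ) (x y : V) : ℝ≥0∞ :=
  ∫⁻ g, ∑' v, w v * (fewMoves P i t x v g * fewMoves P j t y v g) ∂clocksLaw V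

theorem measurable_collision_integrand [Countable V] (w : V → ℝ≥0∞) (i j : ℕ) (t : ℝ) (x y : V) :
    Measurable fun p : ℝ × (V → ℕ → ℝ) =>
      ∑' v, w v * (fewMoves P i (t - p.1) x v p.2 * fewMoves P j (t - p.1) y v p.2) := by
  have h2 : Measurable fun p : ℝ × (V → ℕ → ℝ) => (t - p.1, p.2) :=
    (measurable_const.sub measurable_fst).prodMk measurable_snd
  have h3 : ∀ n x v, Measurable fun p : ℝ × (V → ℕ → ℝ) => fewMoves P n (t - p.1) x v p.2 :=
    fun n x v => by
      have h4 := measurable_fewMoves (P := P) n x v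
      have h5 : Measurable ((fun p : ℝ × (V → ℕ → ℝ) => fewMoves P n p.1 x v p.2) ∘
        fun p : ℝ × (V → ℕ → ℝ) => (t - p.1, p.2)) := Measurable.comp h4 h2
      exact h5
  exact Measurable.tsum fun v => measurable_const.mul ((h3 i x v).mul (h3 j y v))

theorem measurable_collision_integrand_right [Countable V] (w : V → ℝ≥0∞) (i j : ℕ) (t : ℝ)
    (x y : V) : Measurable fun g : V → ℕ → ℝ =>
      ∑' v, w v * (fewMoves P i t x v g * fewMoves P j t y v g) := by
  have h := (measurable_collision_integrand (P := P) w i j t x y).comp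
    (measurable_const (a := (0 : ℝ)).prodMk measurable_id)
  simpa [Function.comp_def] using h

theorem collision_comm (w : V → ℝ≥0∞) (i j : ℕ) (t : ℝ) (x y : V) :
    collision P w i j t x y = collision P w j i t y x :=
  lintegral_congr fun _ => tsum_congr fun _ => by rw [mul_comm (fewMoves _ _ _ _ _ _)]

theorem lintegral_tsum_mul_collision [Countable V] (w a : V → ℝ≥0∞) (i j : ℕ) (t : ℝ) (y : V) :
    ∫⁻ g, ∑' z, a z * ∑' v, w v * (fewMoves P i t z v g * fewMoves P j t y v g) ∂clocksLaw V =
      ∑' z, a z * collision P w i j t z y := by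
  have hms := fun z => measurable_collision_integrand_right (P := P) w i j t z y
  have hma : ∀ z, AEMeasurable (fun g => a z *
      ∑' v, w v * (fewMoves P i t z v g * fewMoves P j t y v g)) (clocksLaw V) := fun z =>
    ((hms z).const_mul _).aemeasurable
  rw [lintegral_tsum hma]
  exact tsum_congr fun z => lintegral_const_mul _ (hms z)

theorem lintegral_tsum_tsum_mul_collision [Countable V] (w : V → ℝ≥0∞) (a : V → V → ℝ≥0∞) (i j : ℕ)
    (t : ℝ) : ∫⁻ g, ∑' z, ∑' y, a z y * ∑' v, w v * (fewMoves P i t z v g * fewMoves P j t y v g)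
      ∂clocksLaw V = ∑' z, ∑' y, a z y * collision P w i j t z y := by
  have hms := fun z y => measurable_collision_integrand_right (P := P) w i j t z y
  have hma : ∀ z y, Measurable (fun g => a z y *
      ∑' v, w v * (fewMoves P i t z v g * fewMoves P j t y v g)) := fun z y => (hms z y).const_mul _
  have hmb : ∀ z, AEMeasurable (fun g => ∑' y, a z y *
      ∑' v, w v * (fewMoves P i t z v g * fewMoves P j t y v g)) (clocksLaw V) := fun z =>
    (Measurable.tsum (hma z)).aemeasurable
  rw [lintegral_tsum hmb]
  refine tsum_congr fun z => ?_
  rw [lintegral_tsum fun y => (hma z y).aemeasurable]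
  exact tsum_congr fun y => lintegral_const_mul _ (hms z y)

/-- Walks at a common vertex wait for the same ring, at rate 1, and then choose their targets
independently, so both move budgets drop. -/
theorem collision_succ_self_le [Countable V] (w : V → ℝ≥0∞) (i j : ℕ) {t : ℝ} (ht : 0 ≤ t) (x : V) :
    collision P w (i + 1) (j + 1) t x x ≤ ENNReal.ofReal (Real.exp (-t)) * w x +
      ∫⁻ s in Set.Ioc 0 t, ENNReal.ofReal (Real.exp (-s)) * ∑' z, ∑' y,
        ENNReal.ofReal (P x z) * ENNReal.ofReal (P x y) * collision P w i j (t - s) z y := by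
  classical
  set Φ : ℝ → (V → ℕ → ℝ) → ℝ≥0∞ := fun s g =>
    ∑' z, ∑' y, ENNReal.ofReal (P x z) * ENNReal.ofReal (P x y) *
      ∑' v, w v * (fewMoves P i (t - s) z v g * fewMoves P j (t - s) y v g) with hΦ
  have hmc := fun z y => measurable_collision_integrand (P := P) w i j t z y
  have hm : Measurable fun p : ℝ × (V → ℕ → ℝ) => Φ p.1 p.2 :=
    Measurable.tsum fun z => Measurable.tsum fun y =>
      measurable_const.mul (hmc z y)
  have h1 : ∀ᵐ g ∂clocksLaw V,
      ∑' v, w v * (fewMoves P (i + 1) t x v g * fewMoves P (j + 1) t x v g) ≤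
        (if t < g x 0 then w x else 0) +
          if g x 0 ≤ t then Φ (g x 0) (shiftClocks (g x 0) g) else 0 := by
    filter_upwards [ae_goodClocks] with g hg
    by_cases h : t < g x 0
    · simp only [fewMoves_succ_of_lt hg _ ht h, h, if_true, not_le.2 h, if_false, add_zero]
      rw [tsum_eq_single x fun v hv => by simp [hv.symm]]
      simp
    · simp only [fewMoves_succ_of_le _ (not_lt.1 h), h, if_false, not_lt.1 h, if_true, zero_add]
      exact (tsum_mul_tsum_mul_tsum w _ _ _ _).le
  have h2 : ∫⁻ g, (if t < g x 0 then w x else 0) ∂clocksLaw V =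
      ENNReal.ofReal (Real.exp (-t)) * w x := by
    have := lintegral_shiftClocks_of_lt x ht (Φ := fun _ => w x) measurable_const
    simpa using this
  have hmi : Measurable fun g : V → ℕ → ℝ => if t < g x 0 then w x else 0 :=
    Measurable.ite (measurableSet_lt measurable_const (measurable_first x)) measurable_const
      measurable_const
  refine (lintegral_mono_ae h1).trans (le_of_eq ?_)
  rw [lintegral_add_left hmi, h2, lintegral_first_ring_self x hm t]
  congr 1
  refine lintegral_congr fun s => ?_
  congr 1
  exact lintegral_tsum_tsum_mul_collision w _ i j (t - s)

/-- The earlier of two distinct clocks decides which walk moves; the other walk keeps its budget and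
is merely shifted in time. If neither clock rings by `t`, the walks stay apart and do not collide.
-/
theorem collision_succ_le_of_ne [Countable V] (w : V → ℝ≥0∞) (i j : ℕ) {t : ℝ} (ht : 0 ≤ t) {x y : V}
    (hxy : x ≠ y) : collision P w (i + 1) (j + 1) t x y ≤
      ∫⁻ s in Set.Ioc 0 t, ENNReal.ofReal (Real.exp (-(2 * s))) *
        (∑' z, ENNReal.ofReal (P x z) * collision P w i (j + 1) (t - s) z y +
          ∑' z, ENNReal.ofReal (P y z) * collision P w (i + 1) j (t - s) x z) := by
  classical
  set Φ : ℝ → (V → ℕ → ℝ) → ℝ≥0∞ := fun s g => ∑' z, ENNReal.ofReal (P x z) *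
    ∑' v, w v * (fewMoves P i (t - s) z v g * fewMoves P (j + 1) (t - s) y v g) with hΦ
  set Ψ : ℝ → (V → ℕ → ℝ) → ℝ≥0∞ := fun s g => ∑' z, ENNReal.ofReal (P y z) *
    ∑' v, w v * (fewMoves P j (t - s) z v g * fewMoves P (i + 1) (t - s) x v g) with hΨ
  have hmc := fun i j z y => measurable_collision_integrand (P := P) w i j t z y
  have hmΦ : Measurable fun p : ℝ × (V → ℕ → ℝ) => Φ p.1 p.2 :=
    Measurable.tsum fun z => measurable_const.mul (hmc i (j + 1) z y)
  have hmΨ : Measurable fun p : ℝ × (V → ℕ → ℝ) => Ψ p.1 p.2 :=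
    Measurable.tsum fun z => measurable_const.mul (hmc j (i + 1) z x)
  have h1 : ∀ᵐ g ∂clocksLaw V,
      ∑' v, w v * (fewMoves P (i + 1) t x v g * fewMoves P (j + 1) t y v g) ≤
        (if g x 0 ≤ t ∧ g x 0 < g y 0 then Φ (g x 0) (shiftClocks (g x 0) g) else 0) +
          if g y 0 ≤ t ∧ g y 0 < g x 0 then Ψ (g y 0) (shiftClocks (g y 0) g) else 0 := by
    filter_upwards [ae_goodClocks, ae_first_ne hxy] with g hg hne
    rcases lt_or_gt_of_ne hne with hlt | hlt
    · by_cases h : g x 0 ≤ t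
      · refine le_trans (le_of_eq ?_) le_self_add
        rw [if_pos ⟨h, hlt⟩]
        simp only [fewMoves_succ_of_le _ h, fewMoves_shift hg _ ((hg x).pos 0).le hlt h]
        exact tsum_mul_tsum_mul w _ _ _
      · have hx := not_le.1 h
        simp only [fewMoves_succ_of_lt hg _ ht hx, fewMoves_succ_of_lt hg _ ht (hx.trans hlt)]
        refine le_trans (le_of_eq ?_) zero_le
        rw [ENNReal.tsum_eq_zero]
        intro v
        by_cases hv : x = v
        · subst hv; simp [hxy.symm]
        · simp [hv]
    · by_cases h : g y 0 ≤ t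
      · refine le_trans (le_of_eq ?_) le_add_self
        rw [if_pos ⟨h, hlt⟩]
        simp only [fewMoves_succ_of_le _ h, fewMoves_shift hg _ ((hg y).pos 0).le hlt h]
        rw [hΨ]
        simp only
        rw [← tsum_mul_tsum_mul w]
        exact tsum_congr fun v => by rw [mul_comm (fewMoves _ _ _ _ _ _)]
      · have hy := not_le.1 h
        simp only [fewMoves_succ_of_lt hg _ ht hy, fewMoves_succ_of_lt hg _ ht (hy.trans hlt)]
        refine le_trans (le_of_eq ?_) zero_le
        rw [ENNReal.tsum_eq_zero]
        intro v
        by_cases hv : x = v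
        · subst hv; simp [hxy.symm]
        · simp [hv]
  have hmi : Measurable fun g : V → ℕ → ℝ =>
      if g x 0 ≤ t ∧ g x 0 < g y 0 then Φ (g x 0) (shiftClocks (g x 0) g) else 0 := by
    have hfx := measurable_first x
    have h5 : Measurable ((fun p : ℝ × (V → ℕ → ℝ) => Φ p.1 p.2) ∘
      fun g : V → ℕ → ℝ => (g x 0, shiftClocks (g x 0) g)) :=
        hmΦ.comp (measurable_shiftClocks_first x)
    exact Measurable.ite ((measurableSet_le hfx measurable_const).inter
      (measurableSet_lt hfx (measurable_first y))) h5 measurable_const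
  refine (lintegral_mono_ae h1).trans (le_of_eq ?_)
  have hmI : Measurable fun s => ENNReal.ofReal (Real.exp (-(2 * s))) * ∫⁻ g, Φ s g ∂clocksLaw V :=
    (by fun_prop : Measurable fun s : ℝ => ENNReal.ofReal (Real.exp (-(2 * s)))).mul
      hmΦ.lintegral_prod_right'
  rw [lintegral_add_left hmi, lintegral_first_ring_of_lt hxy hmΦ t,
    lintegral_first_ring_of_lt hxy.symm hmΨ t, ← lintegral_add_left hmI]
  refine lintegral_congr fun s => ?_
  rw [← mul_add]
  congr 2
  · exact lintegral_tsum_mul_collision w _ i (j + 1) (t - s) y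
  · refine (lintegral_tsum_mul_collision w _ j (i + 1) (t - s) x).trans ?_
    exact tsum_congr fun z => by rw [collision_comm]

/-- The collision probability of two walks with the same clocks is bounded by the pair chain. -/
theorem collision_le_pairFlow [Countable V] (hP : IsStochasticMatrix P) {φ : V → V → ℝ≥0∞} {M : ℝ}
    (hφ : ∀ x y, φ x y ≤ ENNReal.ofReal M) (i j : ℕ) {t : ℝ} (ht : 0 ≤ t) (x y : V) :
    collision P (fun v => φ v v) i j t x y ≤ pairFlow P φ t x y := by
  -- Induction on the total number of moves allowed, because off the diagonal only one of `i` and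
  -- `j` decreases. It then suffices that the flow is a supersolution of the same recursion.
  obtain ⟨n, hn⟩ : ∃ n, i + j ≤ n := ⟨_, le_rfl⟩
  induction n generalizing i j t x y with
  | zero =>
    obtain rfl : i = 0 := by omega
    simp [collision, fewMoves_zero]
  | succ n ih =>
    rcases i with _ | i
    · simp [collision, fewMoves_zero]
    rcases j with _ | j
    · simp [collision, fewMoves_zero]
    refine le_trans ?_ (pairFlow_first_jump hP hφ ht x y)
    by_cases hxy : x = y
    · subst hxy
      refine (collision_succ_self_le _ i j ht x).trans ?_
      simp only [pairRate, if_true, Nat.cast_one, one_mul]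
      refine add_le_add le_rfl ?_
      refine setLIntegral_mono' measurableSet_Ioc fun s hs => ?_
      simp only [pairJump, if_true]
      gcongr with z y
      exact ih i j (by linarith [hs.2]) z y (by omega)
    · refine (collision_succ_le_of_ne _ i j ht hxy).trans (le_trans ?_ le_add_self)
      simp only [pairRate, hxy, if_false, Nat.cast_ofNat]
      refine setLIntegral_mono' measurableSet_Ioc fun s hs => ?_
      have hts : 0 ≤ t - s := by linarith [hs.2]
      simp only [pairJump, hxy, if_false]
      gcongr with z z
      · exact ih i (j + 1) hts z y (by omega)
      · exact ih (i + 1) j hts x z (by omega)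

end TwoWalks

/-! ### The clocks and the trajectory of a walk -/

section Bridge

variable {V Ω : Type*}

/-- The times of the moves along the trajectory `y` with the clocks `g`. -/
noncomputable def moveTimes (g : V → ℕ → ℝ) (y : ℕ → V) : ℕ → ℝ
  | 0 => 0
  | n + 1 => moveTimes g y n + shiftClock (moveTimes g y n) (g (y n)) 0

/-- All the clocks, as a random function. -/
def clockOf (gap : V → ℕ → Ω → ℝ) (ω : Ω) (v : V) (k : ℕ) : ℝ := gap v k ω

theorem strictMono_moveTimes {g : V → ℕ → ℝ} (hg : ∀ v, GoodClock (g v)) (y : ℕ → V) :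
    StrictMono (moveTimes g y) :=
  strictMono_nat_of_lt_succ fun n =>
    lt_add_of_pos_right _ (((hg (y n)).shift (moveTimes g y n)).pos 0)

theorem moveTimes_congr (g : V → ℕ → ℝ) {y y' : ℕ → V} {n : ℕ} (h : ∀ i < n, y i = y' i) :
    moveTimes g y n = moveTimes g y' n := by
  induction n with
  | zero => rfl
  | succ n ih => rw [moveTimes, moveTimes, ih fun i hi => h i (by omega), h n (by omega)]

theorem moveTime_eq_moveTimes (gap : V → ℕ → Ω → ℝ) (Y : ℕ → Ω → V) {ω : Ω}
    (hg : ∀ v, GoodClock (clockOf gap ω v)) (n : ℕ) :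
    moveTime gap Y n ω = moveTimes (clockOf gap ω) (fun i => Y i ω) n := by
  induction n with
  | zero => rfl
  | succ n ih =>
    rw [moveTime, moveTimes, ih]
    set M := moveTimes (clockOf gap ω) (fun i => Y i ω) n
    set x := clockOf gap ω (Y n ω) with hx
    have hG : GoodClock x := hg _
    have e : M + shiftClock M x 0 = ring' x (nextIdx M x) := by
      rw [shiftClock, if_pos rfl]; ring
    rw [e]
    refine IsLeast.csInf_eq ⟨⟨hG.lt_ring'_nextIdx M, nextIdx M x, rfl⟩, ?_⟩
    rintro s ⟨hs, k, rfl⟩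
    exact hG.strictMono.monotone (nextIdx_le hs)

theorem walkPosition_eq (gap : V → ℕ → Ω → ℝ) (Y : ℕ → Ω → V) {ω : Ω}
    (hg : ∀ v, GoodClock (clockOf gap ω v)) {n : ℕ} {t : ℝ}
    (h1 : moveTimes (clockOf gap ω) (fun i => Y i ω) n ≤ t)
    (h2 : t < moveTimes (clockOf gap ω) (fun i => Y i ω) (n + 1)) :
    walkPosition gap Y t ω = Y n ω := by
  have hm := strictMono_moveTimes hg fun i => Y i ω
  have e : {m : ℕ | moveTime gap Y m ω ≤ t} = Set.Iic n := by
    ext m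
    simp only [moveTime_eq_moveTimes gap Y hg, Set.mem_ofPred_eq, Set.mem_Iic]
    exact ⟨fun h => Nat.lt_succ_iff.1 (hm.lt_iff_lt.1 (h.trans_lt h2)),
      fun h => (hm.monotone h).trans h1⟩
  rw [walkPosition, e, csSup_Iic]

theorem measurable_moveTimes [Countable V] [MeasurableSpace V] [DiscreteMeasurableSpace V] (n : ℕ) :
    Measurable fun p : (V → ℕ → ℝ) × (ℕ → V) => moveTimes p.1 p.2 n := by
  induction n with
  | zero => exact measurable_const
  | succ n ih =>
    have h1 : Measurable fun q : (V → ℕ → ℝ) × V => q.1 q.2 :=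
      measurable_from_prod_countable_left fun v => measurable_pi_apply v
    have h2 : Measurable fun p : (V → ℕ → ℝ) × (ℕ → V) => (p.1, p.2 n) :=
      measurable_fst.prodMk ((measurable_pi_apply n).comp measurable_snd)
    have h3 : Measurable ((fun q : (V → ℕ → ℝ) × V => q.1 q.2) ∘
      fun p : (V → ℕ → ℝ) × (ℕ → V) => (p.1, p.2 n)) := h1.comp h2
    have h4 : Measurable ((fun p : ℝ × (ℕ → ℝ) => shiftClock p.1 p.2) ∘
      fun p : (V → ℕ → ℝ) × (ℕ → V) => (moveTimes p.1 p.2 n, p.1 (p.2 n))) :=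
      measurable_shiftClock.comp (ih.prodMk h3)
    exact ih.add ((measurable_pi_apply 0).comp h4)

open Classical in
/-- Indicator of the event that the walk with clocks `g` and trajectory `y` is at `v` at time `t`
and has made `n` moves. -/
noncomputable def visit (n : ℕ) (t : ℝ) (v : V) (g : V → ℕ → ℝ) (y : ℕ → V) : ℝ≥0∞ :=
  if y n = v ∧ moveTimes g y n ≤ t ∧ t < moveTimes g y (n + 1) then 1 else 0

open Classical in
theorem measurable_visit [Countable V] [MeasurableSpace V] [DiscreteMeasurableSpace V] (n : ℕ)
    (t : ℝ) (v : V) : Measurable fun p : (V → ℕ → ℝ) × (ℕ → V) => visit n t v p.1 p.2 := by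
  have h : Measurable fun p : (V → ℕ → ℝ) × (ℕ → V) => p.2 n :=
    (measurable_pi_apply n).comp measurable_snd
  have h1 : MeasurableSet {p : (V → ℕ → ℝ) × (ℕ → V) | p.2 n = v} := h (measurableSet_singleton v)
  have hm : Measurable fun p : (V → ℕ → ℝ) × (ℕ → V) =>
      if p.2 n = v ∧ moveTimes p.1 p.2 n ≤ t ∧ t < moveTimes p.1 p.2 (n + 1)
        then (1 : ℝ≥0∞) else 0 :=
    Measurable.ite (h1.inter ((measurableSet_le (measurable_moveTimes n) measurable_const).inter
      (measurableSet_lt measurable_const (measurable_moveTimes (n + 1))))) measurable_const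
      measurable_const
  exact hm

variable [MeasurableSpace V] [MeasurableSpace Ω]
  {μ : Measure Ω} [IsProbabilityMeasure μ] {P : V → V → ℝ} {o : V} {Y : ℕ → Ω → V}

theorem IsMarkovChainFrom.measure_path_succ (h : IsMarkovChainFrom μ P o Y)
    (hP : IsStochasticMatrix P) (n : ℕ) (y : ℕ → V) :
    μ {ω | ∀ i ≤ n + 1, Y i ω = y i} =
      ENNReal.ofReal (P (y n) (y (n + 1))) * μ {ω | ∀ i ≤ n, Y i ω = y i} := by
  by_cases h0 : y 0 = o
  · rw [← ofReal_measureReal, ← ofReal_measureReal, h.path _ y h0, h.path _ y h0,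
      Finset.prod_range_succ, mul_comm, ENNReal.ofReal_mul (hP.nonneg _ _)]
  -- The path formula is assumed only for paths from `o`; all others are null by the starting
  -- condition.
  · have hz : ∀ m, μ {ω | ∀ i ≤ m, Y i ω = y i} = 0 := fun m => by
      refine measure_mono_null (fun ω hω => ?_) (ae_iff.1 h.start)
      intro h1
      exact h0 ((hω 0 (Nat.zero_le _)).symm.trans h1)
    rw [hz, hz, mul_zero]

variable [Countable V] [DiscreteMeasurableSpace V]

/-- The Markov property at one step. -/
theorem IsMarkovChainFrom.lintegral_succ (h : IsMarkovChainFrom μ P o Y)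
    (hP : IsStochasticMatrix P) (n : ℕ) (G : (ℕ → V) → V → ℝ≥0∞)
    (hG : ∀ y y' : ℕ → V, (∀ i ≤ n, y i = y' i) → G y = G y') :
    ∫⁻ ω, G (fun i => Y i ω) (Y (n + 1) ω) ∂μ =
      ∫⁻ ω, ∑' z, ENNReal.ofReal (P (Y n ω) z) * G (fun i => Y i ω) z ∂μ := by
  -- A path up to time `n` is frozen afterwards, which does not change `G`. Such paths form a
  -- countable discrete space, so both integrals become sums over paths.
  let e : (Fin (n + 1) → V) → ℕ → V := fun a i => a ⟨min i n, by omega⟩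
  let X : Ω → Fin (n + 1) → V := fun ω i => Y i ω
  have hX : Measurable X := measurable_pi_iff.2 fun i => h.measurable i
  have hXY : Measurable fun ω => (X ω, Y (n + 1) ω) := hX.prodMk (h.measurable _)
  have hGe : ∀ ω, G (fun i => Y i ω) = G (e (X ω)) := fun ω => hG _ _ fun i hi => by
    simp [e, X, min_eq_left hi]
  have hen : ∀ ω, Y n ω = e (X ω) n := fun ω => by simp [e, X]
  have h1 : ∀ a : Fin (n + 1) → V, μ.map X {a} = μ {ω | ∀ i ≤ n, Y i ω = e a i} := fun a => by
    rw [Measure.map_apply hX (measurableSet_singleton a)]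
    congr 1
    ext ω
    simp only [Set.mem_preimage, Set.mem_singleton_iff, funext_iff, Set.mem_ofPred_eq, X, e]
    constructor
    · intro h i hi
      simpa [min_eq_left hi] using h ⟨i, by omega⟩
    · intro h i
      have := h i (by omega)
      simpa [min_eq_left (Nat.lt_succ_iff.1 i.2)] using this
  have h2 : ∀ (a : Fin (n + 1) → V) (z : V), μ.map (fun ω => (X ω, Y (n + 1) ω)) {(a, z)} =
      ENNReal.ofReal (P (e a n) z) * μ.map X {a} := fun a z => by
    classical
    have hz := h.measure_path_succ hP n (Function.update (e a) (n + 1) z)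
    rw [Function.update_self, Function.update_of_ne (by omega)] at hz
    have e1 : {ω | ∀ i ≤ n, Y i ω = Function.update (e a) (n + 1) z i} =
        {ω | ∀ i ≤ n, Y i ω = e a i} := by
      ext ω
      refine forall₂_congr fun i hi => ?_
      rw [Function.update_of_ne (by omega)]
    rw [h1, ← e1, ← hz, Measure.map_apply hXY (measurableSet_singleton _)]
    congr 1
    ext ω
    have e2 := Set.ext_iff.1 e1 ω
    have e3 : X ω = a ↔ ∀ i ≤ n, Y i ω = e a i := by
      constructor
      · rintro rfl i hi
        simp [e, X, min_eq_left hi]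
      · intro h
        ext i
        have := h i (by omega)
        simpa [e, min_eq_left (Nat.lt_succ_iff.1 i.2)] using this
    simp only [Set.mem_ofPred_eq] at e2
    simp only [Set.mem_preimage, Set.mem_singleton_iff, Prod.mk.injEq, Set.mem_ofPred_eq,
      Nat.le_succ_iff]
    rw [e3, ← e2]
    constructor
    · rintro ⟨ha, hb⟩ i (hi | rfl)
      · exact ha i hi
      · simpa using hb
    · intro h
      exact ⟨fun i hi => h i (.inl hi), by simpa using h (n + 1) (.inr rfl)⟩
  simp_rw [hGe, hen]
  rw [← lintegral_map (f := fun p : (Fin (n + 1) → V) × V => G (e p.1) p.2) .of_discrete hXY,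
    ← lintegral_map (f := fun a : Fin (n + 1) → V =>
      ∑' z, ENNReal.ofReal (P (e a n) z) * G (e a) z) .of_discrete hX,
    lintegral_countable', lintegral_countable', ENNReal.tsum_prod']
  refine tsum_congr fun a => ?_
  rw [← ENNReal.tsum_mul_right]
  refine tsum_congr fun z => ?_
  rw [h2]
  ring

/-- With the clocks fixed, the first `n` moves follow the trajectory and the other `k` are averaged
by the recursion. The Markov property trades one kind of move for the other, from `k + n` averaged
moves down to none. -/
theorem IsMarkovChainFrom.lintegral_exactMoves_move (h : IsMarkovChainFrom μ P o Y)
    (hP : IsStochasticMatrix P) {g : V → ℕ → ℝ} (hg : ∀ v, GoodClock (g v)) (t : ℝ) (v : V)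
    (n k : ℕ) : ∫⁻ ω, exactMoves P k (t - moveTimes g (fun i => Y i ω) n) (Y n ω) v
        (shiftClocks (moveTimes g (fun i => Y i ω) n) g) ∂μ = exactMoves P (k + n) t o v g := by
  induction n generalizing k with
  | zero =>
    have h0 : shiftClocks 0 g = g := funext fun v => (hg v).shift_zero
    have h1 : ∀ᵐ ω ∂μ, exactMoves P k (t - moveTimes g (fun i => Y i ω) 0) (Y 0 ω) v
        (shiftClocks (moveTimes g (fun i => Y i ω) 0) g) = exactMoves P k t o v g := by
      filter_upwards [h.start] with ω hω
      rw [moveTimes, sub_zero, h0, hω]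
    rw [lintegral_congr_ae h1, lintegral_const, measure_univ, mul_one, add_zero]
  | succ n ih =>
    rw [show k + (n + 1) = k + 1 + n by ring, ← ih,
      h.lintegral_succ hP n (fun y z => exactMoves P k (t - moveTimes g y (n + 1)) z v
        (shiftClocks (moveTimes g y (n + 1)) g))
        (fun y y' hy => by rw [moveTimes_congr g fun i hi => hy i (by omega)])]
    refine lintegral_congr fun ω => ?_
    rw [exactMoves]
    refine tsum_congr fun z => ?_
    have e1 : shiftClocks (shiftClocks (moveTimes g (fun i => Y i ω) n) g (Y n ω) 0)
        (shiftClocks (moveTimes g (fun i => Y i ω) n) g) =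
        shiftClocks (moveTimes g (fun i => Y i ω) (n + 1)) g := by
      ext1 w
      rw [moveTimes, add_comm]
      exact (hg w).shift_shift (((hg (Y n ω)).shift _).pos 0).le _
    rw [e1, moveTimes, ← sub_sub]
    rfl

open Classical in
theorem IsMarkovChainFrom.lintegral_visit (h : IsMarkovChainFrom μ P o Y)
    (hP : IsStochasticMatrix P) {g : V → ℕ → ℝ} (hg : ∀ v, GoodClock (g v)) (t : ℝ) (v : V)
    (n : ℕ) : ∫⁻ ω, visit n t v g (fun i => Y i ω) ∂μ = exactMoves P n t o v g := by
  have e := h.lintegral_exactMoves_move hP hg t v n 0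
  rw [zero_add] at e
  rw [← e]
  refine lintegral_congr fun ω => ?_
  rw [visit, exactMoves]
  refine if_congr (and_congr Iff.rfl (and_congr sub_nonneg.symm ?_)) rfl rfl
  rw [moveTimes, sub_lt_iff_lt_add']
  rfl

end Bridge

/-! ### The law of the walk given the clocks -/

section Occupation

variable {V Ω : Type*}

/-- Given the clocks `g`, the probability that the walk started at `x` is at `v` at time `t`. -/
noncomputable def occupation (P : V → V → ℝ) (t : ℝ) (x v : V) (g : V → ℕ → ℝ) : ℝ≥0∞ :=
  ∑' n, exactMoves P n t x v g

theorem measurable_occupation [Countable V] {P : V → V → ℝ} (t : ℝ) (x v : V) :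
    Measurable (occupation P t x v) :=
  Measurable.tsum fun n => measurable_exactMoves_right n t x v

theorem lintegral_occupation [Countable V] {P : V → V → ℝ} (hP : IsStochasticMatrix P) {t : ℝ}
    (ht : 0 ≤ t) (x v : V) : ∫⁻ g, occupation P t x v g ∂clocksLaw V =
      ∑' n : ℕ, ENNReal.ofReal (Real.exp (-t) * (t ^ n / n.factorial)) * eStepProb P n x v := by
  unfold occupation
  rw [lintegral_tsum fun n => (measurable_exactMoves_right n t x v).aemeasurable]
  exact tsum_congr fun n => lintegral_exactMoves hP n ht x v

theorem hasSum_poisson (t : ℝ) :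
    HasSum (fun n : ℕ => Real.exp (-t) * (t ^ n / n.factorial)) 1 := by
  have h := (NormedSpace.expSeries_div_hasSum_exp (𝔸 := ℝ) t).mul_left (Real.exp (-t))
  rwa [← Real.exp_eq_exp_ℝ, ← Real.exp_add, neg_add_cancel, Real.exp_zero] at h

/-- For each number of moves the rows of the power sum to 1, and the Poisson weights sum to 1. No
mass escapes, which rules out explosion even though `V` may be infinite. -/
theorem tsum_lintegral_occupation [Countable V] {P : V → V → ℝ} (hP : IsStochasticMatrix P) {t : ℝ}
    (ht : 0 ≤ t) (x : V) : ∑' v, ∫⁻ g, occupation P t x v g ∂clocksLaw V = 1 := by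
  simp_rw [lintegral_occupation hP ht]
  rw [ENNReal.tsum_comm]
  simp_rw [ENNReal.tsum_mul_left, tsum_eStepProb hP, mul_one]
  rw [tsum_ofReal_eq (fun n => by positivity) (hasSum_poisson t), ENNReal.ofReal_one]

theorem tsum_visit_le_one {g : V → ℕ → ℝ} (hg : ∀ v, GoodClock (g v)) (y : ℕ → V) (t : ℝ) :
    ∑' v, ∑' n, visit n t v g y ≤ 1 ∧
      ((∑' v, ∑' n, visit n t v g y) ≠ 0 →
        ∃ n, moveTimes g y n ≤ t ∧ t < moveTimes g y (n + 1)) := by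
  classical
  by_cases h : ∃ n, moveTimes g y n ≤ t ∧ t < moveTimes g y (n + 1)
  · refine ⟨?_, fun _ => h⟩
    obtain ⟨n, h1, h2⟩ := h
    have hm := strictMono_moveTimes hg y
    have h3 : ∀ v m, m ≠ n → visit m t v g y = 0 := by
      intro v m hmn
      refine if_neg ?_
      rintro ⟨-, h4, h5⟩
      refine hmn (le_antisymm ?_ ?_)
      · exact Nat.lt_succ_iff.1 (hm.lt_iff_lt.1 (h4.trans_lt h2))
      · exact Nat.lt_succ_iff.1 (hm.lt_iff_lt.1 (h1.trans_lt h5))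
    have h4 : ∀ v, ∑' m, visit m t v g y = visit n t v g y := fun v => tsum_eq_single n (h3 v)
    simp_rw [h4]
    rw [tsum_eq_single (y n) fun v hv => by rw [visit, if_neg fun h => hv h.1.symm]]
    unfold visit
    split_ifs <;> simp
  · have h0 : ∀ v n, visit n t v g y = 0 := fun v n => if_neg fun h' => h ⟨n, h'.2⟩
    simp [h0]

theorem tsum_visit_eq {g : V → ℕ → ℝ} (hg : ∀ v, GoodClock (g v)) (y : ℕ → V) {t : ℝ} {n : ℕ}
    (h1 : moveTimes g y n ≤ t) (h2 : t < moveTimes g y (n + 1)) (v : V) :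
    ∑' m, visit m t v g y = ({v} : Set V).indicator 1 (y n) := by
  classical
  have hm := strictMono_moveTimes hg y
  rw [tsum_eq_single n]
  · by_cases h : y n = v
    · rw [visit, if_pos ⟨h, h1, h2⟩, Set.indicator_of_mem (Set.mem_singleton_iff.2 h), Pi.one_apply]
    · rw [visit, if_neg fun h' => h h'.1, Set.indicator_of_notMem (Set.mem_singleton_iff.not.2 h)]
  · intro m hmn
    refine if_neg ?_
    rintro ⟨-, h4, h5⟩
    refine hmn (le_antisymm ?_ ?_)
    · exact Nat.lt_succ_iff.1 (hm.lt_iff_lt.1 (h4.trans_lt h2))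
    · exact Nat.lt_succ_iff.1 (hm.lt_iff_lt.1 (h1.trans_lt h5))

variable [MeasurableSpace Ω] {μ : Measure Ω} {gap : V → ℕ → Ω → ℝ}

theorem IsUnitPoissonClocks.measurable_clockOf (h : IsUnitPoissonClocks μ gap) :
    Measurable (clockOf gap) :=
  measurable_pi_iff.2 fun v => measurable_pi_iff.2 fun k => h.measurable v k

theorem IsUnitPoissonClocks.map_clockOf (h : IsUnitPoissonClocks μ gap) :
    μ.map (clockOf gap) = clocksLaw V := by
  have h1 := h.indep.map_fun_eq_infinitePi_map fun i : V × ℕ => h.measurable i.1 i.2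
  simp_rw [h.law] at h1
  have hm : Measurable fun ω (i : V × ℕ) => gap i.1 i.2 ω :=
    measurable_pi_iff.2 fun i => h.measurable i.1 i.2
  have h2 := Measure.infinitePi_map_curry (fun (_ : V) (_ : ℕ) => expMeasure 1)
  rw [← h1, Measure.map_map (MeasurableEquiv.measurable _) hm] at h2
  exact h2

variable [MeasurableSpace V] {P : V → V → ℝ} {o : V} {Y : ℕ → Ω → V}

theorem IsClockedWalk.measurable_chain (h : IsClockedWalk μ P o gap Y) :
    Measurable fun ω n => Y n ω := measurable_pi_iff.2 h.chain.measurable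

theorem IsClockedWalk.ae_goodClocks [Countable V] (h : IsClockedWalk μ P o gap Y) :
    ∀ᵐ ω ∂μ, ∀ v, GoodClock (clockOf gap ω v) := by
  have h1 := _root_.ae_goodClocks (V := V)
  rw [← h.clocks.map_clockOf] at h1
  exact ae_of_ae_map h.clocks.measurable_clockOf.aemeasurable h1

theorem IsClockedWalk.measurable_tsum_visit [Countable V]
    [DiscreteMeasurableSpace V] (h : IsClockedWalk μ P o gap Y) (t : ℝ) (v : V) :
    Measurable fun ω => ∑' n, visit n t v (clockOf gap ω) (fun i => Y i ω) :=
  Measurable.tsum fun n => (measurable_visit n t v).comp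
    (h.clocks.measurable_clockOf.prodMk h.measurable_chain)

variable [IsProbabilityMeasure μ]

theorem IsClockedWalk.map_clockOf_chain (h : IsClockedWalk μ P o gap Y) :
    μ.map (fun ω => (clockOf gap ω, fun n => Y n ω)) =
      (clocksLaw V).prod (μ.map fun ω n => Y n ω) := by
  rw [← h.clocks.map_clockOf]
  refine (indepFun_iff_map_prod_eq_prod_map_map h.clocks.measurable_clockOf.aemeasurable
    h.measurable_chain.aemeasurable).1 ?_
  exact h.indep.comp (MeasurableEquiv.curry V ℕ ℝ).measurable measurable_id

variable [Countable V] [DiscreteMeasurableSpace V]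

theorem IsClockedWalk.setLIntegral_visit (h : IsClockedWalk μ P o gap Y)
    (hP : IsStochasticMatrix P) (t : ℝ) (v : V) {B : Set (V → ℕ → ℝ)} (hB : MeasurableSet B) :
    ∫⁻ ω in clockOf gap ⁻¹' B, ∑' n, visit n t v (clockOf gap ω) (fun i => Y i ω) ∂μ =
      ∫⁻ g in B, occupation P t o v g ∂clocksLaw V := by
  have hT : Measurable fun p : (V → ℕ → ℝ) × (ℕ → V) => ∑' n, visit n t v p.1 p.2 :=
    Measurable.tsum fun n => measurable_visit n t v
  have hI : Measurable fun p : (V → ℕ → ℝ) × (ℕ → V) =>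
      B.indicator (1 : (V → ℕ → ℝ) → ℝ≥0∞) p.1 * ∑' n, visit n t v p.1 p.2 :=
    ((measurable_one.indicator hB).comp measurable_fst).mul hT
  have hcm := h.clocks.measurable_clockOf
  rw [← lintegral_indicator (hcm hB), ← lintegral_indicator hB]
  have e1 : ∀ ω, (clockOf gap ⁻¹' B).indicator
      (fun ω => ∑' n, visit n t v (clockOf gap ω) (fun i => Y i ω)) ω =
      B.indicator (1 : (V → ℕ → ℝ) → ℝ≥0∞) (clockOf gap ω) *
        ∑' n, visit n t v (clockOf gap ω) (fun i => Y i ω) := fun ω => by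
    by_cases hω : clockOf gap ω ∈ B <;> simp [Set.indicator, hω]
  simp_rw [e1]
  rw [← lintegral_map (f := fun p : (V → ℕ → ℝ) × (ℕ → V) =>
      B.indicator (1 : (V → ℕ → ℝ) → ℝ≥0∞) p.1 * ∑' n, visit n t v p.1 p.2) hI
      (hcm.prodMk h.measurable_chain), h.map_clockOf_chain]
  have : IsProbabilityMeasure (μ.map fun ω n => Y n ω) :=
    Measure.isProbabilityMeasure_map h.measurable_chain.aemeasurable
  rw [lintegral_prod _ hI.aemeasurable]
  refine lintegral_congr_ae ?_
  filter_upwards [_root_.ae_goodClocks] with g hg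
  have hv : ∀ n, Measurable fun y : ℕ → V => visit n t v g y := fun n =>
    (measurable_visit n t v).comp (measurable_const.prodMk measurable_id)
  have hv2 : ∀ n, Measurable fun ω => visit n t v g fun i => Y i ω := fun n =>
    (hv n).comp h.measurable_chain
  rw [lintegral_const_mul _ (Measurable.tsum hv), lintegral_map (Measurable.tsum hv)
    h.measurable_chain, lintegral_tsum fun n => (hv2 n).aemeasurable]
  have e2 : ∀ n, ∫⁻ ω, visit n t v g (fun i => Y i ω) ∂μ = exactMoves P n t o v g :=
    h.chain.lintegral_visit hP hg t v
  rw [tsum_congr e2]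
  by_cases hgB : g ∈ B <;> simp [Set.indicator, hgB, occupation]

/-- Almost surely, only finitely many moves are made up to time `t`. -/
theorem IsClockedWalk.ae_exists_moveTimes (h : IsClockedWalk μ P o gap Y)
    (hP : IsStochasticMatrix P) {t : ℝ} (ht : 0 ≤ t) :
    ∀ᵐ ω ∂μ, ∃ n, moveTimes (clockOf gap ω) (fun i => Y i ω) n ≤ t ∧
      t < moveTimes (clockOf gap ω) (fun i => Y i ω) (n + 1) := by
  set S : Ω → ℝ≥0∞ := fun ω => ∑' v, ∑' n, visit n t v (clockOf gap ω) (fun i => Y i ω) with hS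
  have hS1 : ∫⁻ ω, S ω ∂μ = 1 := by
    rw [hS, lintegral_tsum fun v => (h.measurable_tsum_visit t v).aemeasurable,
      ← tsum_lintegral_occupation hP ht o]
    refine tsum_congr fun v => ?_
    have := h.setLIntegral_visit hP t v MeasurableSet.univ
    simpa using this
  have hle : S ≤ᵐ[μ] 1 := by
    filter_upwards [h.ae_goodClocks] with ω hω
    exact (tsum_visit_le_one hω _ t).1
  -- `S` is at most 1 and has integral 1, so it equals 1 almost surely; a nonzero value exhibits the
  -- required `n`.
  have heq := ae_eq_of_ae_le_of_lintegral_le hle (by simp [hS1]) measurable_one.aemeasurable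
    (by simp [hS1])
  filter_upwards [heq, h.ae_goodClocks] with ω h1 h2
  exact (tsum_visit_le_one h2 _ t).2 (by
    change S ω ≠ 0
    simp [h1])

theorem IsClockedWalk.ae_indicator_walkPosition (h : IsClockedWalk μ P o gap Y)
    (hP : IsStochasticMatrix P) {t : ℝ} (ht : 0 ≤ t) (v : V) :
    ∀ᵐ ω ∂μ, {ω | walkPosition gap Y t ω = v}.indicator (1 : Ω → ℝ≥0∞) ω =
      ∑' n, visit n t v (clockOf gap ω) (fun i => Y i ω) := by
  filter_upwards [h.ae_exists_moveTimes hP ht, h.ae_goodClocks] with ω ⟨n, h1, h2⟩ hω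
  rw [tsum_visit_eq hω _ h1 h2]
  have e := walkPosition_eq gap Y hω h1 h2
  by_cases hv : Y n ω = v
  · rw [Set.indicator_of_mem (by exact e.trans hv),
      Set.indicator_of_mem (Set.mem_singleton_iff.2 hv), Pi.one_apply, Pi.one_apply]
  · rw [Set.indicator_of_notMem (by exact fun h => hv (e.symm.trans h)),
      Set.indicator_of_notMem (Set.mem_singleton_iff.not.2 hv)]

end Occupation

/-! ### The fragmentation process and the occupation probabilities -/

section Fragmentation

variable {V Ω : Type*}

theorem lintegral_enorm_sq [MeasurableSpace Ω] (μ : Measure Ω) (f : Ω → ℝ) :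
    ∫⁻ ω, ENNReal.ofReal (f ω ^ 2) ∂μ = eLpNorm f 2 μ ^ 2 := by
  have h := eLpNorm_nnreal_pow_eq_lintegral (f := f) (μ := μ) (p := 2) (by norm_num)
  have e : ∀ x : ℝ≥0∞, x ^ ((2 : NNReal) : ℝ) = x ^ 2 := fun x => by
    rw [NNReal.coe_ofNat]; exact_mod_cast ENNReal.rpow_natCast x 2
  simp only [e] at h
  rw [← ENNReal.coe_ofNat, h]
  refine lintegral_congr fun ω => ?_
  rw [← sq_abs, ENNReal.ofReal_pow (abs_nonneg _), Real.enorm_eq_ofReal_abs]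

/-- Monotone convergence removes the bound on the number of moves, which was present only for the
induction. -/
theorem tsum_lintegral_occupation_sq_le [Countable V] {P : V → V → ℝ} (w : V → ℝ≥0∞) (t : ℝ) (x : V)
    {b : ℝ≥0∞} (hb : ∀ n, collision P w n n t x x ≤ b) :
    ∑' v, w v * ∫⁻ g, occupation P t x v g ^ 2 ∂clocksLaw V ≤ b := by
  have hm : ∀ v, Monotone fun n g => fewMoves P n t x v g * fewMoves P n t x v g := by
    intro v
    refine monotone_nat_of_le_succ fun n g => ?_
    have : fewMoves P n t x v g ≤ fewMoves P (n + 1) t x v g :=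
      Finset.sum_le_sum_of_subset (Finset.range_mono n.le_succ)
    exact mul_le_mul' this this
  have hfm : ∀ v n, Measurable (fewMoves P n t x v) := fun v n =>
    Finset.measurable_fun_sum _ fun i _ => measurable_exactMoves_right i t x v
  have hle : ∀ v g, occupation P t x v g ^ 2 ≤ ⨆ n, fewMoves P n t x v g * fewMoves P n t x v g := by
    intro v g
    have e : occupation P t x v g = ⨆ n, fewMoves P n t x v g := ENNReal.tsum_eq_iSup_nat
    rw [sq, e, ENNReal.iSup_mul]
    refine iSup_le fun i => ?_
    rw [ENNReal.mul_iSup]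
    refine iSup_le fun j => ?_
    refine le_trans ?_ (le_iSup _ (max i j))
    exact mul_le_mul' (Finset.sum_le_sum_of_subset (Finset.range_mono (le_max_left i j)))
      (Finset.sum_le_sum_of_subset (Finset.range_mono (le_max_right i j)))
  have hfm2 : ∀ v n, Measurable fun g => fewMoves P n t x v g * fewMoves P n t x v g := fun v n =>
    (hfm v n).mul (hfm v n)
  have hfm3 : ∀ v n, Measurable fun g => w v * (fewMoves P n t x v g * fewMoves P n t x v g) :=
    fun v n => (hfm2 v n).const_mul (w v)
  have hI : ∀ v, ∫⁻ g, occupation P t x v g ^ 2 ∂clocksLaw V ≤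
      ⨆ n, ∫⁻ g, fewMoves P n t x v g * fewMoves P n t x v g ∂clocksLaw V := fun v => by
    rw [← lintegral_iSup (hfm2 v) (hm v)]
    exact lintegral_mono (hle v)
  rw [ENNReal.tsum_eq_iSup_sum]
  refine iSup_le fun s => ?_
  have hs : ∑ v ∈ s, w v * ∫⁻ g, occupation P t x v g ^ 2 ∂clocksLaw V ≤
      ⨆ n, ∑ v ∈ s, w v * ∫⁻ g, fewMoves P n t x v g * fewMoves P n t x v g ∂clocksLaw V := by
    rw [← ENNReal.finsetSum_iSup_of_monotone
      fun v n m h => mul_le_mul_right (lintegral_mono (hm v h)) (w v)]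
    refine Finset.sum_le_sum fun v _ => ?_
    rw [← ENNReal.mul_iSup]
    exact mul_le_mul_right (hI v) _
  refine hs.trans (iSup_le fun n => le_trans ?_ (hb n))
  unfold collision
  rw [lintegral_tsum fun v => (hfm3 v n).aemeasurable]
  refine le_trans (le_of_eq (Finset.sum_congr rfl fun v _ => ?_)) (ENNReal.sum_le_tsum s)
  rw [lintegral_const_mul _ (hfm2 v n)]

theorem lintegral_occupation_ne_top [Countable V] {P : V → V → ℝ} (hP : IsStochasticMatrix P) {t : ℝ}
    (ht : 0 ≤ t) (x v : V) : ∫⁻ g, occupation P t x v g ∂clocksLaw V ≠ ∞ := by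
  have h := ENNReal.le_tsum (f := fun v => ∫⁻ g, occupation P t x v g ∂clocksLaw V) v
  rw [tsum_lintegral_occupation hP ht] at h
  exact ne_top_of_le_ne_top ENNReal.one_ne_top h

theorem indicator_one_eq_toReal (A : Set Ω) :
    A.indicator (fun _ => (1 : ℝ)) = fun ω => (A.indicator (1 : Ω → ℝ≥0∞) ω).toReal := by
  ext ω
  by_cases hω : ω ∈ A <;> simp [hω]

theorem clockSigma_le_comap (gap : V → ℕ → Ω → ℝ) (t : ℝ) :
    clockSigma gap t ≤ MeasurableSpace.comap (clockOf gap) inferInstance := by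
  refine MeasurableSpace.generateFrom_le ?_
  rintro A ⟨v, k, s, -, rfl⟩
  refine ⟨{g | ring' (g v) k ≤ s}, ?_, rfl⟩
  have hm : Measurable fun g : V → ℕ → ℝ => ring' (g v) k :=
    Finset.measurable_fun_sum _ fun i _ => (measurable_pi_apply i).comp (measurable_pi_apply v)
  exact measurableSet_le hm measurable_const

variable [MeasurableSpace Ω] {μ : Measure Ω} {gap : V → ℕ → Ω → ℝ}

theorem IsUnitPoissonClocks.comap_clockOf_le (h : IsUnitPoissonClocks μ gap) :
    MeasurableSpace.comap (clockOf gap) inferInstance ≤ (inferInstance : MeasurableSpace Ω) :=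
  h.measurable_clockOf.comap_le

variable [MeasurableSpace V] [Countable V] {P : V → V → ℝ} {o : V} {Y : ℕ → Ω → V}

theorem IsClockedWalk.lintegral_occupation_clockOf (h : IsClockedWalk μ P o gap Y) (t : ℝ) (v : V) :
    ∫⁻ ω, occupation P t o v (clockOf gap ω) ∂μ = ∫⁻ g, occupation P t o v g ∂clocksLaw V := by
  rw [← h.clocks.map_clockOf, lintegral_map (measurable_occupation t o v)
    h.clocks.measurable_clockOf]

theorem IsClockedWalk.fragmentationSecondMoment_eq (h : IsClockedWalk μ P o gap Y) (t : ℝ) :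
    fragmentationSecondMoment μ gap Y t =
      ∑' v, ∫⁻ ω, ENNReal.ofReal (fragmentation μ gap Y t v ω ^ 2) ∂μ := by
  have hsig := (clockSigma_le_comap gap t).trans h.clocks.comap_clockOf_le
  refine lintegral_tsum fun v => ?_
  have hm : Measurable (fragmentation μ gap Y t v) :=
    (stronglyMeasurable_condExp.mono hsig).measurable
  exact (hm.pow_const 2).ennreal_ofReal.aemeasurable

variable [IsProbabilityMeasure μ] [DiscreteMeasurableSpace V]

theorem IsClockedWalk.setLIntegral_walkPosition (h : IsClockedWalk μ P o gap Y)
    (hP : IsStochasticMatrix P) {t : ℝ} (ht : 0 ≤ t) (v : V) {B : Set (V → ℕ → ℝ)}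
    (hB : MeasurableSet B) :
    ∫⁻ ω in clockOf gap ⁻¹' B, {ω | walkPosition gap Y t ω = v}.indicator (1 : Ω → ℝ≥0∞) ω ∂μ =
      ∫⁻ ω in clockOf gap ⁻¹' B, occupation P t o v (clockOf gap ω) ∂μ := by
  rw [lintegral_congr_ae (ae_restrict_of_ae (h.ae_indicator_walkPosition hP ht v)),
    h.setLIntegral_visit hP t v hB, ← h.clocks.map_clockOf,
    setLIntegral_map hB (measurable_occupation t o v) h.clocks.measurable_clockOf]

theorem IsClockedWalk.aemeasurable_indicator_walkPosition (h : IsClockedWalk μ P o gap Y)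
    (hP : IsStochasticMatrix P) {t : ℝ} (ht : 0 ≤ t) (v : V) :
    AEMeasurable ({ω | walkPosition gap Y t ω = v}.indicator (1 : Ω → ℝ≥0∞)) μ :=
  ⟨_, h.measurable_tsum_visit t v, h.ae_indicator_walkPosition hP ht v⟩

/-- The conditional law of the walk given all the clocks. -/
theorem IsClockedWalk.condExp_comap_clockOf (h : IsClockedWalk μ P o gap Y)
    (hP : IsStochasticMatrix P) {t : ℝ} (ht : 0 ≤ t) (v : V) :
    (fun ω => (occupation P t o v (clockOf gap ω)).toReal) =ᵐ[μ]
      μ[{ω | walkPosition gap Y t ω = v}.indicator (fun _ => (1 : ℝ)) |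
        MeasurableSpace.comap (clockOf gap) inferInstance] := by
  have hI := h.aemeasurable_indicator_walkPosition hP ht v
  have hO : Measurable fun ω => occupation P t o v (clockOf gap ω) :=
    (measurable_occupation t o v).comp h.clocks.measurable_clockOf
  have hOt : ∫⁻ ω, occupation P t o v (clockOf gap ω) ∂μ ≠ ∞ := by
    rw [h.lintegral_occupation_clockOf]
    exact lintegral_occupation_ne_top hP ht o v
  have hle : ∀ ω, {ω | walkPosition gap Y t ω = v}.indicator (1 : Ω → ℝ≥0∞) ω ≤ 1 := fun ω =>
    Set.indicator_le_self' (fun _ _ => by simp) ω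
  have hIt : ∫⁻ ω, {ω | walkPosition gap Y t ω = v}.indicator (1 : Ω → ℝ≥0∞) ω ∂μ ≠ ∞ :=
    ne_top_of_le_ne_top ENNReal.one_ne_top ((lintegral_mono hle).trans (by simp))
  rw [indicator_one_eq_toReal]
  refine ae_eq_condExp_of_forall_setIntegral_eq h.clocks.comap_clockOf_le
    (integrable_toReal_of_lintegral_ne_top hI hIt) (fun s _ _ =>
      (integrable_toReal_of_lintegral_ne_top hO.aemeasurable hOt).integrableOn) ?_ ?_
  · rintro s ⟨B, hB, rfl⟩ -
    rw [integral_toReal hO.aemeasurable.restrict, integral_toReal hI.restrict]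
    · exact congrArg ENNReal.toReal (h.setLIntegral_walkPosition hP ht v hB).symm
    · exact ae_of_all _ fun ω => (hle ω).trans_lt ENNReal.one_lt_top
    · exact ae_lt_top' hO.aemeasurable.restrict
        (ne_top_of_le_ne_top hOt (setLIntegral_le_lintegral _ _))
  · have hm : Measurable[MeasurableSpace.comap (clockOf gap) inferInstance] (clockOf gap) :=
      comap_measurable _
    exact ((measurable_occupation (P := P) t o v).comp hm).ennreal_toReal.aestronglyMeasurable

/-- By the tower property `m_t` is a conditional expectation of the law given all the clocks, and
conditioning contracts `L²`. There is thus no need to show that this law depends only on the rings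
up to time `t`. -/
theorem IsClockedWalk.lintegral_fragmentation_sq_le (h : IsClockedWalk μ P o gap Y)
    (hP : IsStochasticMatrix P) {t : ℝ} (ht : 0 ≤ t) (v : V) :
    ∫⁻ ω, ENNReal.ofReal (fragmentation μ gap Y t v ω ^ 2) ∂μ ≤
      ∫⁻ g, occupation P t o v g ^ 2 ∂clocksLaw V := by
  have h1 : fragmentation μ gap Y t v =ᵐ[μ]
      μ[fun ω => (occupation P t o v (clockOf gap ω)).toReal | clockSigma gap t] :=
    (condExp_condExp_of_le (clockSigma_le_comap gap t) h.clocks.comap_clockOf_le).symm.trans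
      (condExp_congr_ae (h.condExp_comap_clockOf hP ht v).symm)
  rw [lintegral_enorm_sq, eLpNorm_congr_ae h1, ← h.clocks.map_clockOf,
    lintegral_map ((measurable_occupation t o v).pow_const 2) h.clocks.measurable_clockOf]
  refine (pow_le_pow_left' (eLpNorm_condExp_le_eLpNorm _ (by norm_num)) 2).trans ?_
  rw [← lintegral_enorm_sq]
  refine lintegral_mono fun ω => ?_
  rw [ENNReal.ofReal_pow ENNReal.toReal_nonneg]
  exact pow_le_pow_left' ENNReal.ofReal_toReal_le 2

/-- Jensen in the other direction: `m_t(v)` has mean `P(X(t) = v)`, so forgetting the clocks gives a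
lower bound. -/
theorem IsClockedWalk.sq_lintegral_occupation_le (h : IsClockedWalk μ P o gap Y)
    (hP : IsStochasticMatrix P) {t : ℝ} (ht : 0 ≤ t) (v : V) :
    (∫⁻ g, occupation P t o v g ∂clocksLaw V) ^ 2 ≤
      ∫⁻ ω, ENNReal.ofReal (fragmentation μ gap Y t v ω ^ 2) ∂μ := by
  have hsig := (clockSigma_le_comap gap t).trans h.clocks.comap_clockOf_le
  have hI := h.aemeasurable_indicator_walkPosition hP ht v
  have hle : ∀ ω, {ω | walkPosition gap Y t ω = v}.indicator (1 : Ω → ℝ≥0∞) ω ≤ 1 := fun ω =>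
    Set.indicator_le_self' (fun _ _ => by simp) ω
  have h1 : ∫ ω, fragmentation μ gap Y t v ω ∂μ =
      (∫⁻ g, occupation P t o v g ∂clocksLaw V).toReal := by
    unfold fragmentation
    rw [integral_condExp hsig, indicator_one_eq_toReal, integral_toReal hI
      (ae_of_all _ fun ω => (hle ω).trans_lt ENNReal.one_lt_top),
      ← h.lintegral_occupation_clockOf]
    have := h.setLIntegral_walkPosition hP ht v MeasurableSet.univ
    rw [Set.preimage_univ, Measure.restrict_univ] at this
    rw [this]
  have h2 : ∫⁻ g, occupation P t o v g ∂clocksLaw V = ‖∫ ω, fragmentation μ gap Y t v ω ∂μ‖ₑ := by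
    rw [h1, Real.enorm_eq_ofReal ENNReal.toReal_nonneg,
      ENNReal.ofReal_toReal (lintegral_occupation_ne_top hP ht o v)]
  rw [h2, lintegral_enorm_sq]
  refine pow_le_pow_left' ((enorm_integral_le_lintegral_enorm _).trans ?_) 2
  rw [← eLpNorm_one_eq_lintegral_enorm]
  exact eLpNorm_le_eLpNorm_of_exponent_le (by norm_num)
    (stronglyMeasurable_condExp.mono hsig).aestronglyMeasurable

end Fragmentation

/-! ### The upper bound -/

theorem exists_fragmentationSecondMoment_le (C₀ Δ : ℝ) : ∃ C : ℝ,
    ∀ (V : Type*) [Countable V] [MeasurableSpace V] [DiscreteMeasurableSpace V]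
      (P : V → V → ℝ) (π : V → ℝ),
      IsStochasticMatrix P → HasSqrtDecay P C₀ → IsReversibleWrt P π → IsSupRatio π Δ →
      ∀ (o : V) (Ω : Type*) [MeasurableSpace Ω] (μ : Measure Ω) [IsProbabilityMeasure μ]
        (gap : V → ℕ → Ω → ℝ) (Y : ℕ → Ω → V), IsClockedWalk μ P o gap Y →
        ∀ t : ℝ, 0 < t → (Finite V → t ≤ (Nat.card V : ℝ) ^ 2 / 3) →
          fragmentationSecondMoment μ gap Y t ≤ ENNReal.ofReal (C * t ^ (-(1 / 2) : ℝ)) := by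
  obtain ⟨K, hK, hflow⟩ := exists_pairFlow_le
  refine ⟨Δ * (K * (2 * (1 + 2 * C₀))), ?_⟩
  intro V _ _ _ P π hP hC hπ hΔ o Ω _ μ _ gap Y h t ht hV
  have hr : ∀ u v, π u / π v ≤ Δ := fun u v => hΔ.1 ⟨(u, v), rfl⟩
  have hpos := hπ.pos
  have hΔ0 : 0 ≤ Δ := (div_pos (hpos o) (hpos o)).le.trans (hr o o)
  -- `Δ` enters twice: here qualitatively, to make the initial kernel bounded, and in `hw` to
  -- replace the weights `1 / π v` by a constant. The scale `π o` cancels at the end.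
  have hM : ∀ v, 1 / π v ≤ Δ / π o := fun v => by
    rw [le_div_iff₀ (hpos o), div_mul_eq_mul_div, one_mul]
    exact hr o v
  have hB : 0 ≤ 2 * (1 + 2 * C₀) := by linarith [hC.1]
  have hM0 : 0 ≤ Δ / π o := div_nonneg hΔ0 (hpos o).le
  have hcol := fun n => (collision_le_pairFlow hP (lazyKernel_zero_le hM hM0) n n ht.le o o).trans
    (hflow hP hπ _ hM o _ t hB ht (lazy_return_le hP hπ hC ht hV o))
  have hsum := tsum_lintegral_occupation_sq_le _ t o hcol
  have hw : ∀ v, 1 ≤ ENNReal.ofReal (Δ * π o) * lazyKernel P π 0 v v := fun v => by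
    have e : lazyKernel P π 0 v v = ENNReal.ofReal (1 / π v) := by
      simp [lazyKernel, polyEntry_one]
    rw [e, ← ENNReal.ofReal_mul (mul_nonneg hΔ0 (hpos o).le), ENNReal.one_le_ofReal, mul_one_div,
      le_div_iff₀ (hpos v), one_mul, ← div_le_iff₀ (hpos o)]
    exact hr v o
  calc fragmentationSecondMoment μ gap Y t
      = ∑' v, ∫⁻ ω, ENNReal.ofReal (fragmentation μ gap Y t v ω ^ 2) ∂μ :=
        h.fragmentationSecondMoment_eq t
    _ ≤ ∑' v, ENNReal.ofReal (Δ * π o) *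
        (lazyKernel P π 0 v v * ∫⁻ g, occupation P t o v g ^ 2 ∂clocksLaw V) := by
        refine ENNReal.tsum_le_tsum fun v => (h.lintegral_fragmentation_sq_le hP ht.le v).trans ?_
        rw [← mul_assoc]
        exact le_mul_of_one_le_left' (hw v)
    _ ≤ ENNReal.ofReal (Δ * π o) * ENNReal.ofReal (K * (2 * (1 + 2 * C₀)) / π o / √t) := by
        rw [ENNReal.tsum_mul_left]
        gcongr
    _ = _ := by
        rw [← ENNReal.ofReal_mul (mul_nonneg hΔ0 (hpos o).le), rpow_neg_half t ht.le]
        congr 1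
        have := (hpos o).ne'
        field_simp

/-! ### The simple random walk on the integers -/

section LineWalk

theorem hasSum_lineWalk_mul (u : ℤ) (f : ℤ → ℝ) :
    HasSum (fun w => lineWalk u w * f w) ((f (u - 1) + f (u + 1)) / 2) := by
  have hne : u - 1 ≠ u + 1 := by omega
  have h : HasSum (fun w => lineWalk u w * f w) (∑ w ∈ {u - 1, u + 1}, lineWalk u w * f w) :=
    hasSum_sum_of_ne_finset_zero fun w hw => by
      have : ¬|u - w| = 1 := by
        intro h
        rcases (abs_eq zero_le_one).1 h with h | h <;> exact hw (by simp; omega)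
      simp [lineWalk, this]
  convert h using 1
  rw [Finset.sum_pair hne, lineWalk, lineWalk, if_pos (by norm_num), if_pos (by norm_num)]
  ring

theorem isStochasticMatrix_lineWalk : IsStochasticMatrix lineWalk := by
  refine ⟨fun u v => by unfold lineWalk; split_ifs <;> norm_num, fun u => ?_⟩
  simpa using hasSum_lineWalk_mul u 1

theorem stepProb_lineWalk_succ (k : ℕ) (u v : ℤ) : stepProb lineWalk (k + 1) u v =
    (stepProb lineWalk k (u - 1) v + stepProb lineWalk k (u + 1) v) / 2 :=
  (hasSum_lineWalk_mul u _).tsum_eq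

theorem stepProb_lineWalk (k : ℕ) (u v : ℤ) :
    (∀ j : ℕ, v - u = 2 * j - k → stepProb lineWalk k u v = k.choose j / 2 ^ k) ∧
      ((∀ j : ℕ, v - u ≠ 2 * j - k) → stepProb lineWalk k u v = 0) := by
  induction k generalizing u with
  | zero =>
    refine ⟨fun j hj => ?_, fun h => if_neg fun huv => h 0 (by simp [huv])⟩
    cases j with
    | zero => simp [stepProb, show u = v by push_cast at hj; omega]
    | succ j => simp [stepProb, show u ≠ v by push_cast at hj; omega]
  | succ k ih =>
    rw [stepProb_lineWalk_succ]
    constructor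
    · intro j hj
      push_cast at hj
      rw [(ih (u - 1)).1 j (by omega)]
      cases j with
      | zero =>
        rw [(ih (u + 1)).2 fun i => by push_cast at hj; omega]
        simp only [Nat.choose_zero_right, Nat.cast_one]
        ring
      | succ j =>
        rw [(ih (u + 1)).1 j (by push_cast at hj; omega), Nat.choose_succ_succ]
        push_cast
        ring
    · intro h
      push_cast at h
      rw [(ih (u - 1)).2 fun j hj => h j (by omega),
        (ih (u + 1)).2 fun j hj => h (j + 1) (by push_cast; omega)]
      norm_num

/-- A Stirling-free form of the `1 / √(2 n + 1)` bound; the induction step amounts to `(2 n + 3) (2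
n + 1) ≤ 4 (n + 1)²`. -/
theorem mul_centralBinom_sq_le (n : ℕ) : (2 * n + 1) * n.centralBinom ^ 2 ≤ 16 ^ n := by
  induction n with
  | zero => simp
  | succ n ih =>
    have h := Nat.succ_mul_centralBinom_succ n
    have h1 : (n + 1) ^ 2 * ((2 * (n + 1) + 1) * (n + 1).centralBinom ^ 2) =
        4 * (2 * n + 3) * (2 * n + 1) * ((2 * n + 1) * n.centralBinom ^ 2) := by
      calc _ = (2 * n + 3) * ((n + 1) * (n + 1).centralBinom) ^ 2 := by ring
        _ = _ := by rw [h]; ring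
    refine le_of_mul_le_mul_left (a := (n + 1) ^ 2) ?_ (pow_pos n.succ_pos 2)
    rw [h1, pow_succ 16 n]
    calc _ ≤ 4 * (2 * n + 3) * (2 * n + 1) * 16 ^ n := Nat.mul_le_mul_left _ ih
      _ ≤ ((n + 1) ^ 2 * 16) * 16 ^ n := Nat.mul_le_mul_right _ (by nlinarith)
      _ = _ := by ring

theorem stepProb_lineWalk_two_mul_le (n : ℕ) (u v : ℤ) :
    stepProb lineWalk (2 * n) u v ≤ 1 / √(2 * n + 1) := by
  by_cases h : ∃ j : ℕ, v - u = 2 * j - (2 * n : ℕ)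
  · obtain ⟨j, hj⟩ := h
    rw [(stepProb_lineWalk (2 * n) u v).1 j hj, div_le_div_iff₀ (by positivity) (by positivity),
      one_mul]
    have h1 : ((2 * n).choose j : ℝ) ≤ n.centralBinom := by
      exact_mod_cast Nat.choose_le_centralBinom j n
    have h2 : ((2 * n + 1 : ℝ)) * (n.centralBinom : ℝ) ^ 2 ≤ (2 ^ (2 * n)) ^ 2 := by
      have := mul_centralBinom_sq_le n
      rw [← pow_mul, show 2 * n * 2 = 4 * n by ring, pow_mul]
      norm_num
      exact_mod_cast this
    refine (mul_le_mul_of_nonneg_right h1 (Real.sqrt_nonneg _)).trans ?_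
    refine le_of_sq_le_sq ?_ (by positivity)
    rw [mul_pow, Real.sq_sqrt (by positivity), mul_comm]
    exact h2
  · push Not at h
    rw [(stepProb_lineWalk (2 * n) u v).2 h]
    positivity

theorem hasSqrtDecay_lineWalk : HasSqrtDecay lineWalk 1 := by
  refine ⟨one_pos, fun k hk _ u v => ?_⟩
  rw [rpow_neg_half _ (Nat.cast_nonneg k), one_mul]
  rcases Nat.even_or_odd' k with ⟨n, rfl | rfl⟩
  · refine (stepProb_lineWalk_two_mul_le n u v).trans ?_
    have : (0 : ℝ) < (2 * n : ℕ) := by exact_mod_cast hk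
    refine one_div_le_one_div_of_le (Real.sqrt_pos.2 this) (Real.sqrt_le_sqrt ?_)
    push_cast
    linarith
  -- At an odd time the probability is an average of two at the even time before, and the bound `1 /
  -- √(2 n + 1)` is already the one required at time `2 n + 1`.
  · rw [stepProb_lineWalk_succ]
    have h1 := stepProb_lineWalk_two_mul_le n (u - 1) v
    have h2 := stepProb_lineWalk_two_mul_le n (u + 1) v
    push_cast
    linarith

theorem isReversibleWrt_lineWalk : IsReversibleWrt lineWalk (fun _ => 1) :=
  ⟨fun _ => one_pos, fun v w => by simp only [lineWalk, abs_sub_comm]⟩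

theorem isSupRatio_one : IsSupRatio (fun _ : ℤ => (1 : ℝ)) 1 := by
  unfold IsSupRatio
  simp only [div_one, Set.range_const]
  exact isLUB_singleton

/-- The mean is carried along because recentring from `u ± 1` to `u` in the second moment produces
cross terms. -/
theorem hasSum_stepProb_lineWalk_moments (n : ℕ) (u : ℤ) :
    HasSum (fun v : ℤ => stepProb lineWalk n u v * ((v : ℝ) - u)) 0 ∧
      HasSum (fun v : ℤ => stepProb lineWalk n u v * ((v : ℝ) - u) ^ 2) n := by
  induction n generalizing u with
  | zero =>
    have h0 : ∀ v : ℤ, v ≠ u → stepProb lineWalk 0 u v = 0 := fun v hv => if_neg (Ne.symm hv)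
    constructor
    · have := hasSum_single (f := fun v : ℤ => stepProb lineWalk 0 u v * ((v : ℝ) - u)) u
        fun v hv => by simp [h0 v hv]
      simpa using this
    · have := hasSum_single (f := fun v : ℤ => stepProb lineWalk 0 u v * ((v : ℝ) - u) ^ 2) u
        fun v hv => by simp [h0 v hv]
      simpa using this
  | succ n ih =>
    obtain ⟨a1, a2⟩ := ih (u - 1)
    obtain ⟨b1, b2⟩ := ih (u + 1)
    have a0 := hasSum_stepProb isStochasticMatrix_lineWalk n (u - 1)
    have b0 := hasSum_stepProb isStochasticMatrix_lineWalk n (u + 1)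
    constructor
    · convert! ((a1.sub a0).add (b1.add b0)).mul_right (1 / 2) using 1
      · ext v
        rw [stepProb_lineWalk_succ]
        push_cast
        ring
      · norm_num
    · convert! (((a2.sub (a1.mul_left 2)).add a0).add ((b2.add (b1.mul_left 2)).add b0)).mul_right
        (1 / 2) using 1
      · ext v
        rw [stepProb_lineWalk_succ]
        push_cast
        ring
      · push_cast
        ring

theorem hasSum_poisson_mul (t : ℝ) :
    HasSum (fun n : ℕ => Real.exp (-t) * (t ^ n / n.factorial) * n) t := by
  rw [← hasSum_nat_add_iff' 1]
  convert! (hasSum_poisson t).mul_left t using 1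
  · ext n
    have : (n.factorial : ℝ) ≠ 0 := by positivity
    rw [Nat.factorial_succ]
    push_cast
    field_simp
    ring
  · simp

theorem tsum_lintegral_occupation_mul_sq {t : ℝ} (ht : 0 ≤ t) (o : ℤ) :
    ∑' v : ℤ, (∫⁻ g, occupation lineWalk t o v g ∂clocksLaw ℤ) *
      ENNReal.ofReal (((v : ℝ) - o) ^ 2) = ENNReal.ofReal t := by
  simp_rw [lintegral_occupation isStochasticMatrix_lineWalk ht, ← ENNReal.tsum_mul_right]
  rw [ENNReal.tsum_comm, ← tsum_ofReal_eq (fun n => by positivity) (hasSum_poisson_mul t)]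
  refine tsum_congr fun n => ?_
  have h0 := stepProb_nonneg isStochasticMatrix_lineWalk n o
  simp_rw [mul_assoc (ENNReal.ofReal _)]
  rw [ENNReal.tsum_mul_left, ENNReal.ofReal_mul (q := (n : ℝ)) (by positivity),
    ← tsum_ofReal_eq (fun v => mul_nonneg (h0 v) (sq_nonneg _))
      (hasSum_stepProb_lineWalk_moments n o).2]
  congr 1
  exact tsum_congr fun v => (ENNReal.ofReal_mul (h0 v)).symm

/-- A probability measure on the integers with second moment `t` about `o` has collision
probability at least a constant times `t ^ (-1 / 2)`. -/
theorem le_tsum_sq_of_second_moment {p : ℤ → ℝ≥0∞} {o : ℤ} {t : ℝ} (ht : 1 ≤ t)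
    (h1 : ∑' v, p v = 1) (h2 : ∑' v : ℤ, p v * ENNReal.ofReal (((v : ℝ) - o) ^ 2) =
      ENNReal.ofReal t) : ENNReal.ofReal (1 / 24 * (1 / √t)) ≤ ∑' v, p v ^ 2 := by
  have ht0 : 0 < t := by linarith
  -- By Chebyshev the mass outside radius `R` is at most `t / R² ≤ 1/2`.
  set R : ℕ := ⌈√(2 * t)⌉₊ with hR
  have hR1 : √(2 * t) ≤ R := Nat.le_ceil _
  have hR2 : (R : ℝ) ≤ √(2 * t) + 1 := (Nat.ceil_lt_add_one (Real.sqrt_nonneg _)).le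
  have hRpos : (0 : ℝ) < R := (Real.sqrt_pos.2 (by linarith)).trans_le hR1
  have hRsq : 2 * t ≤ (R : ℝ) ^ 2 := by
    rw [← Real.sq_sqrt (by linarith : (0 : ℝ) ≤ 2 * t)]
    exact pow_le_pow_left₀ (Real.sqrt_nonneg _) hR1 2
  set S : Finset ℤ := Finset.Icc (o - R) (o + R) with hS
  have hcard : (S.card : ℝ) = 2 * R + 1 := by
    have : S.card = 2 * R + 1 := by rw [hS, Int.card_Icc]; omega
    rw [this]; push_cast; ring
  have hpt : ∀ v, p v ≤ (if v ∈ S then p v else 0) +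
      p v * ENNReal.ofReal (((v : ℝ) - o) ^ 2) * ENNReal.ofReal (1 / (R : ℝ) ^ 2) := fun v => by
    split_ifs with hv
    · exact le_self_add
    · rw [zero_add, mul_assoc, ← ENNReal.ofReal_mul (sq_nonneg _)]
      refine le_mul_of_one_le_right' ?_
      rw [ENNReal.one_le_ofReal, mul_one_div, one_le_div (by positivity)]
      rw [hS, Finset.mem_Icc, not_and_or, not_le, not_le] at hv
      rw [← sq_abs ((v : ℝ) - o)]
      refine pow_le_pow_left₀ hRpos.le ?_ 2
      rcases hv with hv | hv
      · have : (v : ℝ) < o - R := by exact_mod_cast hv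
        rw [le_abs]; right; linarith
      · have : (o : ℝ) + R < v := by exact_mod_cast hv
        rw [le_abs]; left; linarith
  have hsum : 1 ≤ ∑ v ∈ S, p v + ENNReal.ofReal (1 / 2) := by
    have h := ENNReal.tsum_le_tsum hpt
    rw [ENNReal.tsum_add, ENNReal.tsum_mul_right, h1, h2, ← ENNReal.ofReal_mul ht0.le] at h
    have e : ∑' v, (if v ∈ S then p v else 0) = ∑ v ∈ S, p v := by
      rw [tsum_eq_sum (s := S) fun v hv => if_neg hv]
      exact Finset.sum_congr rfl fun v hv => if_pos hv
    rw [e] at h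
    refine h.trans (add_le_add_right (ENNReal.ofReal_le_ofReal ?_) _)
    rw [mul_one_div, div_le_iff₀ (by positivity)]
    linarith
  have hp1 : ∀ v, p v ≠ ∞ := fun v =>
    ne_top_of_le_ne_top ENNReal.one_ne_top (h1 ▸ ENNReal.le_tsum v)
  have hp : ∀ v, p v = ENNReal.ofReal (p v).toReal := fun v => (ENNReal.ofReal_toReal (hp1 v)).symm
  set q : ℤ → ℝ := fun v => (p v).toReal
  have hq : ∀ v, 0 ≤ q v := fun v => ENNReal.toReal_nonneg
  have hqs : 1 / 2 ≤ ∑ v ∈ S, q v := by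
    have e : ∑ v ∈ S, p v = ENNReal.ofReal (∑ v ∈ S, q v) := by
      rw [ENNReal.ofReal_sum_of_nonneg fun v _ => hq v]
      exact Finset.sum_congr rfl fun v _ => hp v
    rw [e, ← ENNReal.ofReal_add (Finset.sum_nonneg fun v _ => hq v) (by norm_num),
      ENNReal.one_le_ofReal] at hsum
    linarith
  have hcs : (∑ v ∈ S, q v) ^ 2 ≤ (S.card : ℝ) * ∑ v ∈ S, q v ^ 2 := sq_sum_le_card_mul_sum_sq
  have hst : 1 ≤ √t := Real.one_le_sqrt.2 ht
  have hs2 : √(2 * t) ≤ 3 / 2 * √t := by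
    rw [Real.sqrt_mul (by norm_num)]
    refine mul_le_mul_of_nonneg_right ?_ (Real.sqrt_nonneg _)
    rw [Real.sqrt_le_left (by norm_num)]
    norm_num
  have hfin : 1 / 24 * (1 / √t) ≤ ∑ v ∈ S, q v ^ 2 := by
    have hQ : 0 ≤ ∑ v ∈ S, q v ^ 2 := Finset.sum_nonneg fun v _ => sq_nonneg _
    -- The interval has `2 R + 1 ≤ 2 √(2 t) + 3 ≤ 6 √t` points as `t ≥ 1`. Cauchy–Schwarz then gives
    -- the constant `1/24 = (1/2)² / 6`.
    have h3 : (1 / 2 : ℝ) ^ 2 ≤ (6 * √t) * ∑ v ∈ S, q v ^ 2 := by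
      refine (pow_le_pow_left₀ (by norm_num) hqs 2).trans (hcs.trans ?_)
      refine mul_le_mul_of_nonneg_right ?_ hQ
      rw [hcard]
      linarith
    rw [mul_one_div, div_le_iff₀ (by linarith)]
    linarith
  calc ENNReal.ofReal (1 / 24 * (1 / √t)) ≤ ENNReal.ofReal (∑ v ∈ S, q v ^ 2) :=
        ENNReal.ofReal_le_ofReal hfin
    _ = ∑ v ∈ S, p v ^ 2 := by
        rw [ENNReal.ofReal_sum_of_nonneg fun v _ => sq_nonneg _]
        refine Finset.sum_congr rfl fun v _ => ?_
        rw [hp v, ← ENNReal.ofReal_pow (hq v)]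
    _ ≤ ∑' v, p v ^ 2 := ENNReal.sum_le_tsum S

theorem le_fragmentationSecondMoment_lineWalk {Ω : Type*} [MeasurableSpace Ω] {μ : Measure Ω}
    [IsProbabilityMeasure μ] {gap : ℤ → ℕ → Ω → ℝ} {Y : ℕ → Ω → ℤ} {o : ℤ}
    (h : IsClockedWalk μ lineWalk o gap Y) {t : ℝ} (ht : 1 ≤ t) :
    ENNReal.ofReal (1 / 24 * t ^ (-(1 / 2) : ℝ)) ≤ fragmentationSecondMoment μ gap Y t := by
  have ht0 : 0 ≤ t := by linarith
  have hP := isStochasticMatrix_lineWalk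
  rw [rpow_neg_half t ht0, h.fragmentationSecondMoment_eq]
  exact (le_tsum_sq_of_second_moment ht (tsum_lintegral_occupation hP ht0 o)
    (tsum_lintegral_occupation_mul_sq ht0 o)).trans
      (ENNReal.tsum_le_tsum fun v => h.sq_lintegral_occupation_le hP ht0 v)

end LineWalk

theorem mainTheorem10 :
    -- the upper bound, with a constant that depends on `C₀` and `Δ` only
    (∀ C₀ Δ : ℝ, ∃ C : ℝ,
      ∀ (V : Type*) [Countable V] [MeasurableSpace V] [DiscreteMeasurableSpace V]
        (P : V → V → ℝ) (π : V → ℝ),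
        IsStochasticMatrix P → HasSqrtDecay P C₀ → IsReversibleWrt P π →
        IsSupRatio π Δ →
        ∀ (o : V) (Ω : Type*) [MeasurableSpace Ω] (μ : Measure Ω) [IsProbabilityMeasure μ]
          (gap : V → ℕ → Ω → ℝ) (Y : ℕ → Ω → V), IsClockedWalk μ P o gap Y →
          ∀ t : ℝ, 0 < t → (Finite V → t ≤ (Nat.card V : ℝ) ^ 2 / 3) →
            fragmentationSecondMoment μ gap Y t ≤ ENNReal.ofReal (C * t ^ (-(1 / 2) : ℝ))) ∧
    -- optimality of the rate: the simple random walk on `ℤ` satisfies the hypotheses and attains it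
    (IsStochasticMatrix lineWalk ∧ (∃ C₀ : ℝ, HasSqrtDecay lineWalk C₀) ∧
      IsReversibleWrt lineWalk (fun _ => 1) ∧ IsSupRatio (fun _ : ℤ => (1 : ℝ)) 1 ∧
      ∃ c : ℝ, 0 < c ∧
        ∀ (o : ℤ) (Ω : Type*) [MeasurableSpace Ω] (μ : Measure Ω) [IsProbabilityMeasure μ]
          (gap : ℤ → ℕ → Ω → ℝ) (Y : ℕ → Ω → ℤ), IsClockedWalk μ lineWalk o gap Y →
          ∀ t : ℝ, 1 ≤ t →
            ENNReal.ofReal (c * t ^ (-(1 / 2) : ℝ)) ≤ fragmentationSecondMoment μ gap Y t) := by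

  refine ⟨exists_fragmentationSecondMoment_le, isStochasticMatrix_lineWalk,
    ⟨1, hasSqrtDecay_lineWalk⟩, isReversibleWrt_lineWalk, isSupRatio_one, 1 / 24, by norm_num, ?_⟩
  intro o Ω _ μ _ gap Y h t ht
  exact le_fragmentationSecondMoment_lineWalk h ht
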